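/- Let $\mathbf k$ be a field of characteristic zero. Linear operators on tensor powers are written on the right and act from left to right. For a linear map $\tau:V\otimes V\to V\otimes V$ let $\tau_i=\mathrm{id}^{\otimes(i-1)}\otimes\tau\otimes\mathrm{id}^{\otimes(n-i-1)}$ on $V^{\otimes n}$, $1\le i<n$; $\tau$ is a *braiding* if $\tau_1\tau_2\tau_1=\tau_2\tau_1\tau_2$ on $V^{\otimes 3}$, and it is *involutive* if $\tau^2=\mathrm{id}$. An $m$-ary operation $M:V^{\otimes m}\to V$ is *braided* if $(M\otimes\mathrm{id})\tau=\tau_m\cdots\tau_1(\mathrm{id}\otimes M)$ and $(\mathrm{id}\otimes M)\tau=\tau_1\cdots\tau_m(M\otimes\mathrm{id})$. For $a\le b$ put $[a;b]=\tau_{b-1}\tau_{b-2}\cdots\tau_a$ (so $[a;a]=\mathrm{id}$). Let $\mathrm{Sh}_n^r$ be the set of $\pi\in S_n$ with $\pi(1)<\dots<\pi(r)$ and $\pi(r+1)<\dots<\pi(n)$, and put $[\pi]=[1;\pi(1)][2;\pi(2)]\cdots[r;\pi(r)]$ for $\pi\in\mathrm{Sh}_n^r$. The subscript $(t)$ denotes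 the index shift $\tau_i\mapsto\tau_{t+i}$. **Braided Hopf algebras.** A *braided (nonassociative) Hopf algebra* is a not necessarily associative unital $\mathbf k$-algebra $B$ with multiplication $\mathbf m$, a braiding $\tau$ on $B$, a coassociative coproduct $\Delta:B\to B\otimes B$ with counit $\varepsilon$, and two bilinear operations $\backslash,/:B\times B\to B$ such that * $(\mathbf m\otimes\mathrm{id})\tau=\tau_2\tau_1(\mathrm{id}\otimes\mathbf m)$ and $(\mathrm{id}\otimes\mathbf m)\tau=\tau_1\tau_2(\mathbf m\otimes\mathrm{id})$; * $\tau(\varepsilon\otimes\mathrm{id})=(\mathrm{id}\otimes\varepsilon)\tau$ and $\tau(\mathrm{id}\otimes\varepsilon)=(\varepsilon\otimes\mathrm{id})\tau$; * $\tau(\mathrm{id}\otimes\Delta)=(\Delta\otimes\mathrm{id})\tau_2\tau_1$ and $\tau(\Delta\otimes\mathrm{id})=(\mathrm{id}\otimes\Delta)\tau_1\tau_2$; * $\Delta(1)=1\otimes1$ and $\Delta(xy)=\Delta(x)\Delta(y)$, where $(a\otimes b)(c\otimes d)=\sum_i ac_i\otimes b_id$ for $(b\otimes c)\tau=\sum_i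 c_i\otimes b_i$; * $\sum x_{(1)}\backslash(x_{(2)}y)=\varepsilon(x)y=\sum x_{(1)}(x_{(2)}\backslash y)$ and $\sum(yx_{(1)})/x_{(2)}=\varepsilon(x)y=\sum(y/x_{(1)})x_{(2)}$. An element $x\in B$ is *primitive* if $\Delta(x)=x\otimes1+1\otimes x$. **Sabinin $\tau$-algebras.** A *Sabinin $\tau$-algebra* is a vector space $A$ with an involutive braiding $\tau$ and braided multilinear operations $S_{m,2}:A^{\otimes(m+2)}\to A$ ($m\ge0$) and $\Phi_{m,n}:A^{\otimes(m+n)}\to A$ ($m\ge1$, $n\ge2$) such that 1. $S_{m,2}+\tau_{m+1}S_{m,2}=0$ for all $m\ge0$; 2. for all $0\le r\le m$, $$S_{m+2,2}-\tau_{r+1}S_{m+2,2}+\sum_{j=0}^{r}\sum_{\pi\in\mathrm{Sh}_r^j}[\pi]\bigl(\mathrm{id}^{\otimes j}\otimes S_{r-j,2}\otimes\mathrm{id}^{\otimes(m-r+2)}\bigr)S_{m-r+j+1,2}=0;$$ 3. for all $m\ge0$, $$(\mathrm{id}+\tau_{m+1}\tau_{m+2}+\tau_{m+2}\tau_{m+1})\Bigl(S_{m+1,2}+\sum_{j=0}^{m}\sum_{\pi\in\mathrm{Sh}_m^j}[\pi]\bigl(\mathrm{id}^{\otimes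 j}\otimes S_{m-j,2}\otimes\mathrm{id}\bigr)S_{j,2}\Bigr)=0;$$ 4. $\Phi_{m,n}-\tau_r\Phi_{m,n}=0$ for all $m\ge1$, $n\ge2$ and $1\le r<m+n$ with $r\ne m$. **The operations.** Let $B$ be a braided Hopf algebra whose braiding $\tau$ is involutive. Let $R_n:B^{\otimes n}\to B$ be the product $u_1\otimes\cdots\otimes u_n\mapsto(\cdots(u_1u_2)\cdots)u_n$, with $R_1=\mathrm{id}$ and $R_0(1)=1$. Define $P_{m,n}:B^{\otimes(m+n+1)}\to B$ for $m,n\ge1$ recursively by $P_{1,1}(x,y,z)=(xy)z-x(yz)$ and $$P_{m,n}=(R_m\otimes R_n\otimes\mathrm{id})P_{1,1}-\sum_{\substack{0\le r<m,\ 0\le s<n\\ r+s>0}}\ \sum_{\pi\in\mathrm{Sh}_m^r}\sum_{\sigma\in\mathrm{Sh}_n^s}[\pi][\sigma]_{(m)}\,\nu_{r,s}\,\bigl(R_r\otimes R_s\otimes P_{m-r,n-s}\bigr)(\mathbf m\otimes\mathrm{id})\mathbf m ,$$ where $\nu_{r,s}=[r+1;m+1][r+2;m+2]\cdots[r+s;m+s]$.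 Put $$S_{0,2}(y,z)=-\bigl((y\otimes z)\mathbf m-(y\otimes z)\tau\mathbf m\bigr),\qquad S_{m,2}=-P_{m,1}+\tau_{m+1}P_{m,1}\quad(m\ge1),$$ $$\Phi_{m,n}=\frac1{m!\,n!}\sum_{\pi\in S_m,\ \sigma\in S_n}\bar\pi\,\bar\sigma_{(m)}\,P_{m,n-1}\quad(m\ge1,\ n\ge2),$$ where $\bar\pi$ is the image of the permutation $\pi$ under the homomorphism sending the transposition $(i,i+1)$ to $\tau_i$. **Corollary 7.1.** Let $B$ be a braided (nonassociative) Hopf algebra with involutive braiding $\tau$ over a field $\mathbf k$ of characteristic zero, and let $\mathfrak A\subseteq B$ be the subspace of primitive elements. Then $\tau$ restricts to a linear map $\mathfrak A\otimes\mathfrak A\to\mathfrak A\otimes\mathfrak A$, the operations $S_{m,2}$ ($m\ge0$) and $\Phi_{m,n}$ ($m\ge1$, $n\ge2$) defined above map tensor powers of $\mathfrak A$ into $\mathfrak A$, and $\mathfrak A$ with the restricted braiding and the restricted operations is a Sabinin $\tau$-algebra. -/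

import Mathlib

open scoped TensorProduct

namespace BraidedSabinin

noncomputable section

/-! Operators are written in the usual Lean order: the operator that acts first stands on the right
of `∘ₗ`. Words in the local braidings are lists that act from left to right. Positions in tensor
powers are counted from `0`, so position `i` here is position `i + 1` in the usual numbering. -/

section TensorPowers

variable {k V : Type*} [Field k] [AddCommGroup V] [Module k V]

/-- The identification `V^{⊗ 1} = V`. -/
def one : (⨂[k]^1) V ≃ₗ[k] V := PiTensorProduct.subsingletonEquiv (0 : Fin 1)

/-- The identification `V ⊗ V = V^{⊗ 2}`. -/
def two : V ⊗[k] V ≃ₗ[k] (⨂[k]^2) V :=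
  (TensorProduct.congr one.symm one.symm).trans
    (TensorPower.mulEquiv : (⨂[k]^1) V ⊗[k] (⨂[k]^1) V ≃ₗ[k] (⨂[k]^(1 + 1)) V)

/-- `f ⊗ g : V^{⊗ (a + b)} → W ⊗ W'`. -/
def tensorMap {W W' : Type*} [AddCommGroup W] [Module k W] [AddCommGroup W'] [Module k W']
    {a b : ℕ} (f : (⨂[k]^a) V →ₗ[k] W) (g : (⨂[k]^b) V →ₗ[k] W') :
    (⨂[k]^(a + b)) V →ₗ[k] W ⊗[k] W' :=
  TensorProduct.map f g ∘ₗ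
    (TensorPower.mulEquiv : (⨂[k]^a) V ⊗[k] (⨂[k]^b) V ≃ₗ[k] (⨂[k]^(a + b)) V).symm.toLinearMap

/-- `id^{⊗ p} ⊗ f ⊗ id^{⊗ q}` for a linear map `f : V^{⊗ a} → V^{⊗ b}`. -/
def idTensorId (p q : ℕ) {a b : ℕ} (f : (⨂[k]^a) V →ₗ[k] (⨂[k]^b) V) {n n' : ℕ}
    (h : n = p + a + q) (h' : p + b + q = n') : (⨂[k]^n) V →ₗ[k] (⨂[k]^n') V :=
  (TensorPower.cast k V h').toLinearMap ∘ₗ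
    (TensorPower.mulEquiv : (⨂[k]^(p + b)) V ⊗[k] (⨂[k]^q) V ≃ₗ[k] _).toLinearMap ∘ₗ
    tensorMap
      ((TensorPower.mulEquiv : (⨂[k]^p) V ⊗[k] (⨂[k]^b) V ≃ₗ[k] _).toLinearMap ∘ₗ
        tensorMap LinearMap.id f)
      LinearMap.id ∘ₗ
    (TensorPower.cast k V h).toLinearMap

/-- The local braiding on `V^{⊗ n}`: `τ` acts on the positions `i, i + 1` (the identity map when
these positions do not exist). -/
def tauAt (τ : V ⊗[k] V →ₗ[k] V ⊗[k] V) (n i : ℕ) : (⨂[k]^n) V →ₗ[k] (⨂[k]^n) V :=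
  if h : i + 2 ≤ n then
    idTensorId i (n - i - 2) (two.toLinearMap ∘ₗ τ ∘ₗ two.symm.toLinearMap)
      (show n = i + 2 + (n - i - 2) by omega) (by omega)
  else LinearMap.id

/-- The local action of a word in the generators of the braid monoid, from left to right. -/
def act (τ : V ⊗[k] V →ₗ[k] V ⊗[k] V) (n : ℕ) : List ℕ → ((⨂[k]^n) V →ₗ[k] (⨂[k]^n) V)
  | [] => LinearMap.id
  | i :: l => act τ n l ∘ₗ tauAt τ n i

end TensorPowers

section Words

/-- For `a ≤ b`, the word `s_{b-1} s_{b-2} ⋯ s_a`, which moves the tensor factor in position `b`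
to position `a`. -/
def moveWord (a b : ℕ) : List ℕ := (List.range' a (b - a)).reverse

/-- The `r`-shuffles in the symmetric group on `n` symbols: permutations that are increasing on the
first `r` symbols and on the last `n - r` symbols. -/
def shuffles (n r : ℕ) : Finset (Equiv.Perm (Fin n)) :=
  Finset.univ.filter fun π =>
    (∀ i j : Fin n, i < j → j.val < r → π i < π j) ∧
    (∀ i j : Fin n, r ≤ i.val → i < j → π i < π j)

/-- The word `[π]` of an `r`-shuffle: for `i = 0, …, r - 1` in turn, move the factor in position
`π i` to position `i`. -/
def shuffleWord {n : ℕ} (r : ℕ) (π : Equiv.Perm (Fin n)) : List ℕ :=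
  ((List.finRange n).filter fun i => i.val < r).flatMap fun i => moveWord i.val (π i).val

/-- The word moving the factors in positions `m, …, m + s - 1` to positions `r, …, r + s - 1`. -/
def blockWord (r m s : ℕ) : List ℕ :=
  (List.range s).flatMap fun j => moveWord (r + j) (m + j)

/-- The index shift `s_i ↦ s_{t + i}` on words. -/
def shift (t : ℕ) (l : List ℕ) : List ℕ := l.map (t + ·)

/-- The transposition of the symbols `i` and `i + 1`. -/
def transposition (n i : ℕ) : Equiv.Perm (Fin n) :=
  if h : i + 1 < n then Equiv.swap ⟨i, by omega⟩ ⟨i + 1, h⟩ else 1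

theorem exists_word {n : ℕ} (π : Equiv.Perm (Fin n)) :
    ∃ l : List ℕ, (∀ i ∈ l, i + 1 < n) ∧ (l.map (transposition n)).prod = π := by
  cases n with
  | zero => exact ⟨[], by simp, Subsingleton.elim _ _⟩
  | succ n =>
    have h : π ∈ Submonoid.closure
        (Set.range fun i : Fin n => Equiv.swap i.castSucc i.succ) := by
      rw [Equiv.Perm.mclosure_swap_castSucc_succ]; trivial
    induction h using Submonoid.closure_induction with
    | mem x hx =>
      obtain ⟨i, rfl⟩ := hx
      refine ⟨[i.val], by simp, ?_⟩
      simp only [transposition, List.map_cons, List.map_nil, List.prod_cons, List.prod_nil, mul_one]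
      rw [dif_pos (by omega)]
      rfl
    | one => exact ⟨[], by simp, by simp⟩
    | mul x y _ _ hx hy =>
      obtain ⟨l, hl, rfl⟩ := hx
      obtain ⟨l', hl', rfl⟩ := hy
      refine ⟨l ++ l', ?_, by simp⟩
      intro i hi
      rcases List.mem_append.1 hi with h | h
      exacts [hl i h, hl' i h]

/-- A word in the adjacent transpositions with product `π`. For an involutive braiding its local
action is the image of `π` under `t_i ↦ τ_i`, and does not depend on the choice of the word. -/
def permWord {n : ℕ} (π : Equiv.Perm (Fin n)) : List ℕ := (exists_word π).choose

end Words

section Structures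

variable {k V : Type*} [Field k] [AddCommGroup V] [Module k V]

/-- `τ ⊗ id` on `V ⊗ V ⊗ V`. -/
def tauOne (τ : V ⊗[k] V →ₗ[k] V ⊗[k] V) : (V ⊗[k] V) ⊗[k] V →ₗ[k] (V ⊗[k] V) ⊗[k] V :=
  τ.rTensor V

/-- `id ⊗ τ` on `V ⊗ V ⊗ V`. -/
def tauTwo (τ : V ⊗[k] V →ₗ[k] V ⊗[k] V) : (V ⊗[k] V) ⊗[k] V →ₗ[k] (V ⊗[k] V) ⊗[k] V :=
  (TensorProduct.assoc k V V V).symm.toLinearMap ∘ₗ τ.lTensor V ∘ₗ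
    (TensorProduct.assoc k V V V).toLinearMap

/-- The braid relation. -/
def IsBraiding (τ : V ⊗[k] V →ₗ[k] V ⊗[k] V) : Prop :=
  tauOne τ ∘ₗ tauTwo τ ∘ₗ tauOne τ = tauTwo τ ∘ₗ tauOne τ ∘ₗ tauTwo τ

/-- An `m`-ary operation that is compatible with the braiding `τ` in both arguments. -/
def IsBraidedOperation (τ : V ⊗[k] V →ₗ[k] V ⊗[k] V) {m : ℕ} (M : (⨂[k]^m) V →ₗ[k] V) : Prop :=
  τ ∘ₗ tensorMap M one.toLinearMap =
    tensorMap one.toLinearMap M ∘ₗ (TensorPower.cast k V (Nat.add_comm m 1)).toLinearMap ∘ₗ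
      act τ (m + 1) (List.range m).reverse ∧
  τ ∘ₗ tensorMap one.toLinearMap M ∘ₗ (TensorPower.cast k V (Nat.add_comm m 1)).toLinearMap =
    tensorMap M one.toLinearMap ∘ₗ act τ (m + 1) (List.range m)

/-- `S m` is the operation `S_{m,2}`, and `Φ m n`, for `m ≥ 1` and `n ≥ 2`, is the operation
`Φ_{m,n}`; the values of `Φ` outside this range play no role. -/
structure IsSabininTauAlgebra (τ : V ⊗[k] V →ₗ[k] V ⊗[k] V)
    (S : ∀ m : ℕ, (⨂[k]^(m + 2)) V →ₗ[k] V)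
    (Φ : ∀ m n : ℕ, (⨂[k]^(m + n)) V →ₗ[k] V) : Prop where
  braiding : IsBraiding τ
  involutive : τ ∘ₗ τ = LinearMap.id
  braided_S : ∀ m, IsBraidedOperation τ (S m)
  braided_Φ : ∀ m n, 1 ≤ m → 2 ≤ n → IsBraidedOperation τ (Φ m n)
  antisymmetry : ∀ m, S m + S m ∘ₗ tauAt τ (m + 2) m = 0
  derivation : ∀ m r (hr : r ≤ m),
    S (m + 2) - S (m + 2) ∘ₗ tauAt τ (m + 2 + 2) r +
      ∑ j : Fin (r + 1), ∑ π ∈ shuffles r j,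
        S (m - r + j + 1) ∘ₗ
          idTensorId j (m - r + 2) (one.symm.toLinearMap ∘ₗ S (r - j))
            (show m + 2 + 2 = j + (r - j + 2) + (m - r + 2) by omega) (by omega) ∘ₗ
          act τ (m + 2 + 2) (shuffleWord j π) = 0
  cyclic : ∀ m,
    (S (m + 1) +
      ∑ j : Fin (m + 1), ∑ π ∈ shuffles m j,
        S j ∘ₗ
          idTensorId j 1 (one.symm.toLinearMap ∘ₗ S (m - j))
            (show m + 1 + 2 = j + (m - j + 2) + 1 by omega) (by omega) ∘ₗ
          act τ (m + 1 + 2) (shuffleWord j π)) ∘ₗ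
      (LinearMap.id + act τ (m + 1 + 2) [m, m + 1] + act τ (m + 1 + 2) [m + 1, m]) = 0
  symmetry : ∀ m n, 1 ≤ m → 2 ≤ n → ∀ r, r + 1 < m + n → r + 1 ≠ m →
    Φ m n - Φ m n ∘ₗ tauAt τ (m + n) r = 0

end Structures

section Hopf

variable {k B : Type*} [Field k] [NonAssocRing B] [Module k B] [IsScalarTower k B B]
  [SMulCommClass k B B]

/-- The multiplication of the braided tensor square: `(a ⊗ b)(c ⊗ d) = ∑ a cᵢ ⊗ bᵢ d` where
`τ (b ⊗ c) = ∑ cᵢ ⊗ bᵢ`. -/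
def braidedMul (τ : B ⊗[k] B →ₗ[k] B ⊗[k] B) :
    (B ⊗[k] B) ⊗[k] (B ⊗[k] B) →ₗ[k] B ⊗[k] B :=
  TensorProduct.map (LinearMap.mul' k B) (LinearMap.mul' k B) ∘ₗ
    (TensorProduct.assoc k B B (B ⊗[k] B)).symm.toLinearMap ∘ₗ
    ((TensorProduct.assoc k B B B).toLinearMap ∘ₗ τ.rTensor B ∘ₗ
      (TensorProduct.assoc k B B B).symm.toLinearMap).lTensor B ∘ₗ
    (TensorProduct.assoc k B B (B ⊗[k] B)).toLinearMap

/-- Compatibility of a (nonassociative) multiplication with a braiding. -/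
structure IsBraidedAlgebra (τ : B ⊗[k] B →ₗ[k] B ⊗[k] B) : Prop where
  braiding : IsBraiding τ
  mul_left : τ ∘ₗ (LinearMap.mul' k B).rTensor B =
    (LinearMap.mul' k B).lTensor B ∘ₗ (TensorProduct.assoc k B B B).toLinearMap ∘ₗ
      tauOne τ ∘ₗ tauTwo τ
  mul_right : τ ∘ₗ (LinearMap.mul' k B).lTensor B ∘ₗ (TensorProduct.assoc k B B B).toLinearMap =
    (LinearMap.mul' k B).rTensor B ∘ₗ tauTwo τ ∘ₗ tauOne τ

variable [Coalgebra k B]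

/-- Compatibility of a coassociative coalgebra structure with a braiding. -/
structure IsBraidedCoalgebra (τ : B ⊗[k] B →ₗ[k] B ⊗[k] B) : Prop where
  counit_left : (TensorProduct.lid k B).toLinearMap ∘ₗ
      (Coalgebra.counit : B →ₗ[k] k).rTensor B ∘ₗ τ =
    (TensorProduct.rid k B).toLinearMap ∘ₗ (Coalgebra.counit : B →ₗ[k] k).lTensor B
  counit_right : (TensorProduct.rid k B).toLinearMap ∘ₗ
      (Coalgebra.counit : B →ₗ[k] k).lTensor B ∘ₗ τ =
    (TensorProduct.lid k B).toLinearMap ∘ₗ (Coalgebra.counit : B →ₗ[k] k).rTensor B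
  comul_right : (TensorProduct.assoc k B B B).symm.toLinearMap ∘ₗ
      (Coalgebra.comul : B →ₗ[k] B ⊗[k] B).lTensor B ∘ₗ τ =
    tauOne τ ∘ₗ tauTwo τ ∘ₗ (Coalgebra.comul : B →ₗ[k] B ⊗[k] B).rTensor B
  comul_left : (Coalgebra.comul : B →ₗ[k] B ⊗[k] B).rTensor B ∘ₗ τ =
    tauTwo τ ∘ₗ tauOne τ ∘ₗ (TensorProduct.assoc k B B B).symm.toLinearMap ∘ₗ
      (Coalgebra.comul : B →ₗ[k] B ⊗[k] B).lTensor B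

/-- A braided nonassociative Hopf algebra with left division `ldiv x y = x \ y` and right division
`rdiv x y = x / y`. In the four division identities, `TensorProduct.lift f (comul x)` is
`∑ f x₍₁₎ x₍₂₎`. -/
structure IsBraidedHopfAlgebra (τ : B ⊗[k] B →ₗ[k] B ⊗[k] B) (ldiv rdiv : B →ₗ[k] B →ₗ[k] B) :
    Prop where
  algebra : IsBraidedAlgebra τ
  coalgebra : IsBraidedCoalgebra τ
  comul_one : (Coalgebra.comul (1 : B) : B ⊗[k] B) = 1 ⊗ₜ[k] 1
  comul_mul : ∀ x y : B, (Coalgebra.comul (x * y) : B ⊗[k] B) =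
    braidedMul τ ((Coalgebra.comul x : B ⊗[k] B) ⊗ₜ[k] (Coalgebra.comul y : B ⊗[k] B))
  /-- `∑ x₍₁₎ \ (x₍₂₎ y) = ε(x) y` -/
  ldiv_mul : ∀ x y : B, TensorProduct.lift (ldiv.compl₂ ((LinearMap.mul k B).flip y))
    (Coalgebra.comul x) = (Coalgebra.counit x : k) • y
  /-- `∑ x₍₁₎ (x₍₂₎ \ y) = ε(x) y` -/
  mul_ldiv : ∀ x y : B, TensorProduct.lift ((LinearMap.mul k B).compl₂ (ldiv.flip y))
    (Coalgebra.comul x) = (Coalgebra.counit x : k) • y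
  /-- `∑ (y x₍₁₎) / x₍₂₎ = ε(x) y` -/
  mul_rdiv : ∀ x y : B, TensorProduct.lift (rdiv ∘ₗ LinearMap.mul k B y)
    (Coalgebra.comul x) = (Coalgebra.counit x : k) • y
  /-- `∑ (y / x₍₁₎) x₍₂₎ = ε(x) y` -/
  rdiv_mul : ∀ x y : B, TensorProduct.lift (LinearMap.mul k B ∘ₗ rdiv y)
    (Coalgebra.comul x) = (Coalgebra.counit x : k) • y

variable (k B) in
/-- The subspace of primitive elements. -/
def primitives : Submodule k B where
  carrier := {x | (Coalgebra.comul x : B ⊗[k] B) = x ⊗ₜ[k] 1 + 1 ⊗ₜ[k] x}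
  zero_mem' := by simp
  add_mem' := by
    intro x y hx hy
    simp only [Set.mem_ofPred_eq] at hx hy ⊢
    rw [map_add, hx, hy, TensorProduct.add_tmul, TensorProduct.tmul_add]
    abel
  smul_mem' := by
    intro c x hx
    simp only [Set.mem_ofPred_eq] at hx ⊢
    rw [map_smul, hx, smul_add, TensorProduct.smul_tmul', TensorProduct.tmul_smul]

end Hopf

section Operations

variable {k B : Type*} [Field k] [NonAssocRing B] [Module k B] [IsScalarTower k B B]
  [SMulCommClass k B B]

/-- `(f ⊗ g) 𝐦`, the product of the values of two multilinear operations. -/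
def prodMap {a b : ℕ} (f : (⨂[k]^a) B →ₗ[k] B) (g : (⨂[k]^b) B →ₗ[k] B) :
    (⨂[k]^(a + b)) B →ₗ[k] B :=
  LinearMap.mul' k B ∘ₗ tensorMap f g

/-- The product `(⋯((u₁ u₂) u₃)⋯) u_n`; it is `1` for `n = 0`. -/
def leftProd : (n : ℕ) → ((⨂[k]^n) B →ₗ[k] B)
  | 0 => LinearMap.toSpanSingleton k B 1 ∘ₗ
      (PiTensorProduct.isEmptyEquiv (Fin 0) : (⨂[k]^0) B ≃ₗ[k] k).toLinearMap
  | n + 1 => prodMap (leftProd n) one.toLinearMap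

/-- The braided Shestakov–Umirbaev operation `P_{m,n}`. The terms of the recursion with `r = m` or
`s = n` are absent, in agreement with the convention `P_{0,j} = P_{i,0} = 0`. -/
def P (τ : B ⊗[k] B →ₗ[k] B ⊗[k] B) (m n : ℕ) : (⨂[k]^(m + n + 1)) B →ₗ[k] B :=
  prodMap (prodMap (leftProd m) (leftProd n)) one.toLinearMap -
    prodMap (leftProd m) (prodMap (leftProd n) one.toLinearMap) ∘ₗ
      (TensorPower.cast k B (Nat.add_assoc m n 1)).toLinearMap -
    ∑ r : Fin m, ∑ s : Fin n,
      if h : 0 < r.val + s.val then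
        ∑ π ∈ shuffles m r, ∑ σ ∈ shuffles n s,
          prodMap (prodMap (leftProd r) (leftProd s)) (P τ (m - r) (n - s)) ∘ₗ
            (TensorPower.cast k B
              (show m + n + 1 = r + s + (m - r + (n - s) + 1) by omega)).toLinearMap ∘ₗ
            act τ (m + n + 1)
              (shuffleWord r π ++ shift m (shuffleWord s σ) ++ blockWord r m s)
      else 0
termination_by m + n
decreasing_by omega

/-- The operations `S_{m,2}`: `S_{0,2}` is minus the braided commutator and
`S_{m,2} = -P_{m,1} + τ_{m+1} P_{m,1}` for `m ≥ 1`. -/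
def opS (τ : B ⊗[k] B →ₗ[k] B ⊗[k] B) : (m : ℕ) → ((⨂[k]^(m + 2)) B →ₗ[k] B)
  | 0 => -((LinearMap.mul' k B - LinearMap.mul' k B ∘ₗ τ) ∘ₗ
      (two.symm : (⨂[k]^2) B ≃ₗ[k] B ⊗[k] B).toLinearMap)
  | m + 1 => -P τ (m + 1) 1 + P τ (m + 1) 1 ∘ₗ tauAt τ (m + 1 + 2) (m + 1)

/-- The operations `Φ_{m,n}`, for `n ≥ 1` the symmetrization of `P_{m,n-1}` in the first `m` and in
the last `n` arguments. -/
def opPhi (τ : B ⊗[k] B →ₗ[k] B ⊗[k] B) (m : ℕ) : (n : ℕ) → ((⨂[k]^(m + n)) B →ₗ[k] B)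
  | 0 => 0
  | n + 1 => ((m.factorial : k)⁻¹ * ((n + 1).factorial : k)⁻¹) •
      ∑ π : Equiv.Perm (Fin m), ∑ σ : Equiv.Perm (Fin (n + 1)),
        P τ m n ∘ₗ act τ (m + n + 1) (permWord π ++ shift m (permWord σ))

end Operations

end

end BraidedSabinin

/-! The braided statement is reduced to a classical one, in which arguments may be permuted freely.
For a braided space V the envelope `Env W τ` consists of multilinear maps from tensor powers of V to
W with labelled arguments, where braiding two neighbouring arguments is identified with exchanging
their labels. Concatenation of arguments is a natural, associative and unital external product `Env
W₁ τ` × `Env W₂ τ` → `Env (W₁ ⊗ W₂) τ`, so the envelope of an algebra B is an algebra. If j : V → B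
intertwines τ with the braiding σ of B, the classes `gen τ j a` of j commute up to σ: applying σ to
f ⊗ g gives g ⊗ f. The axioms of a braided algebra extend this to everything they generate
(`IsGen.commute`). On such elements a word in the local braidings merely permutes a list of
arguments (`ap_comp_act`), and a sum over shuffles becomes a sum over the splittings of a list into
two complementary sublists (`sum_shuffles`).

No information is lost. Since τ is an involutive braiding, the symmetric group acts on tensor
powers, and a multilinear map is determined by its class with distinct labels
(`act_sortWord_swapAt`, `mk_range_injective`). Operators that agree on generators with distinct
labels therefore agree on the image of the tensor power of j (`comp_eq_of_ap_gen_eq`). This is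
applied with V = B and j = id for the identities, and with V the space of primitive elements and j
the inclusion for closure under the operations.

In the classical setting the recursion for P says that the associator of two left-normed products
and a letter is a convolution of products with values of P (`assoc_eq_csum`). For a second word of
length one, antisymmetrization gives [u y z] − [u z y] + Σ [u₁] S(u₂; y, z) = 0 (`csum_mul_apS`).
This relation alone implies the derivation and cyclic identities: the convolution of the desired
expression with left-normed products cancels to zero, and a convolution factor whose value on empty
words is a left unit can be removed (`eq_zero_of_csum_eq_zero`). The same cancellation, in the
envelope of B ⊗ B, shows that P takes primitive values on primitive letters (`apP_mem_prims`).

It remains to restrict to the primitive elements. The braiding restricts because their tensor square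
is cut out by the conditions that each tensor factor be primitive, which is flatness over a field
(`exists_restrict_tau`). The axioms then descend along the injective inclusion
(`IsSabininTauAlgebra.restrict`). -/

namespace BraidedSabinin

noncomputable section

/-! ### Local braidings on tensor powers, computed in the tensor algebra -/

section TensorPowerCalculus

variable {k V : Type*} [Field k] [AddCommGroup V] [Module k V]

/-- The embedding of a tensor power in the tensor algebra. -/
abbrev toT {n : ℕ} : (⨂[k]^n) V →ₗ[k] TensorAlgebra k V := TensorPower.toTensorAlgebra

/-- Composed with the isomorphism onto the direct sum of tensor powers, the map is the inclusion of
a summand. Identities between tensors can thus be checked in the tensor algebra, where the product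
is strictly associative and casts disappear. -/
theorem toT_injective {n : ℕ} :
    Function.Injective (toT : (⨂[k]^n) V →ₗ[k] TensorAlgebra k V) := by
  have h : (TensorAlgebra.toDirectSum (R := k) (M := V)).toLinearMap ∘ₗ
      (toT : (⨂[k]^n) V →ₗ[k] TensorAlgebra k V) = DirectSum.lof k ℕ (fun n => (⨂[k]^n) V) n := by
    apply PiTensorProduct.ext
    ext x : 1
    simp only [LinearMap.compMultilinearMap_apply, LinearMap.comp_apply]
    rw [TensorPower.toTensorAlgebra_tprod (R := k)]
    exact TensorAlgebra.toDirectSum_tensorPower_tprod (R := k) x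
  refine Function.Injective.of_comp (f := TensorAlgebra.toDirectSum (R := k) (M := V)) ?_
  have h2 := DirectSum.of_injective (β := fun n : ℕ => (⨂[k]^n) V) n
  intro x y hxy
  apply h2
  have := LinearMap.congr_fun h x
  have h3 := LinearMap.congr_fun h y
  simp only [LinearMap.comp_apply] at this h3
  exact this.symm.trans ((show _ = _ from hxy).trans h3)

theorem toT_cast {a b : ℕ} (h : a = b) (x : (⨂[k]^a) V) :
    toT (TensorPower.cast k V h x) = toT x := by
  subst h; simp

theorem toT_mulEquiv {a b : ℕ} (x : (⨂[k]^a) V) (y : (⨂[k]^b) V) :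
    toT (TensorPower.mulEquiv (x ⊗ₜ[k] y)) = toT x * toT y :=
  TensorPower.toTensorAlgebra_gMul x y

theorem toT_one_symm (v : V) : toT (one.symm v : (⨂[k]^1) V) = TensorAlgebra.ι k v := by
  simp [one, toT, TensorAlgebra.tprod_apply]

theorem toT_two (v w : V) :
    toT (two (v ⊗ₜ[k] w)) = TensorAlgebra.ι k v * TensorAlgebra.ι k w := by
  simp only [two, LinearEquiv.trans_apply, TensorProduct.congr_tmul]
  exact (toT_mulEquiv (a := 1) (b := 1) _ _).trans (by rw [toT_one_symm, toT_one_symm])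

/-- The product of tensor powers, with a free index for the result. -/
def tmul {a b n : ℕ} (h : a + b = n) : (⨂[k]^a) V →ₗ[k] (⨂[k]^b) V →ₗ[k] (⨂[k]^n) V :=
  (TensorProduct.mk k _ _).compr₂
    ((TensorPower.cast k V h).toLinearMap ∘ₗ (TensorPower.mulEquiv.toLinearMap))

theorem tmul_eq {a b n : ℕ} (h : a + b = n) (x : (⨂[k]^a) V) (y : (⨂[k]^b) V) :
    tmul h x y = TensorPower.cast k V h (TensorPower.mulEquiv (x ⊗ₜ[k] y)) := rfl

theorem toT_tmul {a b n : ℕ} (h : a + b = n) (x : (⨂[k]^a) V) (y : (⨂[k]^b) V) :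
    toT (tmul h x y) = toT x * toT y := by
  rw [tmul_eq, toT_cast, toT_mulEquiv]

theorem tmul_induction {a b n : ℕ} (h : a + b = n) {p : (⨂[k]^n) V → Prop}
    (hm : ∀ x y, p (tmul h x y)) (ha : ∀ s t, p s → p t → p (s + t)) (t : (⨂[k]^n) V) : p t := by
  subst h
  obtain ⟨s, rfl⟩ := (TensorPower.mulEquiv (R := k) (M := V) (n := a) (m := b)).surjective t
  induction s using TensorProduct.induction_on with
  | zero => simpa using hm 0 0
  | tmul x y => simpa [tmul_eq] using hm x y
  | add s t hs ht => rw [map_add]; exact ha _ _ hs ht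

theorem mulEquiv_symm_tmul {a b : ℕ} (x : (⨂[k]^a) V) (y : (⨂[k]^b) V) :
    (TensorPower.mulEquiv (R := k) (M := V)).symm (tmul rfl x y) = x ⊗ₜ[k] y := by
  simp [tmul_eq]

theorem tensorMap_tmul {W W' : Type*} [AddCommGroup W] [Module k W] [AddCommGroup W'] [Module k W']
    {a b : ℕ} (f : (⨂[k]^a) V →ₗ[k] W) (g : (⨂[k]^b) V →ₗ[k] W') (x : (⨂[k]^a) V)
    (y : (⨂[k]^b) V) : tensorMap f g (tmul rfl x y) = f x ⊗ₜ[k] g y := by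
  simp only [tensorMap, LinearMap.comp_apply, LinearEquiv.coe_coe, mulEquiv_symm_tmul,
    TensorProduct.map_tmul]

/-- The input enters through its image in the tensor algebra, so that no particular bracketing or
cast has to be matched. -/
theorem toT_idTensorId {p q a b n n' : ℕ} (f : (⨂[k]^a) V →ₗ[k] (⨂[k]^b) V)
    (h : n = p + a + q) (h' : p + b + q = n') (x : (⨂[k]^p) V) (y : (⨂[k]^a) V) (z : (⨂[k]^q) V)
    {t : (⨂[k]^n) V} (ht : toT t = toT x * toT y * toT z) :
    toT (idTensorId p q f h h' t) = toT x * toT (f y) * toT z := by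
  subst h h'
  obtain rfl : t = tmul rfl (tmul rfl x y) z := toT_injective (by rw [ht, toT_tmul, toT_tmul])
  simp only [idTensorId, LinearMap.comp_apply, LinearEquiv.coe_coe, TensorPower.cast_refl,
    LinearEquiv.refl_apply, tensorMap_tmul, toT_mulEquiv, LinearMap.id_apply]

variable (τ : V ⊗[k] V →ₗ[k] V ⊗[k] V)

theorem tauAt_of_not {n i : ℕ} (h : ¬ i + 2 ≤ n) : tauAt τ n i = LinearMap.id := dif_neg h

theorem toT_tauAt {n i q : ℕ} (h : n = i + 2 + q) (x : (⨂[k]^i) V) (y : (⨂[k]^2) V)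
    (z : (⨂[k]^q) V) {t : (⨂[k]^n) V} (ht : toT t = toT x * toT y * toT z) :
    toT (tauAt τ n i t) = toT x * toT (two (τ (two.symm y))) * toT z := by
  obtain rfl : q = n - i - 2 := by omega
  rw [tauAt, dif_pos (by omega)]
  exact toT_idTensorId _ _ _ x y z ht

theorem tauAt_tmul_left {a b n i : ℕ} (h : a + b = n) (hi : i + 2 ≤ a) (x : (⨂[k]^a) V)
    (y : (⨂[k]^b) V) : tauAt τ n i (tmul h x y) = tmul h (tauAt τ a i x) y := by
  obtain ⟨q, rfl⟩ := Nat.exists_eq_add_of_le hi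
  refine tmul_induction (p := fun x => tauAt τ n i (tmul h x y) = tmul h (tauAt τ _ i x) y)
    (a := i + 2) (b := q) rfl ?_ ?_ x
  · intro x x3
    refine tmul_induction (p := fun x => tauAt τ n i (tmul h (tmul rfl x x3) y) =
      tmul h (tauAt τ _ i (tmul rfl x x3)) y) (a := i) (b := 2) rfl ?_ ?_ x
    · intro x1 x2
      apply toT_injective
      rw [toT_tmul, toT_tauAt τ rfl x1 x2 x3 (by rw [toT_tmul, toT_tmul]),
        toT_tauAt τ (q := q + b) (by omega) x1 x2 (tmul rfl x3 y)
          (by simp only [toT_tmul, mul_assoc]), toT_tmul, mul_assoc, mul_assoc, mul_assoc]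
    · intro s t hs ht
      simp only [map_add, LinearMap.add_apply, hs, ht]
  · intro s t hs ht
    simp only [map_add, LinearMap.add_apply, hs, ht]

theorem tauAt_tmul_right {a b n i : ℕ} (h : a + b = n) (hi : i + 2 ≤ b) (x : (⨂[k]^a) V)
    (y : (⨂[k]^b) V) : tauAt τ n (a + i) (tmul h x y) = tmul h x (tauAt τ b i y) := by
  obtain ⟨q, rfl⟩ := Nat.exists_eq_add_of_le hi
  refine tmul_induction (p := fun y => tauAt τ n (a + i) (tmul h x y) = tmul h x (tauAt τ _ i y))
    (a := i + 2) (b := q) rfl ?_ ?_ y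
  · intro y y3
    refine tmul_induction (p := fun y => tauAt τ n (a + i) (tmul h x (tmul rfl y y3)) =
      tmul h x (tauAt τ _ i (tmul rfl y y3))) (a := i) (b := 2) rfl ?_ ?_ y
    · intro y1 y2
      apply toT_injective
      rw [toT_tmul, toT_tauAt τ rfl y1 y2 y3 (by rw [toT_tmul, toT_tmul]),
        toT_tauAt τ (q := q) (by omega) (tmul rfl x y1) y2 y3
          (by simp only [toT_tmul, mul_assoc]), toT_tmul, mul_assoc, mul_assoc, mul_assoc]
    · intro s t hs ht
      simp only [map_add, LinearMap.add_apply, hs, ht]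
  · intro s t hs ht
    simp only [map_add, hs, ht]

/-- Cutting the tensor power after the pair `i, i + 1` puts the two braidings on different factors.
-/
theorem tauAt_comm {n i j : ℕ} (h : i + 2 ≤ j) (t : (⨂[k]^n) V) :
    tauAt τ n i (tauAt τ n j t) = tauAt τ n j (tauAt τ n i t) := by
  by_cases hj : j + 2 ≤ n
  · obtain ⟨d, rfl⟩ := Nat.exists_eq_add_of_le h
    refine tmul_induction (a := i + 2) (b := n - (i + 2)) (by omega)
      (p := fun t => tauAt τ n i (tauAt τ n _ t) = tauAt τ n _ (tauAt τ n i t)) ?_ ?_ t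
    · intro x y
      rw [tauAt_tmul_right τ _ (by omega), tauAt_tmul_left τ _ (by omega),
        tauAt_tmul_left τ _ (by omega), tauAt_tmul_right τ _ (by omega)]
    · intro s t hs ht
      simp only [map_add, hs, ht]
  · simp [tauAt_of_not τ hj]

theorem tauAt_involutive {n i : ℕ} (hτ : τ ∘ₗ τ = LinearMap.id) (t : (⨂[k]^n) V) :
    tauAt τ n i (tauAt τ n i t) = t := by
  have hτ' : ∀ x, τ (τ x) = x := LinearMap.congr_fun hτ
  by_cases hi : i + 2 ≤ n
  · obtain ⟨q, rfl⟩ := Nat.exists_eq_add_of_le hi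
    refine tmul_induction (a := i + 2) (b := q) (by omega)
      (p := fun t => tauAt τ _ i (tauAt τ _ i t) = t) ?_ ?_ t
    · intro x z
      refine tmul_induction (a := i) (b := 2) (by omega)
        (p := fun x => tauAt τ _ i (tauAt τ _ i (tmul _ x z)) = tmul _ x z) ?_ ?_ x
      · intro x y
        apply toT_injective
        rw [toT_tauAt τ rfl x (two (τ (two.symm y))) z, LinearEquiv.symm_apply_apply, hτ',
          LinearEquiv.apply_symm_apply, toT_tmul, toT_tmul]
        rw [toT_tauAt τ rfl x y z]
        rw [toT_tmul, toT_tmul]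
      · intro s t hs ht
        simp only [map_add, LinearMap.add_apply, hs, ht]
    · intro s t hs ht
      simp only [map_add, hs, ht]
  · simp [tauAt_of_not τ hi]

/-- The product map `V ⊗ V ⊗ V → V^{⊗ 3}`. -/
def three : (V ⊗[k] V) ⊗[k] V →ₗ[k] (⨂[k]^3) V :=
  TensorProduct.lift ((tmul (a := 2) (b := 1) rfl).compl₁₂ two.toLinearMap one.symm.toLinearMap)

theorem three_tmul (s : V ⊗[k] V) (v : V) : three (s ⊗ₜ[k] v) = tmul rfl (two s) (one.symm v) :=
  rfl

theorem three_surjective (t : (⨂[k]^3) V) : ∃ s, three s = t := by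
  refine tmul_induction (a := 2) (b := 1) rfl (p := fun t => ∃ s, three s = t) ?_ ?_ t
  · intro x y
    exact ⟨two.symm x ⊗ₜ one y, by rw [three_tmul]; simp⟩
  · rintro s t ⟨s, rfl⟩ ⟨t, rfl⟩
    exact ⟨s + t, map_add _ _ _⟩

theorem tauAt_three_zero (s : (V ⊗[k] V) ⊗[k] V) :
    tauAt τ 3 0 (three s) = three (tauOne τ s) := by
  induction s using TensorProduct.induction_on with
  | zero => simp
  | add s t hs ht => simp only [map_add, hs, ht]
  | tmul s v =>
    rw [three_tmul, tauOne, LinearMap.rTensor_tmul, three_tmul, tauAt_tmul_left τ _ (by omega)]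
    congr 2
    apply toT_injective
    rw [toT_tauAt τ (q := 0) rfl (TensorPower.algebraMap₀ 1) (two s) (TensorPower.algebraMap₀ 1)]
    · simp [TensorPower.algebraMap₀_one]
    · simp [TensorPower.algebraMap₀_one]

theorem toT_three_assoc (v : V) (s : V ⊗[k] V) :
    toT (three ((TensorProduct.assoc k V V V).symm (v ⊗ₜ s))) =
      TensorAlgebra.ι k v * toT (two s) := by
  induction s using TensorProduct.induction_on with
  | zero => simp
  | add s t hs ht => simp only [TensorProduct.tmul_add, map_add, hs, ht, mul_add]
  | tmul s v =>
    simp only [TensorProduct.assoc_symm_tmul, three_tmul, toT_tmul, toT_two, toT_one_symm,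
      mul_assoc]

theorem tauAt_three_one (s : (V ⊗[k] V) ⊗[k] V) :
    tauAt τ 3 1 (three s) = three (tauTwo τ s) := by
  obtain ⟨s, rfl⟩ := (TensorProduct.assoc k V V V).symm.surjective s
  induction s using TensorProduct.induction_on with
  | zero => simp
  | add s t hs ht => simp only [map_add, hs, ht]
  | tmul v s =>
    simp only [tauTwo, LinearMap.comp_apply, LinearEquiv.coe_coe, LinearEquiv.apply_symm_apply,
      LinearMap.lTensor_tmul]
    apply toT_injective
    rw [toT_three_assoc, toT_tauAt τ (q := 0) rfl (one.symm v) (two s) (TensorPower.algebraMap₀ 1)]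
    · simp [TensorPower.algebraMap₀_one, toT_one_symm]
    · simp [TensorPower.algebraMap₀_one, toT_one_symm, toT_three_assoc]

/-- By locality only three consecutive factors matter, and there the claim is the braid relation
itself. -/
theorem tauAt_braid {n i : ℕ} (hb : IsBraiding τ) (hi : i + 3 ≤ n) (t : (⨂[k]^n) V) :
    tauAt τ n i (tauAt τ n (i + 1) (tauAt τ n i t)) =
      tauAt τ n (i + 1) (tauAt τ n i (tauAt τ n (i + 1) t)) := by
  have h3 (t : (⨂[k]^3) V) : tauAt τ 3 0 (tauAt τ 3 1 (tauAt τ 3 0 t)) =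
      tauAt τ 3 1 (tauAt τ 3 0 (tauAt τ 3 1 t)) := by
    obtain ⟨s, rfl⟩ := three_surjective t
    simp only [tauAt_three_one, tauAt_three_zero]
    exact congrArg three (LinearMap.congr_fun hb s)
  obtain ⟨q, rfl⟩ := Nat.exists_eq_add_of_le hi
  refine tmul_induction (a := i) (b := 3 + q) (by omega) (p := fun t =>
    tauAt τ _ i (tauAt τ _ (i + 1) (tauAt τ _ i t)) =
      tauAt τ _ (i + 1) (tauAt τ _ i (tauAt τ _ (i + 1) t))) ?_ ?_ t
  · intro x y
    have h0 := fun y => tauAt_tmul_right τ (i := 0) (show i + (3 + q) = i + 3 + q by omega)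
      (by omega) x y
    simp only [add_zero] at h0
    simp only [h0, tauAt_tmul_right τ (i := 1) (show i + (3 + q) = i + 3 + q by omega)
      (show 1 + 2 ≤ 3 + q by omega)]
    congr 1
    refine tmul_induction (a := 3) (b := q) rfl (p := fun y =>
      tauAt τ _ 0 (tauAt τ _ 1 (tauAt τ _ 0 y)) =
        tauAt τ _ 1 (tauAt τ _ 0 (tauAt τ _ 1 y))) ?_ ?_ y
    · intro y z
      simp only [tauAt_tmul_left τ (i := 0) (show 3 + q = 3 + q from rfl) (by omega),
        tauAt_tmul_left τ (i := 1) (show 3 + q = 3 + q from rfl) (by omega), h3]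
    · intro s t hs ht
      simp only [map_add, hs, ht]
  · intro s t hs ht
    simp only [map_add, hs, ht]

end TensorPowerCalculus

/-! ### Words in adjacent transpositions acting on lists -/

section ListWords

variable {α β : Type*}

/-- Exchange the entries in the positions `i` and `i + 1` of a list. -/
def swapAt : ℕ → List α → List α
  | 0, a :: b :: l => b :: a :: l
  | i + 1, a :: l => a :: swapAt i l
  | _, l => l

/-- The action of a word in adjacent transpositions on lists, from left to right. -/
def applyWord (w : List ℕ) (L : List α) : List α := w.foldl (fun L i => swapAt i L) L

theorem swapAt_append_pair (L₁ L₂ : List α) (a b : α) :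
    swapAt L₁.length (L₁ ++ a :: b :: L₂) = L₁ ++ b :: a :: L₂ := by
  induction L₁ with
  | nil => rfl
  | cons c L₁ ih => simp [swapAt, ih]

theorem swapAt_append_right (L₁ L₂ : List α) (i : ℕ) :
    swapAt (L₁.length + i) (L₁ ++ L₂) = L₁ ++ swapAt i L₂ := by
  induction L₁ with
  | nil => simp
  | cons c L₁ ih => simp [Nat.add_right_comm, swapAt, ih]

theorem exists_pair {L : List α} {i : ℕ} (h : i + 2 ≤ L.length) :
    ∃ L₁ a b L₂, L = L₁ ++ a :: b :: L₂ ∧ L₁.length = i := by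
  refine ⟨L.take i, L[i], L[i + 1], L.drop (i + 2), ?_, ?_⟩
  · rw [← List.drop_eq_getElem_cons, ← List.drop_eq_getElem_cons, List.take_append_drop]
  · simp; omega

theorem swapAt_append_left (L₁ L₂ : List α) {i : ℕ} (h : i + 2 ≤ L₁.length) :
    swapAt i (L₁ ++ L₂) = swapAt i L₁ ++ L₂ := by
  obtain ⟨K, a, b, K', rfl, rfl⟩ := exists_pair h
  rw [swapAt_append_pair, List.append_assoc, List.append_assoc]
  exact swapAt_append_pair _ _ _ _

theorem swapAt_of_not {L : List α} {i : ℕ} (h : ¬ i + 2 ≤ L.length) : swapAt i L = L := by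
  induction i generalizing L with
  | zero => match L, h with
    | [], _ => rfl
    | [a], _ => rfl
    | a :: b :: L, h => simp at h
  | succ i ih => match L, h with
    | [], _ => rfl
    | a :: L, h => simp only [swapAt]; rw [ih]; simpa [Nat.add_right_comm] using h

theorem swapAt_perm (i : ℕ) (L : List α) : (swapAt i L).Perm L := by
  by_cases h : i + 2 ≤ L.length
  · obtain ⟨K, a, b, K', rfl, rfl⟩ := exists_pair h
    rw [swapAt_append_pair]
    exact List.Perm.append_left _ (List.Perm.swap _ _ _)
  · rw [swapAt_of_not h]

@[simp] theorem length_swapAt (i : ℕ) (L : List α) : (swapAt i L).length = L.length :=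
  (swapAt_perm i L).length_eq

theorem map_swapAt (f : α → β) (i : ℕ) (L : List α) :
    (swapAt i L).map f = swapAt i (L.map f) := by
  by_cases h : i + 2 ≤ L.length
  · obtain ⟨K, a, b, K', rfl, rfl⟩ := exists_pair h
    rw [swapAt_append_pair]
    simpa using (swapAt_append_pair (K.map f) (K'.map f) (f a) (f b)).symm
  · rw [swapAt_of_not h, swapAt_of_not (by simpa using h)]

@[simp] theorem applyWord_nil (L : List α) : applyWord [] L = L := rfl

@[simp] theorem applyWord_cons (i : ℕ) (w : List ℕ) (L : List α) :
    applyWord (i :: w) L = applyWord w (swapAt i L) := rfl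

theorem applyWord_append (w w' : List ℕ) (L : List α) :
    applyWord (w ++ w') L = applyWord w' (applyWord w L) := List.foldl_append

theorem applyWord_perm (w : List ℕ) (L : List α) : (applyWord w L).Perm L := by
  induction w generalizing L with
  | nil => rfl
  | cons i w ih => exact (ih _).trans (swapAt_perm i L)

@[simp] theorem length_applyWord (w : List ℕ) (L : List α) :
    (applyWord w L).length = L.length := (applyWord_perm w L).length_eq

theorem applyWord_map (f : α → β) (w : List ℕ) (L : List α) :
    (applyWord w L).map f = applyWord w (L.map f) := by
  induction w generalizing L with
  | nil => rfl
  | cons i w ih => rw [applyWord_cons, ih, map_swapAt, applyWord_cons]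

theorem applyWord_shift (w : List ℕ) (L₁ L₂ : List α) :
    applyWord (shift L₁.length w) (L₁ ++ L₂) = L₁ ++ applyWord w L₂ := by
  induction w generalizing L₂ with
  | nil => rfl
  | cons i w ih => simp only [shift, List.map_cons, applyWord_cons, swapAt_append_right]; exact ih _

theorem applyWord_append_left (w : List ℕ) (L₁ L₂ : List α) (h : ∀ i ∈ w, i + 1 < L₁.length) :
    applyWord w (L₁ ++ L₂) = applyWord w L₁ ++ L₂ := by
  induction w generalizing L₁ with
  | nil => rfl
  | cons i w ih =>
    rw [applyWord_cons, swapAt_append_left _ _ (h i (by simp)), applyWord_cons]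
    exact ih _ (fun j hj => by simpa using h j (by simp [hj]))

theorem moveWord_self (a : ℕ) : moveWord a a = [] := by simp [moveWord]

theorem moveWord_succ {a b : ℕ} (h : a ≤ b) : moveWord a (b + 1) = b :: moveWord a b := by
  rw [moveWord, Nat.succ_sub h, List.range'_concat, List.reverse_append]
  simp [moveWord]; omega

theorem moveWord_succ' {a b : ℕ} (h : a < b) : moveWord a b = moveWord (a + 1) b ++ [a] := by
  obtain ⟨d, rfl⟩ := Nat.exists_eq_add_of_lt h
  simp only [moveWord]
  rw [show a + d + 1 - a = d + 1 by omega, show a + d + 1 - (a + 1) = d by omega,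
    List.range'_succ, List.reverse_cons]

theorem mem_moveWord {a b i : ℕ} : i ∈ moveWord a b ↔ a ≤ i ∧ i < b := by
  simp [moveWord]; omega

theorem shift_moveWord (t a b : ℕ) : shift t (moveWord a b) = moveWord (t + a) (t + b) := by
  simp only [shift, moveWord, List.map_reverse, List.map_add_range']
  congr 2; omega

theorem shift_append (t : ℕ) (l l' : List ℕ) : shift t (l ++ l') = shift t l ++ shift t l' :=
  List.map_append

theorem shift_shift (s t : ℕ) (l : List ℕ) : shift s (shift t l) = shift (s + t) l := by
  simp [shift, Function.comp_def, add_assoc]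

theorem applyWord_moveWord (L₁ L₂ L₃ : List α) (x : α) :
    applyWord (moveWord L₁.length (L₁.length + L₂.length)) (L₁ ++ L₂ ++ x :: L₃) =
      L₁ ++ x :: L₂ ++ L₃ := by
  induction L₂ using List.reverseRecOn generalizing L₃ with
  | nil => simp [moveWord_self]
  | append_singleton L₂ y ih =>
    rw [List.length_append, List.length_singleton, ← Nat.add_assoc,
      moveWord_succ (Nat.le_add_right _ _), applyWord_cons]
    have := swapAt_append_pair (L₁ ++ L₂) L₃ y x
    rw [List.length_append] at this
    rw [show L₁ ++ (L₂ ++ [y]) ++ x :: L₃ = L₁ ++ L₂ ++ y :: x :: L₃ by simp, this, ih]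
    simp

end ListWords

/-! ### Well-definedness of the symmetric group action, via Lehmer codes -/

section Lehmer

variable {k V : Type*} [Field k] [AddCommGroup V] [Module k V]
  (τ : V ⊗[k] V →ₗ[k] V ⊗[k] V) {n : ℕ}

theorem act_append (l l' : List ℕ) : act τ n (l ++ l') = act τ n l' ∘ₗ act τ n l := by
  induction l with
  | nil => rfl
  | cons i l ih => simp only [List.cons_append, act, ih]; rfl

theorem act_singleton (i : ℕ) : act τ n [i] = tauAt τ n i := rfl

theorem act_commute {l : List ℕ} {j : ℕ} (h : ∀ i ∈ l, i + 2 ≤ j ∨ j + 2 ≤ i) :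
    act τ n (l ++ [j]) = act τ n (j :: l) := by
  induction l with
  | nil => rfl
  | cons i l ih =>
    rw [List.cons_append, act, ih (fun i hi => h i (by simp [hi]))]
    simp only [act, LinearMap.comp_assoc]
    congr 1
    ext1
    ext1 x
    rcases h i (by simp) with h | h
    · exact (tauAt_comm τ h _).symm
    · exact (tauAt_comm τ h _)

variable (hb : IsBraiding τ) (hτ : τ ∘ₗ τ = LinearMap.id)

-- A letter slides through the descending word by one braid relation and far commutations, and comes
-- out raised by one.
include hb in
theorem act_cons_moveWord {t p j : ℕ} (hp : t + p + 2 ≤ n) (h : t ≤ j) (h' : j < t + p) :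
    act τ n (j :: moveWord t (t + p + 1)) = act τ n (moveWord t (t + p + 1) ++ [j + 1]) := by
  induction p with
  | zero => omega
  | succ p ih =>
    rw [moveWord_succ (by omega)]
    -- Either `j` commutes with the leading letter `t + p + 1` and induction applies, or `j = t + p`
    -- and the braid relation is used at the head of the word.
    by_cases hj : j < t + p
    · have h1 := ih (by omega) hj
      rw [List.cons_append, act, act, act, ← Nat.add_assoc, ← h1, act, LinearMap.comp_assoc,
        LinearMap.comp_assoc]
      congr 1
      ext1
      ext1 x
      exact (tauAt_comm τ (by omega) _).symm
    · obtain rfl : j = t + p := by omega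
      rw [← Nat.add_assoc, moveWord_succ (by omega), List.cons_append, List.cons_append, act, act,
        act, act, act, act_commute, act]
      · simp only [LinearMap.comp_assoc]
        congr 1
        ext1
        ext1 x
        exact tauAt_braid τ hb (by omega) _
      · intro i hi
        rw [mem_moveWord] at hi
        omega

include hb in
theorem act_append_moveWord {t p : ℕ} (hp : t + p + 2 ≤ n) (l : List ℕ)
    (hl : ∀ j ∈ l, t ≤ j ∧ j < t + p) :
    act τ n (l ++ moveWord t (t + p + 1)) =
      act τ n (moveWord t (t + p + 1) ++ l.map (· + 1)) := by
  induction l with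
  | nil => simp
  | cons j l ih =>
    rw [List.cons_append, act, ih (fun i hi => hl i (by simp [hi])), act_append,
      LinearMap.comp_assoc]
    have := act_cons_moveWord τ hb hp (hl j (by simp)).1 (hl j (by simp)).2
    rw [act] at this
    rw [this, ← act_append, List.map_cons, List.append_assoc]
    rfl

/-- A word that leads from the sorted list to the given list. -/
def sortWord : List ℕ → List ℕ
  | [] => []
  | a :: w => moveWord 0 (w.countP (· < a)) ++ shift 1 (sortWord w)

theorem sortWord_of_pairwise {w : List ℕ} (h : w.Pairwise (· ≤ ·)) : sortWord w = [] := by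
  induction w with
  | nil => rfl
  | cons a w ih =>
    rw [List.pairwise_cons] at h
    have : w.countP (· < a) = 0 := by
      rw [List.countP_eq_zero]
      intro b hb
      simpa using h.1 b hb
    rw [sortWord, this, ih h.2, moveWord_self]
    rfl

-- The ascent case. With `q ≤ p` the numbers of entries of `w` below `a` and below `b`, the code of
-- `a, b` is `(q, p)` and that of `b, a` is `(p + 1, q)`. The new letter commutes past the code of
-- `w` and completes the second move to one of length `p + 1`, through which the first move slides.
include hb in
theorem act_sortWord_lt {a b t : ℕ} {w : List ℕ} (hab : a < b) (hn : t + (w.length + 2) ≤ n) :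
    act τ n (shift t (sortWord (a :: b :: w)) ++ [t]) =
      act τ n (shift t (sortWord (b :: a :: w))) := by
  have h1 : (b :: w).countP (· < a) = w.countP (· < a) := by
    rw [List.countP_cons_of_neg]; simp; omega
  have h2 : (a :: w).countP (· < b) = w.countP (· < b) + 1 := by
    rw [List.countP_cons_of_pos]; simpa using hab
  have h3 : w.countP (· < a) ≤ w.countP (· < b) := by
    apply List.countP_mono_left
    intro x _ hx
    simp at hx ⊢
    omega
  have h4 : w.countP (· < b) ≤ w.length := List.countP_le_length
  simp only [sortWord, h1, h2]
  generalize w.countP (· < a) = q at *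
  generalize w.countP (· < b) = p at *
  simp only [shift_append, shift_shift, shift_moveWord, add_zero, List.append_assoc]
  have h5 : act τ n (shift (t + (1 + 1)) (sortWord w) ++ [t]) =
      act τ n (t :: shift (t + (1 + 1)) (sortWord w)) := by
    apply act_commute
    intro i hi
    simp [shift] at hi
    omega
  have h6 : act τ n (moveWord t (t + q) ++ (moveWord (t + 1) (t + 1 + p) ++ [t])) =
      act τ n (moveWord t (t + (p + 1)) ++ moveWord (t + 1) (t + 1 + q)) := by
    rw [show t + 1 + p = t + p + 1 by omega, ← moveWord_succ' (by omega)]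
    rw [act_append_moveWord τ hb (by omega)]
    · congr 2
      have := shift_moveWord 1 t (t + q)
      rw [show t + 1 = 1 + t by omega, show 1 + t + q = 1 + (t + q) by omega, ← this]
      simp [shift, Nat.add_comm]
    · intro j hj
      rw [mem_moveWord] at hj
      omega
  have h7 : act τ n (moveWord t (t + q) ++ (moveWord (t + 1) (t + (1 + p)) ++
      (shift (t + (1 + 1)) (sortWord w) ++ [t]))) =
      act τ n ((moveWord t (t + q) ++ (moveWord (t + 1) (t + 1 + p) ++ [t])) ++
        shift (t + (1 + 1)) (sortWord w)) := by
    simp only [act_append, ← Nat.add_assoc] at h5 ⊢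
    rw [h5]
    rfl
  rw [h7, act_append, h6, ← act_append, List.append_assoc, Nat.add_assoc t 1 q]

-- This replaces a presentation of the symmetric group: sorting words are compatible with adjacent
-- exchanges, so acting by a sorting word respects the relations of the envelope. Distinct entries
-- are needed, since exchanging equal entries leaves the list unchanged while the braiding need not
-- act trivially.
include hb hτ in
theorem act_sortWord_swapAt (w : List ℕ) (hw : w.Nodup) {t i : ℕ} (hi : i + 2 ≤ w.length)
    (hn : t + w.length ≤ n) :
    act τ n (shift t (sortWord w) ++ [t + i]) = act τ n (shift t (sortWord (swapAt i w))) := by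
  induction w generalizing t i with
  | nil => simp at hi
  | cons a w ih =>
    cases i with
    | succ i =>
      simp only [swapAt, sortWord, shift_append, shift_shift, List.append_assoc]
      rw [(swapAt_perm i w).countP_eq, act_append]
      simp only [List.length_cons] at hn hi
      rw [show t + (i + 1) = t + 1 + i by omega, ih (List.nodup_cons.1 hw).2 (by omega) (by omega),
        ← act_append]
    | zero =>
      match w, hw, hi, hn with
      | [], _, hi, _ => simp at hi
      | b :: w, hw, _, hn =>
        simp only [List.length_cons] at hn
        rcases lt_trichotomy a b with h | h | h
        · exact act_sortWord_lt τ hb h hn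
        · simp [h] at hw
        -- A descent is an ascent read backwards, because the local braiding is its own inverse.
        · have := act_sortWord_lt τ hb h hn
          rw [add_zero, act_append, swapAt, ← this, act_append]
          ext1
          ext1 x
          simp only [LinearMap.compMultilinearMap_apply, LinearMap.comp_apply, act_singleton]
          exact tauAt_involutive τ hτ _

end Lehmer

/-! ### The envelope: labelled multilinear maps up to braiding -/

section Envelope

variable {k V : Type*} [Field k] [AddCommGroup V] [Module k V]

section Tensors

variable {W₁ W₂ W₃ W₁' W₂' : Type*} [AddCommGroup W₁] [Module k W₁] [AddCommGroup W₂] [Module k W₂]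
  [AddCommGroup W₃] [Module k W₃] [AddCommGroup W₁'] [Module k W₁'] [AddCommGroup W₂']
  [Module k W₂']

variable (k V W₁ W₂) in
/-- The map `tensorMap` as a bilinear map. -/
def tensorMapBilin (a b : ℕ) : ((⨂[k]^a) V →ₗ[k] W₁) →ₗ[k] ((⨂[k]^b) V →ₗ[k] W₂) →ₗ[k]
    ((⨂[k]^(a + b)) V →ₗ[k] W₁ ⊗[k] W₂) :=
  (TensorProduct.mapBilinear (RingHom.id k) ((⨂[k]^a) V) ((⨂[k]^b) V) W₁ W₂).compr₂
    (LinearMap.lcomp k _ (TensorPower.mulEquiv (R := k) (M := V)).symm.toLinearMap)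

theorem tensorMapBilin_apply {a b : ℕ} (f : (⨂[k]^a) V →ₗ[k] W₁) (g : (⨂[k]^b) V →ₗ[k] W₂) :
    tensorMapBilin k V W₁ W₂ a b f g = tensorMap f g := rfl

theorem hom_ext_tmul {a b n : ℕ} (h : a + b = n) {f g : (⨂[k]^n) V →ₗ[k] W₁}
    (H : ∀ x y, f (tmul h x y) = g (tmul h x y)) : f = g := by
  ext1
  ext1 x
  exact tmul_induction h (p := fun t => f t = g t) H
    (fun s t hs ht => by rw [map_add, map_add, hs, ht]) _

theorem tensorMap_tauAt_left (τ : V ⊗[k] V →ₗ[k] V ⊗[k] V) {a b i : ℕ} (hi : i + 2 ≤ a)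
    (f : (⨂[k]^a) V →ₗ[k] W₁) (g : (⨂[k]^b) V →ₗ[k] W₂) :
    tensorMap (f ∘ₗ tauAt τ a i) g = tensorMap f g ∘ₗ tauAt τ (a + b) i := by
  refine hom_ext_tmul rfl fun x y => ?_
  rw [LinearMap.comp_apply, tauAt_tmul_left τ rfl hi, tensorMap_tmul, tensorMap_tmul]
  rfl

theorem tensorMap_tauAt_right (τ : V ⊗[k] V →ₗ[k] V ⊗[k] V) {a b i : ℕ} (hi : i + 2 ≤ b)
    (f : (⨂[k]^a) V →ₗ[k] W₁) (g : (⨂[k]^b) V →ₗ[k] W₂) :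
    tensorMap f (g ∘ₗ tauAt τ b i) = tensorMap f g ∘ₗ tauAt τ (a + b) (a + i) := by
  refine hom_ext_tmul rfl fun x y => ?_
  rw [LinearMap.comp_apply, tauAt_tmul_right τ rfl hi, tensorMap_tmul, tensorMap_tmul]
  rfl

theorem map_comp_tensorMap {a b : ℕ} (φ : W₁ →ₗ[k] W₁') (ψ : W₂ →ₗ[k] W₂')
    (f : (⨂[k]^a) V →ₗ[k] W₁) (g : (⨂[k]^b) V →ₗ[k] W₂) :
    TensorProduct.map φ ψ ∘ₗ tensorMap f g = tensorMap (φ ∘ₗ f) (ψ ∘ₗ g) := by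
  refine hom_ext_tmul rfl fun x y => ?_
  simp [tensorMap_tmul]

theorem assoc_comp_tensorMap {a b c : ℕ} (f : (⨂[k]^a) V →ₗ[k] W₁) (g : (⨂[k]^b) V →ₗ[k] W₂)
    (h : (⨂[k]^c) V →ₗ[k] W₃) :
    (TensorProduct.assoc k W₁ W₂ W₃).toLinearMap ∘ₗ tensorMap (tensorMap f g) h =
      tensorMap f (tensorMap g h) ∘ₗ (TensorPower.cast k V (Nat.add_assoc a b c)).toLinearMap := by
  refine hom_ext_tmul rfl fun x z => ?_
  refine tmul_induction (a := a) (b := b) rfl (p := fun x =>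
    ((TensorProduct.assoc k W₁ W₂ W₃).toLinearMap ∘ₗ tensorMap (tensorMap f g) h) (tmul rfl x z) =
      (tensorMap f (tensorMap g h) ∘ₗ (TensorPower.cast k V (Nat.add_assoc a b c)).toLinearMap)
        (tmul rfl x z)) ?_ ?_ x
  · intro x y
    have : TensorPower.cast k V (Nat.add_assoc a b c) (tmul rfl (tmul rfl x y) z) =
        tmul rfl x (tmul rfl y z) := by
      apply toT_injective
      simp only [toT_cast, toT_tmul, mul_assoc]
    simp only [LinearMap.comp_apply, tensorMap_tmul, LinearEquiv.coe_coe, this,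
      TensorProduct.assoc_tmul]
  · intro s t hs ht
    simp only [map_add, LinearMap.add_apply, hs, ht]

end Tensors

variable (W : Type*) [AddCommGroup W] [Module k W] (τ : V ⊗[k] V →ₗ[k] V ⊗[k] V)

variable (k V) in
/-- Labelled multilinear maps. -/
abbrev PreEnv : Type _ := DirectSum (List ℕ) fun w => (⨂[k]^w.length) V →ₗ[k] W

variable {W}

/-- A multilinear map with arguments labelled by the entries of `w`. -/
def preMk {n : ℕ} (w : List ℕ) (h : w.length = n) : ((⨂[k]^n) V →ₗ[k] W) →ₗ[k] PreEnv k V W :=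
  DirectSum.lof k (List ℕ) (fun w => (⨂[k]^w.length) V →ₗ[k] W) w ∘ₗ
    LinearMap.lcomp k W (TensorPower.cast k V h).toLinearMap

variable (W) in
/-- The relations that identify the exchange of two labels with the action of the braiding. -/
def envRel : Submodule k (PreEnv k V W) :=
  Submodule.span k {x | ∃ (w : List ℕ) (i : ℕ) (f : (⨂[k]^w.length) V →ₗ[k] W),
    i + 2 ≤ w.length ∧
      x = preMk w rfl (f ∘ₗ tauAt τ w.length i) - preMk (swapAt i w) (length_swapAt i w) f}

variable (W) in
/-- The envelope of `W` with respect to a braided space `V`: multilinear maps `V^{⊗ n} → W` with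
labelled arguments, up to simultaneous permutation of arguments and labels. -/
def Env : Type _ := PreEnv k V W ⧸ envRel W τ

instance : AddCommGroup (Env W τ) := inferInstanceAs (AddCommGroup (PreEnv k V W ⧸ envRel W τ))

instance : Module k (Env W τ) := inferInstanceAs (Module k (PreEnv k V W ⧸ envRel W τ))

namespace Env

variable (W) in
/-- The quotient map onto the envelope. -/
def quot : PreEnv k V W →ₗ[k] Env W τ := (envRel W τ).mkQ

/-- The class of a multilinear map with labelled arguments. -/
def mk {n : ℕ} (w : List ℕ) (h : w.length = n) : ((⨂[k]^n) V →ₗ[k] W) →ₗ[k] Env W τ :=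
  quot W τ ∘ₗ preMk w h

variable {τ}

theorem mk_congr {n n' : ℕ} {w w' : List ℕ} (hw : w = w') {h : w.length = n} {h' : w'.length = n'}
    {f : (⨂[k]^n) V →ₗ[k] W} {f' : (⨂[k]^n') V →ₗ[k] W} (hn : n = n')
    (hf : f = f' ∘ₗ (TensorPower.cast k V hn).toLinearMap) : mk τ w h f = mk τ w' h' f' := by
  subst hw hn
  subst hf
  congr 1
  ext1; ext1 x; simp

/-- For positions out of range both the braiding and the exchange are trivial, so no bound on `i` is
required. -/
theorem mk_comp_tauAt {n : ℕ} (w : List ℕ) (h : w.length = n) (f : (⨂[k]^n) V →ₗ[k] W) (i : ℕ) :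
    mk τ w h (f ∘ₗ tauAt τ n i) = mk τ (swapAt i w) ((length_swapAt i w).trans h) f := by
  by_cases hi : i + 2 ≤ w.length
  · subst h
    rw [← sub_eq_zero]
    exact (Submodule.Quotient.mk_eq_zero _).2 (Submodule.subset_span ⟨w, i, f, hi, rfl⟩)
  · rw [tauAt_of_not τ (h ▸ hi)]
    exact mk_congr (swapAt_of_not hi).symm rfl (by ext1; ext1 x; simp)

theorem induction {p : Env W τ → Prop} (hm : ∀ w (f : (⨂[k]^w.length) V →ₗ[k] W), p (mk τ w rfl f))
    (ha : ∀ x y, p x → p y → p (x + y)) (x : Env W τ) : p x := by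
  obtain ⟨x, rfl⟩ : ∃ y, quot W τ y = x := (envRel W τ).mkQ_surjective x
  induction x using DirectSum.induction_on with
  | zero =>
    have := hm [] 0
    rwa [map_zero] at this
  | of w f =>
    have := hm w f
    rw [mk, LinearMap.comp_apply] at this
    convert this
    simp only [preMk, LinearMap.comp_apply, DirectSum.lof_eq_of]
    congr 1
    ext1; ext1 x; simp
  | add x y hx hy => rw [map_add]; exact ha _ _ hx hy

theorem hom_ext {U : Type*} [AddCommGroup U] [Module k U] {f g : Env W τ →ₗ[k] U}
    (h : ∀ n w (hw : List.length w = n) (φ : (⨂[k]^n) V →ₗ[k] W),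
      f (mk τ w hw φ) = g (mk τ w hw φ)) : f = g := by
  ext x
  induction x using induction with
  | hm w φ => exact h _ w rfl φ
  | ha x y hx hy => rw [map_add, map_add, hx, hy]

/-- Linear maps on the envelope. -/
def lift {U : Type*} [AddCommGroup U] [Module k U]
    (φ : ∀ w : List ℕ, ((⨂[k]^w.length) V →ₗ[k] W) →ₗ[k] U)
    (hφ : ∀ w i (f : (⨂[k]^w.length) V →ₗ[k] W), i + 2 ≤ w.length →
      φ w (f ∘ₗ tauAt τ w.length i) =
        φ (swapAt i w) (f ∘ₗ (TensorPower.cast k V (length_swapAt i w)).toLinearMap)) :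
    Env W τ →ₗ[k] U :=
  (envRel W τ).liftQ (DirectSum.toModule k (List ℕ) U φ) <| by
    rw [envRel, Submodule.span_le]
    rintro _ ⟨w, i, f, hi, rfl⟩
    rw [SetLike.mem_coe, LinearMap.mem_ker, map_sub, sub_eq_zero]
    simp only [preMk, LinearMap.comp_apply, DirectSum.toModule_lof, LinearMap.lcomp_apply']
    rw [← hφ w i f hi]
    congr 1
    ext1; ext1 x; simp

theorem lift_mk {U : Type*} [AddCommGroup U] [Module k U]
    (φ : ∀ w : List ℕ, ((⨂[k]^w.length) V →ₗ[k] W) →ₗ[k] U) (hφ) {n : ℕ} (w : List ℕ)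
    (h : w.length = n) (f : (⨂[k]^n) V →ₗ[k] W) :
    lift (τ := τ) φ hφ (mk τ w h f) = φ w (f ∘ₗ (TensorPower.cast k V h).toLinearMap) := by
  rw [mk, LinearMap.comp_apply, lift]
  refine (Submodule.liftQ_apply (envRel W τ) _ (preMk w h f)).trans ?_
  rw [preMk, LinearMap.comp_apply, DirectSum.toModule_lof]
  rfl

variable {W₁ W₂ W₃ W₁' W₂' : Type*} [AddCommGroup W₁] [Module k W₁] [AddCommGroup W₂] [Module k W₂]
  [AddCommGroup W₃] [Module k W₃] [AddCommGroup W₁'] [Module k W₁'] [AddCommGroup W₂']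
  [Module k W₂']

variable (τ) in
/-- Functoriality of the envelope. -/
def map (g : W₁ →ₗ[k] W₂) : Env W₁ τ →ₗ[k] Env W₂ τ :=
  lift (fun w => mk τ w rfl ∘ₗ LinearMap.compRight k g) fun w i f _ => by
    simp only [LinearMap.comp_apply, LinearMap.compRight_apply, ← LinearMap.comp_assoc]
    rw [mk_comp_tauAt]
    exact mk_congr rfl (length_swapAt i w).symm (by ext1; ext1 x; simp)

theorem map_mk (g : W₁ →ₗ[k] W₂) {n : ℕ} (w : List ℕ) (h : w.length = n)
    (f : (⨂[k]^n) V →ₗ[k] W₁) : map τ g (mk τ w h f) = mk τ w h (g ∘ₗ f) := by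
  rw [map, lift_mk]
  exact mk_congr rfl h rfl

theorem map_comp (g' : W₂ →ₗ[k] W₃) (g : W₁ →ₗ[k] W₂) : map τ (g' ∘ₗ g) = map τ g' ∘ₗ map τ g :=
  hom_ext fun n w hw f => by simp only [LinearMap.comp_apply, map_mk, LinearMap.comp_assoc]

theorem map_map (g' : W₂ →ₗ[k] W₃) (g : W₁ →ₗ[k] W₂) (x : Env W₁ τ) :
    map τ g' (map τ g x) = map τ (g' ∘ₗ g) x := by rw [map_comp]; rfl

theorem map_id : map τ (LinearMap.id : W₁ →ₗ[k] W₁) = LinearMap.id :=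
  hom_ext fun n w hw f => by simp only [map_mk, LinearMap.id_comp, LinearMap.id_apply]

theorem map_add (g g' : W₁ →ₗ[k] W₂) : map τ (g + g') = map τ g + map τ g' :=
  hom_ext fun n w hw f => by
    simp only [map_mk, LinearMap.add_comp, LinearMap.add_apply, _root_.map_add]

theorem map_smul (c : k) (g : W₁ →ₗ[k] W₂) : map τ (c • g) = c • map τ g :=
  hom_ext fun n w hw f => by
    simp only [map_mk, LinearMap.smul_comp, LinearMap.smul_apply, _root_.map_smul]

theorem mk_tensorMap_cast {n n' : ℕ} (w w' : List ℕ) (h : w.length = n) (h' : w'.length = n')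
    (f : (⨂[k]^n) V →ₗ[k] W₁) (g : (⨂[k]^n') V →ₗ[k] W₂) :
    mk τ (w ++ w') List.length_append
      (tensorMap (f ∘ₗ (TensorPower.cast k V h).toLinearMap)
        (g ∘ₗ (TensorPower.cast k V h').toLinearMap)) =
      mk τ (w ++ w') (by rw [List.length_append, h, h']) (tensorMap f g) := by
  subst h h'
  congr 2 <;> (ext1; ext1 x; simp)

variable (τ) in
/-- The external product of envelopes. -/
def prod : Env W₁ τ →ₗ[k] Env W₂ τ →ₗ[k] Env (W₁ ⊗[k] W₂) τ :=
  lift (fun w => LinearMap.flip (lift (fun w' => LinearMap.flip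
      ((tensorMapBilin k V W₁ W₂ w.length w'.length).compr₂
        (mk τ (w ++ w') List.length_append)))
      (fun w' i g hi => by
        ext1 f
        simp only [LinearMap.flip_apply, LinearMap.compr₂_apply, tensorMapBilin_apply]
        -- A relation in the second factor becomes a relation at the position shifted by `w.length`.
        rw [tensorMap_tauAt_right τ hi, mk_comp_tauAt]
        have := mk_tensorMap_cast (τ := τ) w (swapAt i w') rfl (length_swapAt i w') f g
        simp only [TensorPower.cast_refl, LinearEquiv.refl_toLinearMap, LinearMap.comp_id] at this
        rw [this]
        exact mk_congr (swapAt_append_right w w' i) rfl (by ext1; ext1 x; simp))))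
    (fun w i f hi => by
      refine hom_ext fun n w' hw' g => ?_
      subst hw'
      simp only [LinearMap.flip_apply, lift_mk, LinearMap.compr₂_apply, tensorMapBilin_apply,
        TensorPower.cast_refl, LinearEquiv.refl_toLinearMap, LinearMap.comp_id]
      rw [tensorMap_tauAt_left τ hi, mk_comp_tauAt]
      have := mk_tensorMap_cast (τ := τ) (swapAt i w) w' (length_swapAt i w) rfl f g
      simp only [TensorPower.cast_refl, LinearEquiv.refl_toLinearMap, LinearMap.comp_id] at this
      rw [this]
      exact mk_congr (swapAt_append_left w w' hi) rfl (by ext1; ext1 x; simp))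

theorem prod_mk {n n' : ℕ} (w w' : List ℕ) (h : w.length = n) (h' : w'.length = n')
    (f : (⨂[k]^n) V →ₗ[k] W₁) (g : (⨂[k]^n') V →ₗ[k] W₂) :
    prod τ (mk τ w h f) (mk τ w' h' g) =
      mk τ (w ++ w') (by rw [List.length_append, h, h']) (tensorMap f g) := by
  rw [prod, lift_mk, LinearMap.flip_apply, lift_mk, LinearMap.flip_apply, LinearMap.compr₂_apply,
    tensorMapBilin_apply, mk_tensorMap_cast]

theorem map_prod (φ : W₁ →ₗ[k] W₁') (ψ : W₂ →ₗ[k] W₂') (x : Env W₁ τ) (y : Env W₂ τ) :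
    map τ (TensorProduct.map φ ψ) (prod τ x y) =
      prod τ (map τ φ x) (map τ ψ y) := by
  have : (prod τ).compr₂ (map τ (TensorProduct.map φ ψ)) =
      (prod τ).compl₁₂ (map τ φ) (map τ ψ) :=
    hom_ext fun n w hw f => hom_ext fun n' w' hw' g => by
      simp only [LinearMap.compr₂_apply, LinearMap.compl₁₂_apply, prod_mk, map_mk,
        map_comp_tensorMap]
  exact LinearMap.congr_fun (LinearMap.congr_fun this x) y

theorem map_assoc_prod (x : Env W₁ τ) (y : Env W₂ τ) (z : Env W₃ τ) :
    map τ (TensorProduct.assoc k W₁ W₂ W₃).toLinearMap (prod τ (prod τ x y) z) =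
      prod τ x (prod τ y z) := by
  induction x using induction with
  | ha x x' h h' => simp only [_root_.map_add, LinearMap.add_apply, h, h']
  | hm w f =>
    induction y using induction with
    | ha x x' h h' => simp only [_root_.map_add, LinearMap.add_apply, h, h']
    | hm w' g =>
      induction z using induction with
      | ha x x' h h' => simp only [_root_.map_add, h, h']
      | hm w'' h =>
        simp only [prod_mk, map_mk, assoc_comp_tensorMap]
        exact mk_congr (List.append_assoc _ _ _) (Nat.add_assoc _ _ _) rfl

variable (τ) in
/-- The unit of the external product. -/
def unit : Env k τ := mk τ [] rfl (PiTensorProduct.isEmptyEquiv (Fin 0)).toLinearMap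

theorem map_lid_prod_unit (x : Env W τ) :
    map τ (TensorProduct.lid k W).toLinearMap (prod τ (unit τ) x) = x := by
  induction x using induction with
  | ha x x' h h' => rw [_root_.map_add, _root_.map_add, h, h']
  | hm w f =>
    rw [unit, prod_mk, map_mk]
    refine mk_congr (List.nil_append w) (Nat.zero_add _) ?_
    refine hom_ext_tmul rfl fun x y => ?_
    obtain ⟨c, rfl⟩ := (TensorPower.algebraMap₀ (R := k) (M := V)).surjective x
    have : TensorPower.cast k V (Nat.zero_add _) (tmul rfl (TensorPower.algebraMap₀ c) y) =
      c • y := by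
        apply toT_injective
        simp [toT_cast, toT_tmul, TensorPower.algebraMap₀_eq_smul_one]
    simp only [LinearMap.comp_apply, LinearEquiv.coe_coe]
    rw [this, tensorMap_tmul]
    simp [TensorPower.algebraMap₀]

theorem map_rid_prod_unit (x : Env W τ) :
    map τ (TensorProduct.rid k W).toLinearMap (prod τ x (unit τ)) = x := by
  induction x using induction with
  | ha x x' h h' => rw [_root_.map_add, LinearMap.add_apply, _root_.map_add, h, h']
  | hm w f =>
    rw [unit, prod_mk, map_mk]
    refine mk_congr (List.append_nil w) (Nat.add_zero _) ?_
    refine hom_ext_tmul rfl fun x y => ?_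
    obtain ⟨c, rfl⟩ := (TensorPower.algebraMap₀ (R := k) (M := V)).surjective y
    have : TensorPower.cast k V (Nat.add_zero _) (tmul rfl x (TensorPower.algebraMap₀ c)) =
      c • x := by
        apply toT_injective
        simp [toT_tmul, TensorPower.algebraMap₀_eq_smul_one]
    simp only [LinearMap.comp_apply, LinearEquiv.coe_coe]
    rw [this, tensorMap_tmul]
    simp [TensorPower.algebraMap₀]

section Evaluation

variable (hb : IsBraiding τ) (hτ : τ ∘ₗ τ = LinearMap.id)

/-- The component of an element of the envelope with the labels `0, …, n - 1`. -/
def eval (n : ℕ) : Env W τ →ₗ[k] ((⨂[k]^n) V →ₗ[k] W) :=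
  -- The relations preserve the multiset of labels, so all other label sets may be sent to zero.
  lift (fun w => if h : w.Perm (List.range n) then
      LinearMap.lcomp k W ((TensorPower.cast k V (show n = w.length by
        rw [h.length_eq, List.length_range])).toLinearMap ∘ₗ act τ n (sortWord w)) else 0)
    fun w i f hi => by
      by_cases h : w.Perm (List.range n)
      · rw [dif_pos h, dif_pos ((swapAt_perm i w).trans h)]
        have hn : w.length = n := by rw [h.length_eq, List.length_range]
        subst hn
        have := act_sortWord_swapAt τ hb hτ w (h.nodup_iff.2 List.nodup_range)
          (t := 0) hi (Nat.zero_add _).le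
        simp only [shift, zero_add, List.map_id', act_append, act_singleton] at this
        rw [LinearMap.lcomp_apply', LinearMap.lcomp_apply', ← this]
        ext1; ext1 x; simp
      · rw [dif_neg h, dif_neg (fun h' => h ((swapAt_perm i w).symm.trans h'))]
        rfl

theorem eval_mk_range (n : ℕ) (f : (⨂[k]^n) V →ₗ[k] W) :
    eval hb hτ n (mk τ (List.range n) List.length_range f) = f := by
  rw [eval, lift_mk, dif_pos (List.Perm.refl _),
    sortWord_of_pairwise (List.pairwise_lt_range.imp fun h => h.le)]
  ext1; ext1 x; simp [act]

-- The faithfulness of the envelope: `eval` recovers the multilinear map from its class with labels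
-- `0, …, n - 1`.
include hb hτ in
theorem mk_range_injective {n : ℕ} {f g : (⨂[k]^n) V →ₗ[k] W}
    (h : mk τ (List.range n) List.length_range f = mk τ (List.range n) List.length_range g) :
    f = g := by
  rw [← eval_mk_range hb hτ n f, h, eval_mk_range hb hτ n g]

end Evaluation

end Env

end Envelope

/-! ### Sums over splittings of a list and their convolution calculus -/

section Unshuffles

variable {α β M N : Type*}

/-- The sum of `φ u v` over all ways to split a list into two complementary sublists `u`, `v`. -/
def csum [AddCommMonoid M] : List α → (List α → List α → M) → M
  | [], φ => φ [] []
  | a :: l, φ => csum l (fun u v => φ (a :: u) v) + csum l (fun u v => φ u (a :: v))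

section Monoid

variable [AddCommMonoid M] [AddCommMonoid N]

theorem csum_add (l : List α) (φ ψ : List α → List α → M) :
    csum l (fun u v => φ u v + ψ u v) = csum l φ + csum l ψ := by
  induction l generalizing φ ψ with
  | nil => rfl
  | cons a l ih => simp only [csum, ih]; abel

theorem csum_zero (l : List α) : csum l (fun _ _ => (0 : M)) = 0 := by
  induction l with
  | nil => rfl
  | cons a l ih => simp only [csum, ih, add_zero]

theorem map_csum {F : Type*} [FunLike F M N] [AddMonoidHomClass F M N] (f : F) (l : List α)
    (φ : List α → List α → M) : f (csum l φ) = csum l fun u v => f (φ u v) := by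
  induction l generalizing φ with
  | nil => rfl
  | cons a l ih => simp only [csum, map_add, ih]

theorem csum_sum {ι : Type*} (s : Finset ι) (l : List α) (φ : ι → List α → List α → M) :
    csum l (fun u v => ∑ i ∈ s, φ i u v) = ∑ i ∈ s, csum l (φ i) := by
  classical
  induction s using Finset.induction_on with
  | empty => simp [csum_zero]
  | insert a s ha ih => simp only [Finset.sum_insert ha, csum_add, ih]

theorem csum_append (l l' : List α) (φ : List α → List α → M) :
    csum (l ++ l') φ = csum l fun u v => csum l' fun u' v' => φ (u ++ u') (v ++ v') := by
  induction l generalizing φ with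
  | nil => rfl
  | cons a l ih => simp only [List.cons_append, csum, ih]

theorem csum_swap (l : List α) (φ : List α → List α → M) :
    csum l φ = csum l fun u v => φ v u := by
  induction l generalizing φ with
  | nil => rfl
  | cons a l ih =>
    rw [csum, csum, add_comm, ih (fun u v => φ u (a :: v)), ih (fun u v => φ (a :: u) v)]

/-- Coassociativity of the unshuffle coproduct: both sides distribute the letters over three blocks.
-/
theorem csum_assoc (l : List α) (φ : List α → List α → List α → M) :
    csum l (fun u v => csum u fun u₁ u₂ => φ u₁ u₂ v) =
      csum l fun u v => csum v fun v₁ v₂ => φ u v₁ v₂ := by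
  induction l generalizing φ with
  | nil => rfl
  | cons a l ih =>
    simp only [csum, csum_add]
    rw [ih fun x y z => φ (a :: x) y z, ih fun x y z => φ x (a :: y) z,
      ih fun x y z => φ x y (a :: z)]
    abel

/-- The iterated unshuffle with the second and the third block exchanged. -/
theorem csum_assoc_swap (l : List α) (φ : List α → List α → List α → M) :
    csum l (fun u v => csum u fun u₁ u₂ => φ u₁ u₂ v) =
      csum l fun u v => csum u fun u₁ u₂ => φ u₁ v u₂ := by
  rw [csum_assoc, csum_assoc l fun x y z => φ x z y]
  congr 1
  funext u v
  exact csum_swap _ _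

theorem csum_comm (l l' : List α) (φ : List α → List α → List α → List α → M) :
    csum l (fun u v => csum l' fun u' v' => φ u v u' v') =
      csum l' fun u' v' => csum l fun u v => φ u v u' v' := by
  induction l generalizing φ with
  | nil => rfl
  | cons a l ih => simp only [csum, csum_add, ih]

theorem csum_congr {l : List α} {φ ψ : List α → List α → M}
    (h : ∀ u v, u.length + v.length = l.length → φ u v = ψ u v) : csum l φ = csum l ψ := by
  induction l generalizing φ ψ with
  | nil => exact h [] [] rfl
  | cons a l ih =>
    simp only [csum]
    congr 1
    · exact ih fun u v huv => h _ _ (by simp; omega)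
    · exact ih fun u v huv => h _ _ (by simp; omega)

theorem csum_eq_single {l : List α} {φ : List α → List α → M}
    (h : ∀ u v, u.length + v.length = l.length → v.length < l.length → φ u v = 0) :
    csum l φ = φ [] l := by
  induction l generalizing φ with
  | nil => rfl
  | cons a l ih =>
    have h1 : csum l (fun u v => φ (a :: u) v) = 0 := by
      rw [← csum_zero (M := M) l]
      exact csum_congr fun u v huv => h _ _ (by simp; omega) (by simp; omega)
    rw [csum, h1, zero_add]
    exact ih fun u v huv hv => h _ _ (by simp; omega) (by simp; omega)

theorem csum_map (f : α → β) (l : List α) (φ : List β → List β → M) :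
    csum (l.map f) φ = csum l fun u v => φ (u.map f) (v.map f) := by
  induction l generalizing φ with
  | nil => rfl
  | cons a l ih => simp only [List.map_cons, csum, ih]

/-- Grouping by the length of the first part matches the sums over `j` in the axioms of a Sabinin
algebra. -/
theorem csum_eq_sum_length (l : List α) (φ : List α → List α → M) :
    csum l φ = ∑ r ∈ Finset.range (l.length + 1),
      csum l fun u v => if u.length = r then φ u v else 0 := by
  rw [← csum_sum]
  refine csum_congr fun u v h => ?_
  rw [Finset.sum_ite_eq, if_pos (by simp; omega)]

end Monoid

section Group

variable [AddCommGroup M] [AddCommGroup N]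

theorem csum_neg (l : List α) (φ : List α → List α → M) :
    csum l (fun u v => -φ u v) = -csum l φ := (map_csum (negAddMonoidHom (α := M)) l φ).symm

theorem csum_sub (l : List α) (φ ψ : List α → List α → M) :
    csum l (fun u v => φ u v - ψ u v) = csum l φ - csum l ψ := by
  simp only [sub_eq_add_neg, csum_add, csum_neg]

/-- Inversion of a convolution with a family that starts with a left unit. -/
theorem eq_zero_of_csum_eq_zero (mul : N →+ M →+ M) (c : List α → List α → N)
    (hc : ∀ y, mul (c [] []) y = y) (E : List α → List α → M)
    (h : ∀ u w, csum u (fun u₁ u₂ => csum w fun w₁ w₂ => mul (c u₁ w₁) (E u₂ w₂)) = 0)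
    (u w : List α) : E u w = 0 := by
  -- Every term with a nonempty first part involves `E` on shorter words and vanishes by induction.
  -- Only the term with the left unit is left.
  induction hn : u.length + w.length using Nat.strong_induction_on generalizing u w with
  | _ n ih =>
    have := h u w
    rwa [csum_eq_single, csum_eq_single, hc] at this
    · intro w₁ w₂ hw hw'
      rw [ih (u.length + w₂.length) (by omega) u w₂ rfl, map_zero]
    · intro u₁ u₂ hu hu'
      rw [← csum_zero (M := M) w]
      refine csum_congr fun w₁ w₂ hw => ?_
      rw [ih (u₂.length + w₂.length) (by omega) u₂ w₂ rfl, map_zero]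

end Group

end Unshuffles

/-! ### The derivation and cyclic identities from the commutator relation -/

section Classical

variable {X M : Type*} [AddCommGroup M] (mul : M →+ M →+ M) (e : M) (i : X → M)

/-- The left-normed product of the values of the letters of a word. -/
def leftNormed (u : List X) : M := u.foldl (fun m x => mul m (i x)) e

theorem leftNormed_concat (u : List X) (x : X) :
    leftNormed mul e i (u ++ [x]) = mul (leftNormed mul e i u) (i x) := by
  simp [leftNormed]

/-- The identity that characterizes the operations `S`. -/
def IsCommutatorFamily (S : List X → X → X → X) : Prop :=
  ∀ u y z, leftNormed mul e i (u ++ [y, z]) - leftNormed mul e i (u ++ [z, y]) +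
    csum u (fun u₁ u₂ => mul (leftNormed mul e i u₁) (i (S u₂ y z))) = 0

variable {mul e i} {S : List X → X → X → X} (he : ∀ y, mul e y = y)
  (hS : IsCommutatorFamily mul e i S)

-- The commutator relation is multiplied on the right by the letters of `w`, one at a time.
include hS in
theorem IsCommutatorFamily.append (u w : List X) (a b : X) :
    leftNormed mul e i (u ++ a :: b :: w) - leftNormed mul e i (u ++ b :: a :: w) +
      csum u (fun u₁ u₂ => leftNormed mul e i (u₁ ++ S u₂ a b :: w)) = 0 := by
  induction w using List.reverseRecOn with
  | nil => simpa only [leftNormed_concat] using hS u a b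
  | append_singleton w x ih =>
    simp only [← List.cons_append, ← List.append_assoc, leftNormed_concat]
    have := congrArg (fun t => mul t (i x)) ih
    simp only [map_add, map_sub, map_zero, AddMonoidHom.add_apply, AddMonoidHom.sub_apply,
      AddMonoidHom.zero_apply] at this
    rw [← this]
    congr 1
    have h2 := map_csum (AddMonoidHom.flip mul (i x)) u
      (fun u₁ u₂ => leftNormed mul e i (u₁ ++ S u₂ a b :: w))
    exact h2.symm

-- The convolution of the claimed expression with left-normed products is a combination of instances
-- of the commutator relation, hence zero, and the convolution factor is cancelled.
include he hS in
theorem IsCommutatorFamily.derivation (u w : List X) (a b y z : X) :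
    i (S (u ++ a :: b :: w) y z) - i (S (u ++ b :: a :: w) y z) +
      csum u (fun u₁ u₂ => i (S (u₁ ++ S u₂ a b :: w) y z)) = 0 := by
  refine eq_zero_of_csum_eq_zero mul (fun u w => leftNormed mul e i (u ++ w)) he
    (fun u w => i (S (u ++ a :: b :: w) y z) - i (S (u ++ b :: a :: w) y z) +
      csum u (fun u₁ u₂ => i (S (u₁ ++ S u₂ a b :: w) y z))) ?_ u w
  intro u w
  -- In the difference of these two relations the terms that separate `a` from `b` cancel. What is
  -- left has both letters in the product or both in the argument of `S`.
  have hA := hS (u ++ a :: b :: w) y z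
  have hB := hS (u ++ b :: a :: w) y z
  have hC : csum u (fun u₁ u₂ => leftNormed mul e i ((u₁ ++ S u₂ a b :: w) ++ [y, z]) -
      leftNormed mul e i ((u₁ ++ S u₂ a b :: w) ++ [z, y]) +
    csum (u₁ ++ S u₂ a b :: w) (fun v₁ v₂ => mul (leftNormed mul e i v₁) (i (S v₂ y z)))) = 0 := by
    simp only [hS _ y z, csum_zero]
  -- The next two relations remove the undivided words, and `hL` the terms with `a`, `b` or `S(-; a,
  -- b)` inside the product.
  have hK := hS.append u (w ++ [y, z]) a b
  have hK' := hS.append u (w ++ [z, y]) a b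
  have hL : csum u (fun u₁ u₂ => csum w fun w₁ w₂ =>
      mul (leftNormed mul e i (u₁ ++ a :: b :: w₁) - leftNormed mul e i (u₁ ++ b :: a :: w₁) +
        csum u₁ (fun v₁ v₂ => leftNormed mul e i (v₁ ++ S v₂ a b :: w₁)))
        (i (S (u₂ ++ w₂) y z))) = 0 := by
    simp only [hS.append, map_zero, AddMonoidHom.zero_apply, csum_zero]
  have hm (x : M) (l : List X) (φ : List X → List X → M →+ M) :
      (csum l φ) x = csum l fun u v => (φ u v) x := map_csum (AddMonoidHom.eval x) l φ
  simp only [csum_append, csum, csum_add, csum_sub, map_add, map_sub, AddMonoidHom.add_apply,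
    AddMonoidHom.sub_apply, map_csum, hm, List.append_assoc, List.cons_append]
    at hA hB hC hK hK' hL ⊢
  -- The splitting of `u` into three blocks is rebracketed so that the terms of `hC` match those of
  -- `hL` and of the goal.
  have e1 : csum u (fun u₁ u₂ => csum u₁ fun v₁ v₂ => csum w fun w₁ w₂ =>
        mul (leftNormed mul e i (v₁ ++ S u₂ a b :: w₁)) (i (S (v₂ ++ w₂) y z))) =
      csum u (fun u₁ u₂ => csum w fun w₁ w₂ => csum u₁ fun v₁ v₂ =>
        mul (leftNormed mul e i (v₁ ++ S v₂ a b :: w₁)) (i (S (u₂ ++ w₂) y z))) := by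
    rw [csum_assoc_swap u fun x y' z' => csum w fun w₁ w₂ =>
        mul (leftNormed mul e i (x ++ S z' a b :: w₁)) (i (S (y' ++ w₂) y z))]
    congr 1
    funext u₁ u₂
    rw [csum_comm]
  have e2 : csum u (fun u₁ u₂ => csum u₁ fun v₁ v₂ => csum w fun w₁ w₂ =>
        mul (leftNormed mul e i (v₁ ++ w₁)) (i (S (v₂ ++ S u₂ a b :: w₂) y z))) =
      csum u (fun u₁ u₂ => csum w fun w₁ w₂ => csum u₂ fun v₁ v₂ =>
        mul (leftNormed mul e i (u₁ ++ w₁)) (i (S (v₁ ++ S v₂ a b :: w₂) y z))) := by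
    rw [csum_assoc u fun x y' z' => csum w fun w₁ w₂ =>
        mul (leftNormed mul e i (x ++ w₁)) (i (S (y' ++ S z' a b :: w₂) y z))]
    congr 1
    funext u₁ u₂
    rw [csum_comm]
  rw [e1, e2] at hC
  have key := congrArg₂ (· - ·) (congrArg₂ (· + ·) (congrArg₂ (· - ·) hA hB) hC)
    (congrArg₂ (· + ·) (congrArg₂ (· - ·) hK hK') hL)
  simp only [sub_zero, add_zero] at key
  rw [← key]
  abel

variable (S i) in
/-- The summand of the cyclic identity. -/
def cyclicTerm (u : List X) (a b c : X) : M :=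
  i (S (u ++ [c]) a b) + csum u (fun u₁ u₂ => i (S u₁ (S u₂ a b) c))

-- Only four words survive in the convolution. They are arranged so that the sum over the cyclic
-- rotations of `a, b, c` vanishes.
include hS in
theorem IsCommutatorFamily.csum_cyclicTerm (u : List X) (a b c : X) :
    csum u (fun u₁ u₂ => mul (leftNormed mul e i u₁) (cyclicTerm i S u₂ a b c)) =
      -(leftNormed mul e i (u ++ [c, a, b]) - leftNormed mul e i (u ++ [c, b, a]) -
        leftNormed mul e i (u ++ [a, b, c]) + leftNormed mul e i (u ++ [b, a, c])) := by
  have hA := hS (u ++ [c]) a b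
  have hB := hS.append u [c] a b
  have hC : csum u (fun u₁ u₂ => leftNormed mul e i (u₁ ++ [S u₂ a b, c]) -
      leftNormed mul e i (u₁ ++ [c, S u₂ a b]) +
    csum u₁ (fun v₁ v₂ => mul (leftNormed mul e i v₁) (i (S v₂ (S u₂ a b) c)))) = 0 := by
    simp only [hS _ _ c, csum_zero]
  have hD : ∀ u₁ u₂, leftNormed mul e i (u₁ ++ [c, S u₂ a b]) =
      mul (leftNormed mul e i (u₁ ++ [c])) (i (S u₂ a b)) := fun u₁ u₂ => by
    rw [← leftNormed_concat]; simp
  simp only [cyclicTerm, csum_append, csum, csum_add, csum_sub, map_add, map_csum, hD,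
    List.append_assoc, List.cons_append, List.nil_append, List.append_nil] at hA hB hC ⊢
  rw [csum_assoc u fun x y' z' => mul (leftNormed mul e i x) (i (S y' (S z' a b) c))] at hC
  rw [eq_neg_iff_add_eq_zero]
  have key := congrArg₂ (· - ·) (congrArg₂ (· + ·) hA hC) hB
  simp only [sub_zero, add_zero] at key
  rw [← key]
  abel

-- The twelve words obtained from the three rotations cancel in pairs. In the cancellation lemma the
-- second list is a dummy.
include he hS in
theorem IsCommutatorFamily.cyclic (u : List X) (a b c : X) :
    cyclicTerm i S u a b c + cyclicTerm i S u b c a + cyclicTerm i S u c a b = 0 := by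
  refine eq_zero_of_csum_eq_zero mul (fun u _ => leftNormed mul e i u) he
    (fun u _ => cyclicTerm i S u a b c + cyclicTerm i S u b c a + cyclicTerm i S u c a b) ?_ u []
  intro u w
  have : csum u (fun u₁ u₂ => mul (leftNormed mul e i u₁)
      (cyclicTerm i S u₂ a b c + cyclicTerm i S u₂ b c a + cyclicTerm i S u₂ c a b)) = 0 := by
    simp only [map_add, csum_add, hS.csum_cyclicTerm]
    abel
  rw [csum_comm]
  simp only [this, csum_zero]

end Classical

/-! ### Shuffle permutations and splittings of lists -/

section Shuffles

variable {α β M : Type*} {n : ℕ}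

theorem eq_of_perm_of_pairwise_lt {l l' : List (Fin n)} (h : l.Perm l') (hl : l.Pairwise (· < ·))
    (hl' : l'.Pairwise (· < ·)) : l = l' :=
  List.Perm.eq_of_pairwise (fun _ _ _ _ h h' => absurd h (lt_asymm h')) hl hl' h

theorem filter_finRange_lt (n r : ℕ) :
    (List.finRange n).filter (fun i => i.val < r) = (List.finRange n).take r := by
  conv_lhs => rw [← List.take_append_drop r (List.finRange n), List.filter_append]
  rw [List.filter_eq_self.2, List.filter_eq_nil_iff.2, List.append_nil]
  · intro x hx
    obtain ⟨i, hi, rfl⟩ := List.mem_drop_iff_getElem.1 hx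
    simp
  · intro x hx
    obtain ⟨i, hi, rfl⟩ := List.mem_take_iff_getElem.1 hx
    simp at hi ⊢
    omega

theorem mem_take_finRange {r : ℕ} {x : Fin n} : x ∈ (List.finRange n).take r ↔ x.val < r := by
  rw [← filter_finRange_lt]; simp

theorem mem_drop_finRange {r : ℕ} {x : Fin n} : x ∈ (List.finRange n).drop r ↔ r ≤ x.val := by
  rw [List.mem_drop_iff_getElem]
  constructor
  · rintro ⟨i, hi, rfl⟩
    simp
  · intro h
    refine ⟨x.val - r, by simp; omega, ?_⟩
    ext
    simp
    omega

theorem mem_shuffles {r : ℕ} {π : Equiv.Perm (Fin n)} : π ∈ shuffles n r ↔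
    (∀ i j : Fin n, i < j → j.val < r → π i < π j) ∧
    (∀ i j : Fin n, r ≤ i.val → i < j → π i < π j) := by simp [shuffles]

theorem pairwise_map_take {r : ℕ} {π : Equiv.Perm (Fin n)} (hπ : π ∈ shuffles n r) :
    (((List.finRange n).take r).map π).Pairwise (· < ·) := by
  rw [List.pairwise_map]
  refine List.Pairwise.imp_of_mem ?_ ((List.pairwise_lt_finRange n).sublist (List.take_sublist _ _))
  intro a b _ hb hab
  exact (mem_shuffles.1 hπ).1 a b hab (mem_take_finRange.1 hb)

theorem pairwise_map_drop {r : ℕ} {π : Equiv.Perm (Fin n)} (hπ : π ∈ shuffles n r) :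
    (((List.finRange n).drop r).map π).Pairwise (· < ·) := by
  rw [List.pairwise_map]
  refine List.Pairwise.imp_of_mem ?_ ((List.pairwise_lt_finRange n).sublist (List.drop_sublist _ _))
  intro a b ha _ hab
  exact (mem_shuffles.1 hπ).2 a b (mem_drop_finRange.1 ha) hab

/-- The state after the first `i` moves of a shuffle word. -/
theorem applyWord_flatMap_take {r : ℕ} (hr : r ≤ n) {π : Equiv.Perm (Fin n)}
    (hπ : π ∈ shuffles n r) {i : ℕ} (hi : i ≤ r) :
    ∃ (A : List (Fin n)) (c : ℕ),
      applyWord (((List.finRange n).take i).flatMap fun i => moveWord i.val (π i).val)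
        (List.finRange n) =
        ((List.finRange n).take i).map π ++ (A ++ (List.finRange n).drop c) ∧
      (A ++ (List.finRange n).drop c).Sublist (List.finRange n) ∧ i + A.length = c ∧ c ≤ n ∧
      ∀ j : Fin n, i ≤ j.val → j.val < r → c ≤ (π j).val := by
  -- After `i` moves, `A` holds the symbols passed over so far and `c` is the first symbol not yet
  -- inspected. Monotonicity keeps all later chosen symbols at or beyond `c`.
  induction i with
  | zero => exact ⟨[], 0, by simp⟩
  | succ i ih =>
    obtain ⟨A, c, hA, hs, hc, hcn, hj⟩ := ih (by omega)
    have hin : i < (List.finRange n).length := by simp; omega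
    set x : Fin n := ⟨i, by omega⟩ with hx
    have hci : c ≤ (π x).val := hj x le_rfl (by simp [hx]; omega)
    have hxi : (List.finRange n)[i] = x := by simp [hx]
    obtain ⟨d, hd⟩ := Nat.exists_eq_add_of_le hci
    have hlen : (((List.finRange n).drop c).take d).length = d := by
      simp
      have := (π x).isLt
      omega
    have hdrop : (List.finRange n).drop c =
        ((List.finRange n).drop c).take d ++ π x :: (List.finRange n).drop ((π x).val + 1) := by
      have h0 := List.drop_eq_getElem_cons (l := List.finRange n) (i := (π x).val) (by simp)
      simp only [List.getElem_finRange, Fin.cast_mk, Fin.eta] at h0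
      conv_lhs => rw [← List.take_append_drop d ((List.finRange n).drop c)]
      rw [List.drop_drop, ← hd, h0]
    have hxv : x.val = i := rfl
    generalize ((List.finRange n).drop c).take d = T at hdrop hlen
    rw [hdrop] at hA hs
    refine ⟨A ++ T, (π x).val + 1, ?_, ?_, ?_, ?_, ?_⟩
    · rw [List.take_succ_eq_append_getElem hin, hxi, List.flatMap_append, applyWord_append, hA]
      have := applyWord_moveWord (((List.finRange n).take i).map π)
        (A ++ T) ((List.finRange n).drop ((π x).val + 1)) (π x)
      have hl1 : (((List.finRange n).take i).map π).length = i := by simp; omega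
      rw [hl1, List.length_append, hlen, ← Nat.add_assoc, hc, ← hd] at this
      simpa [hxv] using this
    · refine List.Sublist.trans ?_ hs
      rw [List.append_assoc]
      refine List.Sublist.append_left ?_ A
      exact List.Sublist.append_left (List.sublist_cons_self _ _) _
    · rw [List.length_append, hlen]; omega
    · exact (π x).isLt
    · intro j hij hjr
      have := (mem_shuffles.1 hπ).1 x j (by rw [Fin.lt_def]; simp [hx]; omega) hjr
      exact this

/-- The chosen symbols come first by construction. The others keep their increasing order, and an
increasing list is determined by its entries. -/
theorem applyWord_shuffleWord_finRange {r : ℕ} (hr : r ≤ n) {π : Equiv.Perm (Fin n)}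
    (hπ : π ∈ shuffles n r) :
    applyWord (shuffleWord r π) (List.finRange n) = (List.finRange n).map π := by
  obtain ⟨A, c, hA, hs, -⟩ := applyWord_flatMap_take hr hπ le_rfl
  rw [shuffleWord, filter_finRange_lt, hA]
  conv_rhs => rw [← List.take_append_drop r (List.finRange n), List.map_append]
  congr 1
  refine eq_of_perm_of_pairwise_lt ?_ ((List.pairwise_lt_finRange n).sublist hs)
    (pairwise_map_drop hπ)
  rw [← List.perm_append_left_iff (((List.finRange n).take r).map π), ← List.map_append,
    List.take_append_drop, ← hA]
  refine (applyWord_perm _ _).trans ?_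
  refine (List.perm_of_nodup_nodup_toFinset_eq (List.nodup_finRange n)
    ((List.nodup_finRange n).map π.injective) ?_)
  ext x
  simpa using ⟨π.symm x, by simp⟩

/-- For distinct letters a splitting is a choice of a subset, which allows the comparison with
shuffles through their sets of first values. -/
theorem csum_eq_sum_powerset [AddCommMonoid M] [DecidableEq α] {l : List α} (hl : l.Nodup)
    (φ : List α → List α → M) :
    csum l φ = ∑ s ∈ l.toFinset.powerset, φ (l.filter (· ∈ s)) (l.filter (· ∉ s)) := by
  induction l generalizing φ with
  | nil => simp [csum]
  | cons a l ih =>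
    obtain ⟨ha, hl⟩ := List.nodup_cons.1 hl
    rw [csum, ih hl, ih hl, List.toFinset_cons, Finset.sum_powerset_insert (by simpa using ha),
      add_comm]
    congr 1
    · refine Finset.sum_congr rfl fun s hs => ?_
      have : a ∉ s := fun h => ha (by simpa using Finset.mem_powerset.1 hs h)
      simp [this]
    · refine Finset.sum_congr rfl fun s hs => ?_
      have h : ∀ b ∈ l, (b = a ∨ b ∈ s) ↔ b ∈ s := fun b hb =>
        ⟨fun h => h.resolve_left (by rintro rfl; exact ha hb), Or.inr⟩
      have h1 : l.filter (· ∈ insert a s) = l.filter (· ∈ s) :=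
        List.filter_congr fun b hb => by simp [Finset.mem_insert, h b hb]
      have h2 : l.filter (· ∉ insert a s) = l.filter (· ∉ s) :=
        List.filter_congr fun b hb => by simp only [Finset.mem_insert, h b hb]
      rw [List.filter_cons_of_pos (by simp), List.filter_cons_of_neg (by simp), h1, h2]

/-- The set of values of a permutation on the first `r` symbols. -/
def firstValues (r : ℕ) (π : Equiv.Perm (Fin n)) : Finset (Fin n) :=
  Finset.univ.filter fun x => (π.symm x).val < r

theorem map_take_eq_filter {r : ℕ} {π : Equiv.Perm (Fin n)} (hπ : π ∈ shuffles n r) :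
    ((List.finRange n).take r).map π = (List.finRange n).filter (· ∈ firstValues r π) := by
  refine eq_of_perm_of_pairwise_lt ?_ (pairwise_map_take hπ)
    ((List.pairwise_lt_finRange n).sublist List.filter_sublist)
  refine List.perm_of_nodup_nodup_toFinset_eq
    (((List.nodup_finRange n).sublist (List.take_sublist _ _)).map π.injective)
    ((List.nodup_finRange n).filter _) ?_
  ext x
  simp only [List.mem_toFinset, List.mem_map, mem_take_finRange, List.mem_filter,
    List.mem_finRange, true_and, firstValues, Finset.mem_filter, Finset.mem_univ, decide_eq_true_eq]
  exact ⟨by rintro ⟨a, ha, rfl⟩; simpa using ha, fun h => ⟨_, h, by simp⟩⟩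

theorem map_drop_eq_filter {r : ℕ} {π : Equiv.Perm (Fin n)} (hπ : π ∈ shuffles n r) :
    ((List.finRange n).drop r).map π = (List.finRange n).filter (· ∉ firstValues r π) := by
  refine eq_of_perm_of_pairwise_lt ?_ (pairwise_map_drop hπ)
    ((List.pairwise_lt_finRange n).sublist List.filter_sublist)
  refine List.perm_of_nodup_nodup_toFinset_eq
    (((List.nodup_finRange n).sublist (List.drop_sublist _ _)).map π.injective)
    ((List.nodup_finRange n).filter _) ?_
  ext x
  simp only [List.mem_toFinset, List.mem_map, mem_drop_finRange, List.mem_filter,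
    List.mem_finRange, true_and, firstValues, Finset.mem_filter, Finset.mem_univ,
    decide_eq_true_eq, not_lt]
  exact ⟨by rintro ⟨a, ha, rfl⟩; simpa using ha, fun h => ⟨_, h, by simp⟩⟩

theorem map_eq_filter_append {r : ℕ} {π : Equiv.Perm (Fin n)} (hπ : π ∈ shuffles n r) :
    (List.finRange n).map π = (List.finRange n).filter (· ∈ firstValues r π) ++
      (List.finRange n).filter (· ∉ firstValues r π) := by
  rw [← map_take_eq_filter hπ, ← map_drop_eq_filter hπ, ← List.map_append, List.take_append_drop]

theorem length_filter_mem (s : Finset (Fin n)) :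
    ((List.finRange n).filter (· ∈ s)).length = s.card := by
  rw [← List.toFinset_card_of_nodup ((List.nodup_finRange n).filter _)]
  congr 1
  ext x
  simp

/-- The shuffle lists the elements of `s` in increasing order and then those of its complement. -/
theorem exists_shuffle (s : Finset (Fin n)) :
    ∃ π ∈ shuffles n s.card, firstValues s.card π = s := by
  set l := (List.finRange n).filter (· ∈ s) with hl
  set l' := (List.finRange n).filter (· ∉ s) with hl'
  have hll : l.length = s.card := length_filter_mem s
  have hlen : (l ++ l').length = n := by
    have := (List.filter_append_perm (· ∈ s) (List.finRange n)).length_eq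
    rw [List.length_finRange] at this
    refine Eq.trans ?_ this
    simp [hl, hl']
  have hnd : (l ++ l').Nodup := by
    have := (List.filter_append_perm (· ∈ s) (List.finRange n)).nodup_iff.2 (List.nodup_finRange n)
    convert this using 3
    simp
  have hinj : Function.Injective fun i : Fin n => (l ++ l')[i.val]'(by rw [hlen]; exact i.isLt) := by
    intro i j hij
    exact Fin.ext ((hnd.getElem_inj_iff).1 hij)
  have h1 (i : Fin n) (hi : i.val < s.card) :
      (l ++ l')[i.val]'(by rw [hlen]; exact i.isLt) = l[i.val]'(by omega) :=
    List.getElem_append_left _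
  have h2 (i : Fin n) (hi : s.card ≤ i.val) :
      (l ++ l')[i.val]'(by rw [hlen]; exact i.isLt) =
        l'[i.val - l.length]'(by rw [List.length_append] at hlen; omega) :=
    List.getElem_append_right (by omega)
  have hp : l.Pairwise (· < ·) := (List.pairwise_lt_finRange n).sublist List.filter_sublist
  have hp' : l'.Pairwise (· < ·) := (List.pairwise_lt_finRange n).sublist List.filter_sublist
  refine ⟨Equiv.ofBijective _ (Finite.injective_iff_bijective.1 hinj), ?_, ?_⟩
  · rw [mem_shuffles]
    constructor
    · intro i j hij hj
      rw [Equiv.ofBijective_apply, Equiv.ofBijective_apply, h1 i (by omega), h1 j hj]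
      exact List.pairwise_iff_getElem.1 hp _ _ _ _ hij
    · intro i j hi hij
      rw [Equiv.ofBijective_apply, Equiv.ofBijective_apply, h2 i hi, h2 j (by omega)]
      exact List.pairwise_iff_getElem.1 hp' _ _ _ _ (by omega)
  · ext x
    simp only [firstValues, Finset.mem_filter, Finset.mem_univ, true_and]
    obtain ⟨y, rfl⟩ := (Equiv.ofBijective _ (Finite.injective_iff_bijective.1 hinj)).surjective x
    rw [Equiv.symm_apply_apply, Equiv.ofBijective_apply]
    constructor
    · intro hy
      rw [h1 y hy]
      have : l[y.val]'(by omega) ∈ l := List.getElem_mem _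
      simpa [hl] using (List.mem_filter.1 this).2
    · intro hy
      by_contra hy'
      rw [h2 y (by omega)] at hy
      have : l'[y.val - l.length]'(by rw [List.length_append] at hlen; omega) ∈ l' :=
        List.getElem_mem _
      have := (List.mem_filter.1 this).2
      simp at this
      exact this hy

/-- Sums over shuffles are sums over unshuffles of lists. -/
theorem sum_shuffles [AddCommMonoid M] {r : ℕ} (L : List α) (hL : L.length = n) (hr : r ≤ n)
    (φ : List α → M) :
    ∑ π ∈ shuffles n r, φ (applyWord (shuffleWord r π) L) =
      csum L fun u v => if u.length = r then φ (u ++ v) else 0 := by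
  subst hL
  -- The list of positions has distinct letters even if `L` does not. The general case follows by
  -- mapping positions to letters.
  have key : ∀ ψ : List (Fin L.length) → M,
      ∑ π ∈ shuffles L.length r, ψ (applyWord (shuffleWord r π) (List.finRange L.length)) =
        csum (List.finRange L.length) fun u v => if u.length = r then ψ (u ++ v) else 0 := by
    intro ψ
    rw [csum_eq_sum_powerset (List.nodup_finRange _), List.toFinset_finRange, Finset.powerset_univ]
    simp only [length_filter_mem]
    rw [← Finset.sum_filter]
    refine Finset.sum_bij (fun π _ => firstValues r π) ?_ ?_ ?_ ?_
    · intro π hπ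
      rw [Finset.mem_filter, ← length_filter_mem, ← map_take_eq_filter hπ]
      simpa using hr
    · intro π hπ π' hπ' h
      have : (List.finRange L.length).map π = (List.finRange L.length).map π' := by
        rw [map_eq_filter_append hπ, map_eq_filter_append hπ', h]
      rw [← List.ofFn_eq_map, ← List.ofFn_eq_map] at this
      exact DFunLike.coe_injective (List.ofFn_injective this)
    · intro s hs
      obtain rfl := (Finset.mem_filter.1 hs).2
      obtain ⟨π, hπ, h⟩ := exists_shuffle s
      exact ⟨π, hπ, h⟩
    · intro π hπ
      rw [applyWord_shuffleWord_finRange hr hπ, map_eq_filter_append hπ]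
  have h1 := List.map_get_finRange L
  have h2 := key fun l => φ (l.map L.get)
  simp only [applyWord_map, h1] at h2
  rw [h2]
  conv_rhs => rw [← h1, csum_map]
  simp

/-- Each letter of `v₁` in turn jumps over the whole block `u₂`. -/
theorem applyWord_blockWord (u₁ u₂ v₁ v₂ : List α) :
    applyWord (blockWord u₁.length (u₁.length + u₂.length) v₁.length) (u₁ ++ u₂ ++ v₁ ++ v₂) =
      u₁ ++ v₁ ++ u₂ ++ v₂ := by
  induction v₁ using List.reverseRecOn generalizing v₂ with
  | nil => simp [blockWord]
  | append_singleton v x ih =>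
    have h1 : blockWord u₁.length (u₁.length + u₂.length) (v ++ [x]).length =
        blockWord u₁.length (u₁.length + u₂.length) v.length ++
          moveWord (u₁ ++ v).length ((u₁ ++ v).length + u₂.length) := by
      simp only [blockWord, List.length_append, List.length_singleton, List.range_succ,
        List.flatMap_append, List.flatMap_singleton]
      congr 2
      omega
    have h2 := ih (x :: v₂)
    rw [h1, applyWord_append, show u₁ ++ u₂ ++ (v ++ [x]) ++ v₂ = u₁ ++ u₂ ++ v ++ x :: v₂ by simp,
      h2]
    have := applyWord_moveWord (u₁ ++ v) u₂ v₂ x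
    simpa using this

end Shuffles

/-! ### Sums over all permutations -/

section Permutations

variable {α M : Type*} {n : ℕ}

theorem getElem?_swapAt {L : List α} {i : ℕ} (h : i + 2 ≤ L.length) (j : ℕ) :
    (swapAt i L)[j]? = if j = i then L[i + 1]? else if j = i + 1 then L[i]? else L[j]? := by
  obtain ⟨L₁, a, b, L₂, rfl, rfl⟩ := exists_pair h
  rw [swapAt_append_pair]
  rcases lt_trichotomy j L₁.length with hj | rfl | hj
  · rw [if_neg (by omega), if_neg (by omega), List.getElem?_append_left hj,
      List.getElem?_append_left hj]
  · rw [if_pos rfl, List.getElem?_append_right le_rfl, List.getElem?_append_right (by omega)]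
    simp
  · rw [if_neg (by omega)]
    split_ifs with h'
    · subst h'
      rw [List.getElem?_append_right (by omega), List.getElem?_append_right (by omega)]
      simp
    · rw [List.getElem?_append_right (by omega), List.getElem?_append_right (by omega)]
      obtain ⟨d, hd⟩ : ∃ d, j - L₁.length = d + 2 := ⟨j - L₁.length - 2, by omega⟩
      simp [hd]

theorem swapAt_ofFn {i : ℕ} (h : i + 1 < n) (g : Fin n → α) :
    swapAt i (List.ofFn g) = List.ofFn (g ∘ transposition n i) := by
  refine List.ext_getElem? fun j => ?_
  rw [getElem?_swapAt (by simp; omega)]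
  simp only [List.getElem?_ofFn, transposition, dif_pos h, Function.comp_apply]
  by_cases hj : j < n
  · rw [dif_pos hj, dif_pos (show i < n by omega), dif_pos hj]
    split_ifs with h1 h2
    · subst h1
      rw [Equiv.swap_apply_left]
    · subst h2
      rw [Equiv.swap_apply_right]
    · rw [Equiv.swap_apply_of_ne_of_ne] <;> simpa [Fin.ext_iff]
  · rw [if_neg (by omega), if_neg (by omega), dif_neg hj, dif_neg hj]

/-- The effect of a word on a list depends only on its product in the symmetric group, so the choice
made in `permWord` is immaterial. -/
theorem applyWord_ofFn {l : List ℕ} (hl : ∀ i ∈ l, i + 1 < n) (g : Fin n → α) :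
    applyWord l (List.ofFn g) = List.ofFn (g ∘ (l.map (transposition n)).prod) := by
  induction l generalizing g with
  | nil => rfl
  | cons i l ih =>
    rw [applyWord_cons, swapAt_ofFn (hl i (by simp)), ih fun j hj => hl j (by simp [hj])]
    rfl

/-- Left multiplication by a transposition permutes the summands; this is the symmetry of the
operations Φ. -/
theorem sum_permWord_swapAt [AddCommMonoid M] (L : List α) (hL : L.length = n) (i : ℕ)
    (φ : List α → M) :
    ∑ π : Equiv.Perm (Fin n), φ (applyWord (permWord π) (swapAt i L)) =
      ∑ π : Equiv.Perm (Fin n), φ (applyWord (permWord π) L) := by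
  by_cases hi : i + 1 < n
  · obtain ⟨g, rfl⟩ : ∃ g : Fin n → α, L = List.ofFn g := by
      subst hL
      exact ⟨L.get, by simp⟩
    have h (g : Fin n → α) (π : Equiv.Perm (Fin n)) :
        applyWord (permWord π) (List.ofFn g) = List.ofFn (g ∘ π) := by
      have := applyWord_ofFn (exists_word π).choose_spec.1 g
      rwa [(exists_word π).choose_spec.2] at this
    simp only [swapAt_ofFn hi, h, Function.comp_assoc, ← Equiv.Perm.coe_mul]
    exact Fintype.sum_equiv (Equiv.mulLeft _) _ _ fun π => rfl
  · rw [swapAt_of_not (by omega)]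

end Permutations

/-! ### Tensor powers of linear maps -/

section TensorProducts

variable {k V B : Type*} [Field k] [AddCommGroup V] [Module k V] [AddCommGroup B] [Module k B]

/-- The product of tensor powers as a map on the tensor product. -/
def tmulMap {a b n : ℕ} (h : a + b = n) : (⨂[k]^a) B ⊗[k] (⨂[k]^b) B →ₗ[k] (⨂[k]^n) B :=
  TensorProduct.lift (tmul h)

theorem tmulMap_tmul {a b n : ℕ} (h : a + b = n) (x : (⨂[k]^a) B) (y : (⨂[k]^b) B) :
    tmulMap h (x ⊗ₜ[k] y) = tmul h x y := rfl

theorem tensorMap_comp_tmulMap {W W' : Type*} [AddCommGroup W] [Module k W] [AddCommGroup W']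
    [Module k W'] {a b : ℕ} (f : (⨂[k]^a) B →ₗ[k] W) (g : (⨂[k]^b) B →ₗ[k] W') :
    tensorMap f g ∘ₗ tmulMap rfl = TensorProduct.map f g := by
  refine TensorProduct.ext' fun x y => ?_
  rw [LinearMap.comp_apply, tmulMap_tmul, tensorMap_tmul, TensorProduct.map_tmul]

theorem toT_piMap (j : V →ₗ[k] B) {n : ℕ} (x : (⨂[k]^n) V) :
    toT (PiTensorProduct.map (fun _ => j) x : (⨂[k]^n) B) =
      TensorAlgebra.lift k (TensorAlgebra.ι k ∘ₗ j) (toT x) := by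
  induction x using PiTensorProduct.induction_on with
  | smul_tprod r v =>
    simp only [map_smul, PiTensorProduct.map_tprod, TensorPower.toTensorAlgebra_tprod,
      TensorAlgebra.tprod_apply, map_list_prod, List.map_ofFn]
    congr 3
    funext i
    simp
  | add x y hx hy => simp only [map_add, hx, hy]

theorem piMap_tmul (j : V →ₗ[k] B) {a b n : ℕ} (h : a + b = n) (x : (⨂[k]^a) V) (y : (⨂[k]^b) V) :
    (PiTensorProduct.map (fun _ => j) (tmul h x y) : (⨂[k]^n) B) =
      tmul h (PiTensorProduct.map (fun _ => j) x) (PiTensorProduct.map (fun _ => j) y) := by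
  apply toT_injective
  simp only [toT_piMap, toT_tmul, map_mul]

theorem piMap_one_symm (j : V →ₗ[k] B) (v : V) :
    (PiTensorProduct.map (fun _ => j) (one.symm v) : (⨂[k]^1) B) = one.symm (j v) := by
  apply toT_injective
  simp [toT_piMap, toT_one_symm]

theorem piMap_two (j : V →ₗ[k] B) (s : V ⊗[k] V) :
    (PiTensorProduct.map (fun _ => j) (two s) : (⨂[k]^2) B) = two (TensorProduct.map j j s) := by
  induction s using TensorProduct.induction_on with
  | zero => simp
  | tmul v w => apply toT_injective; simp [toT_piMap, toT_two]
  | add s t hs ht => simp only [map_add, hs, ht]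

theorem tauAt_two_zero (τ : V ⊗[k] V →ₗ[k] V ⊗[k] V) (s : V ⊗[k] V) :
    tauAt τ 2 0 (two s) = two (τ s) := by
  apply toT_injective
  rw [toT_tauAt τ (q := 0) rfl (TensorPower.algebraMap₀ 1) (two s) (TensorPower.algebraMap₀ 1)]
  · simp [TensorPower.algebraMap₀_one]
  · simp [TensorPower.algebraMap₀_one]

theorem tensorMap_one_one_two (s : V ⊗[k] V) :
    tensorMap one.toLinearMap one.toLinearMap (two s) = s := by
  induction s using TensorProduct.induction_on with
  | zero => simp
  | tmul v w =>
    have : (two (v ⊗ₜ[k] w) : (⨂[k]^2) V) = tmul (a := 1) (b := 1) rfl (one.symm v) (one.symm w) := by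
      apply toT_injective
      simp [toT_two, toT_tmul, toT_one_symm]
    rw [this]
    exact (tensorMap_tmul _ _ _ _).trans (by simp)
  | add s t hs ht => simp only [map_add, hs, ht]

end TensorProducts

/-! ### Evaluation of multilinear operations on lists of elements of the envelope -/

namespace Env

variable {k V B : Type*} [Field k] [AddCommGroup V] [Module k V] [AddCommGroup B] [Module k B]
  {τ : V ⊗[k] V →ₗ[k] V ⊗[k] V}

section

variable {W W' W₁ W₂ : Type*} [AddCommGroup W] [Module k W] [AddCommGroup W'] [Module k W']
  [AddCommGroup W₁] [Module k W₁] [AddCommGroup W₂] [Module k W₂]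

theorem prod_map_left (φ : W₁ →ₗ[k] W) (x : Env W₁ τ) (y : Env W₂ τ) :
    prod τ (map τ φ x) y = map τ (TensorProduct.map φ LinearMap.id) (prod τ x y) := by
  rw [map_prod, map_id]; rfl

theorem prod_map_right (φ : W₂ →ₗ[k] W) (x : Env W₁ τ) (y : Env W₂ τ) :
    prod τ x (map τ φ y) = map τ (TensorProduct.map LinearMap.id φ) (prod τ x y) := by
  rw [map_prod, map_id]; rfl

theorem map_assoc_symm_prod {W₃ : Type*} [AddCommGroup W₃] [Module k W₃] (x : Env W₁ τ)
    (y : Env W₂ τ) (z : Env W₃ τ) :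
    map τ (TensorProduct.assoc k W₁ W₂ W₃).symm.toLinearMap (prod τ x (prod τ y z)) =
      prod τ (prod τ x y) z := by
  rw [← map_assoc_prod, map_map, LinearEquiv.symm_comp, map_id]; rfl

/-- The external product of a list of elements of the envelope. -/
def tens : (n : ℕ) → List (Env B τ) → Env ((⨂[k]^n) B) τ
  | 0, _ => map τ (TensorPower.algebraMap₀ (R := k) (M := B)).toLinearMap (unit τ)
  | _ + 1, [] => 0
  | n + 1, f :: L => map τ (tmulMap (a := 1) (b := n) (Nat.add_comm 1 n))
      (prod τ (map τ one.symm.toLinearMap f) (tens n L))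

theorem tens_append {a b n : ℕ} (h : a + b = n) (L₁ L₂ : List (Env B τ)) (h₁ : L₁.length = a) :
    tens n (L₁ ++ L₂) = map τ (tmulMap h) (prod τ (tens a L₁) (tens b L₂)) := by
  induction L₁ generalizing a n with
  | nil =>
    obtain rfl : a = 0 := by simpa using h₁.symm
    obtain rfl : b = n := by simpa using h
    rw [List.nil_append, tens, prod_map_left, map_map]
    conv_lhs => rw [← map_lid_prod_unit (tens b L₂)]
    congr 2
    refine TensorProduct.ext' fun c x => ?_
    apply toT_injective
    simp [tmulMap_tmul, toT_tmul, TensorPower.algebraMap₀_eq_smul_one]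
  | cons f L₁ ih =>
    obtain rfl : a = L₁.length + 1 := by simpa using h₁.symm
    obtain rfl : n = L₁.length + b + 1 := by omega
    rw [List.cons_append, tens, tens, ih rfl rfl]
    generalize map τ one.symm.toLinearMap f = F
    rw [prod_map_right, prod_map_left, map_map, map_map, ← map_assoc_prod, map_map]
    congr 2
    refine TensorProduct.ext_threefold fun x y z => ?_
    apply toT_injective
    simp [tmulMap_tmul, toT_tmul, mul_assoc]

/-- The value of a multilinear operation on a list of elements of the envelope. -/
def ap {n : ℕ} (M : (⨂[k]^n) B →ₗ[k] W) (L : List (Env B τ)) : Env W τ := map τ M (tens n L)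

theorem ap_comp {n : ℕ} (g : W →ₗ[k] W') (M : (⨂[k]^n) B →ₗ[k] W) (L : List (Env B τ)) :
    ap (g ∘ₗ M) L = map τ g (ap M L) := by rw [ap, ap, map_map]

theorem ap_add {n : ℕ} (M M' : (⨂[k]^n) B →ₗ[k] W) (L : List (Env B τ)) :
    ap (M + M') L = ap M L + ap M' L := by rw [ap, map_add]; rfl

theorem ap_smul {n : ℕ} (c : k) (M : (⨂[k]^n) B →ₗ[k] W) (L : List (Env B τ)) :
    ap (c • M) L = c • ap M L := by rw [ap, map_smul]; rfl

theorem ap_neg {n : ℕ} (M : (⨂[k]^n) B →ₗ[k] W) (L : List (Env B τ)) :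
    ap (-M) L = -ap M L := by rw [← neg_one_smul k, ap_smul, neg_one_smul]

theorem ap_sub {n : ℕ} (M M' : (⨂[k]^n) B →ₗ[k] W) (L : List (Env B τ)) :
    ap (M - M') L = ap M L - ap M' L := by rw [sub_eq_add_neg, ap_add, ap_neg, sub_eq_add_neg]

theorem ap_zero {n : ℕ} (L : List (Env B τ)) : ap (0 : (⨂[k]^n) B →ₗ[k] W) L = 0 := by
  rw [← zero_smul k (0 : (⨂[k]^n) B →ₗ[k] W), ap_smul, zero_smul]

theorem ap_sum {n : ℕ} {ι : Type*} (s : Finset ι) (M : ι → ((⨂[k]^n) B →ₗ[k] W))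
    (L : List (Env B τ)) : ap (∑ i ∈ s, M i) L = ∑ i ∈ s, ap (M i) L := by
  classical
  induction s using Finset.induction_on with
  | empty => rw [Finset.sum_empty, Finset.sum_empty, ap_zero]
  | insert a s ha ih => rw [Finset.sum_insert ha, Finset.sum_insert ha, ap_add, ih]

theorem ap_cast {n n' : ℕ} (h : n = n') (M : (⨂[k]^n') B →ₗ[k] W) (L : List (Env B τ)) :
    ap (M ∘ₗ (TensorPower.cast k B h).toLinearMap) L = ap M L := by
  subst h
  congr 1
  ext1; ext1 x; simp

theorem ap_one (f : Env B τ) : ap (one (k := k) (V := B)).toLinearMap [f] = f := by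
  rw [ap, tens, tens, prod_map_left, prod_map_right, map_map, map_map, map_map]
  conv_rhs => rw [← map_rid_prod_unit f]
  congr 2
  refine TensorProduct.ext' fun x c => ?_
  have : (tmulMap (a := 1) (b := 0) rfl (one.symm x ⊗ₜ[k] TensorPower.algebraMap₀ c) : (⨂[k]^1) B) =
      one.symm (c • x) := by
    apply toT_injective
    simp [tmulMap_tmul, toT_tmul, toT_one_symm, TensorPower.algebraMap₀_eq_smul_one]
  simp [this]

theorem tens_one (f : Env B τ) : tens 1 [f] = map τ (one (k := k) (V := B)).symm.toLinearMap f := by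
  conv_rhs => rw [← ap_one f, ap, map_map, LinearEquiv.symm_comp, map_id]
  rfl

theorem tens_two (f g : Env B τ) :
    tens 2 [f, g] = map τ (two (k := k) (V := B)).toLinearMap (prod τ f g) := by
  rw [show [f, g] = [f] ++ [g] from rfl, tens_append (a := 1) (b := 1) rfl _ _ rfl, tens_one,
    tens_one, ← map_prod, map_map]
  congr 2
  refine TensorProduct.ext' fun x y => ?_
  apply toT_injective
  simp [tmulMap_tmul, toT_tmul, toT_one_symm, toT_two]

theorem ap_tensorMap {a b : ℕ} (f : (⨂[k]^a) B →ₗ[k] W₁) (g : (⨂[k]^b) B →ₗ[k] W₂)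
    (L₁ L₂ : List (Env B τ)) (h : L₁.length = a) :
    ap (tensorMap f g) (L₁ ++ L₂) = prod τ (ap f L₁) (ap g L₂) := by
  rw [ap, tens_append rfl _ _ h, map_map, tensorMap_comp_tmulMap, map_prod]
  rfl

theorem map_idTensorId {p q a b n n' : ℕ} (φ : (⨂[k]^a) B →ₗ[k] (⨂[k]^b) B)
    (h : n = p + a + q) (h' : p + b + q = n') {L₁ L₂ L₂' L₃ : List (Env B τ)} (h₁ : L₁.length = p)
    (h₂ : L₂.length = a) (h₂' : L₂'.length = b) (hφ : map τ φ (tens a L₂) = tens b L₂') :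
    map τ (idTensorId p q φ h h') (tens n (L₁ ++ L₂ ++ L₃)) = tens n' (L₁ ++ L₂' ++ L₃) := by
  rw [tens_append (a := p + a) (b := q) h.symm _ _ (by simp [h₁, h₂]), tens_append rfl _ _ h₁,
    tens_append (a := p + b) (b := q) h' _ _ (by simp [h₁, h₂']), tens_append rfl _ _ h₁, ← hφ,
    prod_map_left, prod_map_right, prod_map_left, prod_map_left, map_map, map_map, map_map, map_map]
  congr 2
  refine TensorProduct.ext_threefold fun x y z => ?_
  apply toT_injective
  simp only [LinearMap.comp_apply, TensorProduct.map_tmul, LinearMap.id_apply, tmulMap_tmul,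
    toT_tmul]
  exact toT_idTensorId φ h h' x y z (by simp only [toT_tmul])

/-- An operation inserted in the middle replaces a block of arguments by its value, so nested
operations are evaluated from the inside. -/
theorem ap_idTensorId {p q a n n' : ℕ} (M : (⨂[k]^n') B →ₗ[k] W) (S : (⨂[k]^a) B →ₗ[k] B)
    (h : n = p + a + q) (h' : p + 1 + q = n') {L₁ L₂ L₃ : List (Env B τ)} (h₁ : L₁.length = p)
    (h₂ : L₂.length = a) :
    ap (M ∘ₗ idTensorId p q (one.symm.toLinearMap ∘ₗ S) h h') (L₁ ++ L₂ ++ L₃) =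
      ap M (L₁ ++ [ap S L₂] ++ L₃) := by
  rw [ap, map_comp, LinearMap.comp_apply, map_idTensorId _ h h' h₁ h₂ (L₂' := [ap S L₂]) rfl]
  · rfl
  · rw [tens_one, map_comp]; rfl

end

/-! ### Commutation up to the braiding of the target -/

section Commutation

variable (σ : B ⊗[k] B →ₗ[k] B ⊗[k] B)

/-- Elements of the envelope that commute up to the braiding of the target. -/
def Commute (f g : Env B τ) : Prop := map τ σ (prod τ f g) = prod τ g f

variable {σ}

theorem map_tauAt_tens {n i : ℕ} {L : List (Env B τ)} (hL : L.length = n)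
    (hc : ∀ f ∈ L, ∀ g ∈ L, Commute σ f g) :
    map τ (tauAt σ n i) (tens n L) = tens n (swapAt i L) := by
  by_cases hi : i + 2 ≤ n
  · obtain ⟨L₁, f, g, L₃, rfl, rfl⟩ := exists_pair (hL ▸ hi)
    rw [swapAt_append_pair, tauAt, dif_pos hi,
      show L₁ ++ f :: g :: L₃ = L₁ ++ [f, g] ++ L₃ by simp,
      show L₁ ++ g :: f :: L₃ = L₁ ++ [g, f] ++ L₃ by simp]
    refine map_idTensorId _ _ _ rfl rfl rfl ?_
    have := hc f (by simp) g (by simp)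
    rw [tens_two, tens_two, map_map, ← this, map_map]
    congr 2
    ext1; ext1 x; ext1 y; simp
  · rw [tauAt_of_not σ hi, swapAt_of_not (hL ▸ hi), map_id]; rfl

/-- This is where the braiding disappears: on commuting elements a braid word is a rearrangement of
the argument list. -/
theorem ap_comp_act {W : Type*} [AddCommGroup W] [Module k W] {n : ℕ} (M : (⨂[k]^n) B →ₗ[k] W)
    (l : List ℕ) {L : List (Env B τ)} (hL : L.length = n)
    (hc : ∀ f ∈ L, ∀ g ∈ L, Commute σ f g) :
    ap (M ∘ₗ act σ n l) L = ap M (applyWord l L) := by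
  induction l generalizing L with
  | nil => rfl
  | cons i l ih =>
    rw [act, ← LinearMap.comp_assoc, ap, map_comp, LinearMap.comp_apply, map_tauAt_tens hL hc]
    refine ih (by simp [hL]) fun f hf g hg => hc f ?_ g ?_
    · exact (swapAt_perm i L).mem_iff.1 hf
    · exact (swapAt_perm i L).mem_iff.1 hg

theorem ap_comp_tauAt {W : Type*} [AddCommGroup W] [Module k W] {n : ℕ} (M : (⨂[k]^n) B →ₗ[k] W)
    (i : ℕ) {L : List (Env B τ)} (hL : L.length = n) (hc : ∀ f ∈ L, ∀ g ∈ L, Commute σ f g) :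
    ap (M ∘ₗ tauAt σ n i) L = ap M (swapAt i L) :=
  ap_comp_act (σ := σ) M [i] hL hc

end Commutation

/-! ### Generators of the envelope and faithfulness of evaluation -/

section Faithful

/-- The generator with label `a`. -/
def gen (τ : V ⊗[k] V →ₗ[k] V ⊗[k] V) (j : V →ₗ[k] B) (a : ℕ) : Env B τ :=
  mk τ [a] rfl (j ∘ₗ one.toLinearMap)

/-- Consequently the value of `M` on generators is the class of `M` itself, precomposed with the
tensor power of `j`. -/
theorem tens_gen (j : V →ₗ[k] B) {n : ℕ} (w : List ℕ) (h : w.length = n) :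
    tens n (w.map (gen τ j)) = mk τ w h (PiTensorProduct.map fun _ => j) := by
  induction w generalizing n with
  | nil =>
    obtain rfl : n = 0 := by simpa using h.symm
    rw [List.map_nil, tens, unit, map_mk]
    congr 1
    ext1; ext1 x
    simp [TensorPower.algebraMap₀_eq_smul_one, TensorPower.gOne_def]
    congr
    funext i
    exact i.elim0
  | cons a w ih =>
    obtain rfl : n = w.length + 1 := by simpa using h.symm
    rw [List.map_cons, tens, ih rfl, gen, map_mk, prod_mk, map_mk]
    refine mk_congr rfl (Nat.add_comm _ _) ?_
    refine hom_ext_tmul rfl fun x y => ?_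
    obtain ⟨v, rfl⟩ := one.symm.surjective x
    simp only [LinearMap.comp_apply, tensorMap_tmul, tmulMap_tmul, LinearEquiv.coe_coe,
      LinearEquiv.apply_symm_apply]
    apply toT_injective
    simp only [toT_piMap, toT_cast, toT_tmul, toT_one_symm, map_mul]
    refine congrArg₂ (· * ·) ?_ rfl
    exact ((congrArg (TensorAlgebra.lift k (TensorAlgebra.ι k ∘ₗ j)) (toT_one_symm v)).trans
      (TensorAlgebra.lift_ι_apply _ _)).symm

theorem ap_gen {W : Type*} [AddCommGroup W] [Module k W] (j : V →ₗ[k] B) {n : ℕ}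
    (M : (⨂[k]^n) B →ₗ[k] W) (w : List ℕ) (h : w.length = n) :
    ap M (w.map (gen τ j)) = mk τ w h (M ∘ₗ PiTensorProduct.map fun _ => j) := by
  rw [ap, tens_gen j w h, map_mk]

/-- The labels `0, …, n - 1` are distinct, so the class determines the operator on the image of the
tensor power of `j`. -/
theorem comp_eq_of_ap_gen_eq {W : Type*} [AddCommGroup W] [Module k W] (hb : IsBraiding τ)
    (hτ : τ ∘ₗ τ = LinearMap.id) (j : V →ₗ[k] B) {n : ℕ} {M M' : (⨂[k]^n) B →ₗ[k] W}
    (h : ap M ((List.range n).map (gen τ j)) = ap M' ((List.range n).map (gen τ j))) :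
    M ∘ₗ PiTensorProduct.map (fun _ => j) = M' ∘ₗ PiTensorProduct.map (fun _ => j) := by
  rw [ap_gen j M _ List.length_range, ap_gen j M' _ List.length_range] at h
  exact mk_range_injective hb hτ h

/-- As `j` intertwines the braidings, σ on the target becomes τ on the arguments, which the relation
of the envelope turns into an exchange of labels. -/
theorem gen_commute {σ : B ⊗[k] B →ₗ[k] B ⊗[k] B} {j : V →ₗ[k] B}
    (hj : TensorProduct.map j j ∘ₗ τ = σ ∘ₗ TensorProduct.map j j) (a b : ℕ) :
    Commute σ (gen τ j a) (gen τ j b) := by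
  have h1 : σ ∘ₗ tensorMap (j ∘ₗ one.toLinearMap) (j ∘ₗ one.toLinearMap) =
      tensorMap (j ∘ₗ one.toLinearMap) (j ∘ₗ one.toLinearMap) ∘ₗ tauAt τ (1 + 1) 0 := by
    rw [← map_comp_tensorMap, ← LinearMap.comp_assoc, ← hj, LinearMap.comp_assoc,
      LinearMap.comp_assoc]
    congr 1
    ext1; ext1 x
    obtain ⟨s, hs⟩ := two.surjective (PiTensorProduct.tprod k x : (⨂[k]^(1 + 1)) V)
    simp only [LinearMap.compMultilinearMap_apply, LinearMap.comp_apply]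
    rw [← hs]
    refine (congrArg τ (tensorMap_one_one_two s)).trans ?_
    refine Eq.trans ?_ (congrArg _ (tauAt_two_zero τ s).symm)
    exact (tensorMap_one_one_two (τ s)).symm
  rw [Commute, gen, gen, prod_mk, map_mk, prod_mk, h1]
  exact mk_comp_tauAt ([a] ++ [b]) rfl _ 0

end Faithful

end Env

/-! ### The braiding and the unit element -/

section BraidedAlgebras

variable {k B : Type*} [Field k] [NonAssocRing B] [Module k B] [IsScalarTower k B B]
  [SMulCommClass k B B] {σ : B ⊗[k] B →ₗ[k] B ⊗[k] B}

/-- Compatibility with the unit is not an axiom. Multiplying by 1 in `mul_left` gives σ = Ψ σ, where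
Ψ(c ⊗ d) is obtained from σ(1 ⊗ c) by multiplying its second factor by d on the right. -/
theorem IsBraidedAlgebra.tau_one_left (hA : IsBraidedAlgebra σ) (hσ : σ ∘ₗ σ = LinearMap.id)
    (x : B) : σ (1 ⊗ₜ[k] x) = x ⊗ₜ[k] 1 := by
  set Ψ : B ⊗[k] B →ₗ[k] B ⊗[k] B := (LinearMap.mul' k B).lTensor B ∘ₗ
    (TensorProduct.assoc k B B B).toLinearMap ∘ₗ (σ ∘ₗ TensorProduct.mk k B B 1).rTensor B with hΨ
  have h1 : σ = Ψ ∘ₗ σ := by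
    refine TensorProduct.ext' fun b c => ?_
    have := LinearMap.congr_fun hA.mul_left ((1 ⊗ₜ[k] b) ⊗ₜ[k] c)
    simp only [LinearMap.comp_apply, LinearMap.rTensor_tmul, LinearMap.mul'_apply, one_mul] at this
    rw [this]
    simp only [hΨ, LinearMap.comp_apply, tauTwo, LinearEquiv.coe_coe, TensorProduct.assoc_tmul,
      LinearMap.lTensor_tmul]
    congr 2
    induction σ (b ⊗ₜ[k] c) using TensorProduct.induction_on with
    | zero => simp
    | tmul c d => simp [tauOne]
    | add s t hs ht => simp only [TensorProduct.tmul_add, map_add, hs, ht]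
  -- σ is invertible, hence Ψ is the identity; its value at `x ⊗ 1` is `σ (1 ⊗ x)`.
  have h2 : Ψ = LinearMap.id := by
    have := congrArg (· ∘ₗ σ) h1
    simp only [LinearMap.comp_assoc, hσ, LinearMap.comp_id] at this
    exact this.symm
  have h3 := LinearMap.congr_fun h2 (x ⊗ₜ[k] 1)
  rw [LinearMap.id_apply] at h3
  rw [← h3]
  simp only [hΨ, LinearMap.comp_apply, LinearMap.rTensor_tmul, TensorProduct.mk_apply,
    LinearEquiv.coe_coe]
  induction σ (1 ⊗ₜ[k] x) using TensorProduct.induction_on with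
  | zero => simp
  | tmul c d => simp
  | add s t hs ht => rw [TensorProduct.add_tmul, map_add, map_add, ← hs, ← ht]

theorem IsBraidedAlgebra.tau_one_right (hA : IsBraidedAlgebra σ) (hσ : σ ∘ₗ σ = LinearMap.id)
    (x : B) : σ (x ⊗ₜ[k] 1) = 1 ⊗ₜ[k] x := by
  rw [← hA.tau_one_left hσ x]
  exact LinearMap.congr_fun hσ _

end BraidedAlgebras

/-! ### The algebra structure of the envelope and the recursion for P -/

namespace Env

variable {k V B : Type*} [Field k] [AddCommGroup V] [Module k V]
  {τ : V ⊗[k] V →ₗ[k] V ⊗[k] V}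

section

variable {W W₁ W₂ : Type*} [AddCommGroup W] [Module k W] [AddCommGroup W₁] [Module k W₁]
  [AddCommGroup W₂] [Module k W₂]

variable (τ) in
/-- The bilinear operation on envelopes that is induced by a linear map on a tensor product. -/
def bilin (m : W₁ ⊗[k] W₂ →ₗ[k] W) : Env W₁ τ →+ Env W₂ τ →+ Env W τ :=
  AddMonoidHom.mk' (fun x => (map τ m ∘ₗ prod τ x).toAddMonoidHom) fun x y => by
    ext z
    simp

theorem bilin_apply (m : W₁ ⊗[k] W₂ →ₗ[k] W) (x : Env W₁ τ) (y : Env W₂ τ) :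
    bilin τ m x y = map τ m (prod τ x y) := rfl

end

variable [NonAssocRing B] [Module k B] [IsScalarTower k B B] [SMulCommClass k B B]

variable (k B τ) in
/-- The multiplication of the envelope of an algebra. -/
abbrev mul : Env B τ →+ Env B τ →+ Env B τ := bilin τ (LinearMap.mul' k B)

variable (B τ) in
/-- The unit element of the envelope of an algebra. -/
def one : Env B τ := map τ (LinearMap.toSpanSingleton k B 1) (unit τ)

omit [IsScalarTower k B B] [SMulCommClass k B B] in
theorem prod_one (x : Env B τ) : prod τ x (one B τ) = map τ ((TensorProduct.mk k B B).flip 1) x := by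
  conv_rhs => rw [← map_rid_prod_unit x, map_map]
  rw [one, prod_map_right]
  congr 2
  refine TensorProduct.ext' fun b c => ?_
  simp

omit [IsScalarTower k B B] [SMulCommClass k B B] in
theorem one_prod (x : Env B τ) : prod τ (one B τ) x = map τ (TensorProduct.mk k B B 1) x := by
  conv_rhs => rw [← map_lid_prod_unit x, map_map]
  rw [one, prod_map_left]
  congr 2
  refine TensorProduct.ext' fun b c => ?_
  simp [TensorProduct.smul_tmul]

theorem mul_one (x : Env B τ) : mul k B τ x (one B τ) = x := by
  rw [bilin_apply, prod_one, map_map]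
  conv_rhs => rw [← LinearMap.id_apply (R := k) x, ← map_id]
  congr 2
  ext b
  simp

theorem one_mul (x : Env B τ) : mul k B τ (one B τ) x = x := by
  rw [bilin_apply, one_prod, map_map]
  conv_rhs => rw [← LinearMap.id_apply (R := k) x, ← map_id]
  congr 2
  ext b
  simp

theorem ap_prodMap {a b : ℕ} (f : (⨂[k]^a) B →ₗ[k] B) (g : (⨂[k]^b) B →ₗ[k] B)
    (L₁ L₂ : List (Env B τ)) (h : L₁.length = a) :
    ap (prodMap f g) (L₁ ++ L₂) = mul k B τ (ap f L₁) (ap g L₂) := by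
  rw [prodMap, ap_comp, ap_tensorMap _ _ _ _ h]
  rfl

section Letters

variable {X : Type*} (i : X → Env B τ)

/-- The left-normed product. -/
abbrev lprod (u : List X) : Env B τ := leftNormed (mul k B τ) (one B τ) i u

theorem lprod_nil : lprod i [] = one B τ := rfl

theorem lprod_concat (u : List X) (x : X) :
    lprod i (u ++ [x]) = mul k B τ (lprod i u) (i x) := leftNormed_concat _ _ _ u x

theorem ap_leftProd {n : ℕ} (u : List X) (h : u.length = n) :
    ap (leftProd n) (u.map i) = lprod i u := by
  induction u using List.reverseRecOn generalizing n with
  | nil =>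
    obtain rfl : n = 0 := by simpa using h.symm
    rw [leftProd, List.map_nil, ap, tens, map_map, lprod, leftNormed, one, List.foldl_nil]
    congr 2
    ext
    simp [TensorPower.algebraMap₀]
  | append_singleton u x ih =>
    obtain rfl : n = u.length + 1 := by simpa using h.symm
    rw [leftProd, List.map_append, ap_prodMap _ _ _ _ (by simp), ih rfl, lprod_concat]
    congr 1
    exact ap_one _

variable (σ : B ⊗[k] B →ₗ[k] B ⊗[k] B)

/-- The value of the operations `P` on words. -/
def apP (u v : List X) (z : X) : Env B τ :=
  ap (P σ u.length v.length) ((u ++ v ++ [z]).map i)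

variable {i σ}

theorem ap_P {m n : ℕ} {u v : List X} (hu : u.length = m) (hv : v.length = n) (z : X) :
    ap (P σ m n) (u.map i ++ v.map i ++ [i z]) = apP i σ u v z := by
  subst hu hv
  simp [apP]

theorem lt_of_mem_shuffleWord {n r : ℕ} {π : Equiv.Perm (Fin n)} {j : ℕ}
    (hj : j ∈ shuffleWord r π) : j + 1 < n := by
  simp only [shuffleWord, List.mem_flatMap, moveWord, List.mem_reverse, List.mem_range'_1] at hj
  obtain ⟨a, -, hj⟩ := hj
  have := (π a).isLt
  omega

/-- The summands of the recursion for the operations `P`. -/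
theorem sum_shuffles_ap_P (hc : ∀ x y, Commute σ (i x) (i y)) {u v : List X} (z : X) {r s m n : ℕ}
    (hm : u.length = m) (hn : v.length = n)
    (hr : r ≤ m) (hs : s ≤ n)
    (h : m + n + 1 = r + s + (m - r + (n - s) + 1)) :
    ∑ π ∈ shuffles m r, ∑ ρ ∈ shuffles n s,
      ap (prodMap (prodMap (leftProd r) (leftProd s)) (P σ (m - r) (n - s)) ∘ₗ
            (TensorPower.cast k B h).toLinearMap ∘ₗ
            act σ (m + n + 1) (shuffleWord r π ++ shift m (shuffleWord s ρ) ++ blockWord r m s))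
        ((u ++ v ++ [z]).map i) =
      csum u fun u₁ u₂ => csum v fun v₁ v₂ => if u₁.length = r ∧ v₁.length = s then
        mul k B τ (mul k B τ (lprod i u₁) (lprod i v₁)) (apP i σ u₂ v₂ z) else 0 := by
  set G : List X → List X → Env B τ := fun u' v' =>
    ap (prodMap (prodMap (leftProd r) (leftProd s)) (P σ (m - r) (n - s)) ∘ₗ
      (TensorPower.cast k B h).toLinearMap)
      ((applyWord (blockWord r m s) (u' ++ v' ++ [z])).map i) with hG
  have h1 : ∀ π ∈ shuffles m r, ∀ ρ ∈ shuffles n s,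
      ap (prodMap (prodMap (leftProd r) (leftProd s)) (P σ (m - r) (n - s)) ∘ₗ
            (TensorPower.cast k B h).toLinearMap ∘ₗ
            act σ (m + n + 1) (shuffleWord r π ++ shift m (shuffleWord s ρ) ++ blockWord r m s))
        ((u ++ v ++ [z]).map i) =
      G (applyWord (shuffleWord r π) u) (applyWord (shuffleWord s ρ) v) := by
    intro π _ ρ _
    rw [← LinearMap.comp_assoc, ap_comp_act _ _ (by simp [hm, hn, Nat.add_assoc]), ← applyWord_map, hG]
    · congr 2
      rw [applyWord_append, applyWord_append, List.append_assoc u v, applyWord_append_left]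
      · have h2 := applyWord_shift (shuffleWord s ρ) (applyWord (shuffleWord r π) u) (v ++ [z])
        rw [length_applyWord, hm] at h2
        rw [h2, applyWord_append_left (w := shuffleWord s ρ), List.append_assoc]
        intro j hj
        rw [hn]
        exact lt_of_mem_shuffleWord hj
      · intro j hj
        rw [hm]
        exact lt_of_mem_shuffleWord hj
    · intro f hf g hg
      obtain ⟨x, -, rfl⟩ := List.mem_map.1 hf
      obtain ⟨y, -, rfl⟩ := List.mem_map.1 hg
      exact hc x y
  rw [Finset.sum_congr rfl fun π hπ => Finset.sum_congr rfl fun ρ hρ => h1 π hπ ρ hρ,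
    sum_shuffles u hm hr fun u' => ∑ ρ ∈ shuffles n s, G u' (applyWord (shuffleWord s ρ) v)]
  refine csum_congr fun u₁ u₂ hu => ?_
  by_cases hu₁ : u₁.length = r
  · rw [if_pos hu₁, sum_shuffles v hn hs fun v' => G (u₁ ++ u₂) v']
    refine csum_congr fun v₁ v₂ hv => ?_
    by_cases hv₁ : v₁.length = s
    · rw [if_pos hv₁, if_pos ⟨hu₁, hv₁⟩, hG]
      have h2 : applyWord (blockWord r m s) (u₁ ++ u₂ ++ (v₁ ++ v₂) ++ [z]) =
          (u₁ ++ v₁) ++ (u₂ ++ v₂ ++ [z]) := by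
        have := applyWord_blockWord u₁ u₂ v₁ (v₂ ++ [z])
        rw [hu₁, hv₁, show r + u₂.length = m by omega] at this
        simpa using this
      simp only [h2]
      rw [ap_cast, List.map_append, ap_prodMap _ _ _ _ (by simp [hu₁, hv₁]), List.map_append,
        ap_prodMap _ _ _ _ (by simp [hu₁]), ap_leftProd i _ hu₁, ap_leftProd i _ hv₁]
      congr 1
      rw [← ap_P (show u₂.length = m - r by omega) (show v₂.length = n - s by omega)]
      simp
    · rw [if_neg hv₁, if_neg fun h => hv₁ h.2]
  · rw [if_neg hu₁]
    simp only [hu₁, false_and, if_false, csum_zero]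

theorem ap_associator {m n : ℕ} {u v : List X} (hm : u.length = m) (hn : v.length = n) (z : X)  :
    ap (prodMap (prodMap (leftProd m) (leftProd n)) BraidedSabinin.one.toLinearMap -
      prodMap (leftProd m) (prodMap (leftProd n) BraidedSabinin.one.toLinearMap) ∘ₗ
        (TensorPower.cast k B (Nat.add_assoc m n 1)).toLinearMap) ((u ++ v ++ [z]).map i) =
      mul k B τ (mul k B τ (lprod i u) (lprod i v)) (i z) -
        mul k B τ (lprod i u) (mul k B τ (lprod i v) (i z)) := by
  rw [ap_sub, ap_cast]
  congr 1
  · rw [List.map_append, ap_prodMap _ _ _ _ (by simp [hm, hn]), List.map_append,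
      ap_prodMap _ _ _ _ (by simp [hm]), ap_leftProd i _ hm, ap_leftProd i _ hn]
    congr 1
    exact ap_one _
  · rw [List.append_assoc, List.map_append, ap_prodMap _ _ _ _ (by simp [hm]), List.map_append,
      ap_prodMap _ _ _ _ (by simp [hn]), ap_leftProd i _ hm, ap_leftProd i _ hn]
    congr 2
    exact ap_one _

/-- The recursive sum is empty and an associator with first entry 1 vanishes. This justifies
including the degenerate terms in the convolution formula. -/
theorem apP_nil_left (v : List X) (z : X) : apP i σ [] v z = 0 := by
  rw [apP, P]
  simp only [List.length_nil, Finset.univ_eq_empty, Finset.sum_empty, sub_zero]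
  refine (ap_associator (u := []) (v := v) rfl rfl z).trans ?_
  rw [lprod_nil, one_mul, one_mul, sub_self]

theorem apP_nil_right (u : List X) (z : X) : apP i σ u [] z = 0 := by
  rw [apP, P]
  simp only [List.length_nil, Finset.univ_eq_empty, Finset.sum_empty, Finset.sum_const_zero,
    sub_zero]
  refine (ap_associator (u := u) (v := []) rfl rfl z).trans ?_
  rw [lprod_nil, mul_one, one_mul, sub_self]

/-- The recursion with the shuffles and block moves absorbed into splittings of the two words. -/
theorem apP_eq (hc : ∀ x y, Commute σ (i x) (i y)) (u v : List X) (z : X) :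
    apP i σ u v z = mul k B τ (mul k B τ (lprod i u) (lprod i v)) (i z) -
      mul k B τ (lprod i u) (mul k B τ (lprod i v) (i z)) -
      csum u fun u₁ u₂ => csum v fun v₁ v₂ =>
        if u₁.length < u.length ∧ v₁.length < v.length ∧ 0 < u₁.length + v₁.length then
          mul k B τ (mul k B τ (lprod i u₁) (lprod i v₁)) (apP i σ u₂ v₂ z) else 0 := by
  rw [apP, P, ap_sub, ap_associator rfl rfl]
  congr 1
  have h1 : ∀ (r : Fin u.length) (s : Fin v.length),
      ap (if h : 0 < r.val + s.val then
        ∑ π ∈ shuffles u.length r, ∑ ρ ∈ shuffles v.length s,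
          prodMap (prodMap (leftProd r) (leftProd s)) (P σ (u.length - r) (v.length - s)) ∘ₗ
            (TensorPower.cast k B (show u.length + v.length + 1 =
              r + s + (u.length - r + (v.length - s) + 1) by omega)).toLinearMap ∘ₗ
            act σ (u.length + v.length + 1)
              (shuffleWord r π ++ shift u.length (shuffleWord s ρ) ++ blockWord r u.length s)
      else 0) ((u ++ v ++ [z]).map i) = csum u fun u₁ u₂ => csum v fun v₁ v₂ =>
        if 0 < r.val + s.val ∧ u₁.length = r ∧ v₁.length = s then
          mul k B τ (mul k B τ (lprod i u₁) (lprod i v₁)) (apP i σ u₂ v₂ z) else 0 := by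
    intro r s
    by_cases h : 0 < r.val + s.val
    · rw [dif_pos h]
      simp only [ap_sum]
      rw [sum_shuffles_ap_P hc z rfl rfl r.isLt.le s.isLt.le]
      simp only [h, true_and]
    · rw [dif_neg h, ap_zero]
      simp only [h, false_and, if_false, csum_zero]
  simp only [ap_sum, h1]
  -- The sums over lengths are moved inside the splittings, where at most one pair of lengths
  -- contributes.
  rw [← Finset.sum_congr rfl fun r _ => csum_sum _ _ _, ← csum_sum]
  congr 1
  funext u₁ u₂
  rw [← Finset.sum_congr rfl fun r _ => csum_sum _ _ _, ← csum_sum]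
  congr 1
  funext v₁ v₂
  by_cases h : u₁.length < u.length ∧ v₁.length < v.length ∧ 0 < u₁.length + v₁.length
  · rw [if_pos h, Finset.sum_eq_single ⟨u₁.length, h.1⟩, Finset.sum_eq_single ⟨v₁.length, h.2.1⟩,
      if_pos ⟨h.2.2, rfl, rfl⟩]
    · intro s _ hs
      exact if_neg fun h' => hs (Fin.ext h'.2.2.symm)
    · simp
    · intro r _ hr
      exact Finset.sum_eq_zero fun s _ => if_neg fun h' => hr (Fin.ext h'.2.1.symm)
    · simp
  · rw [if_neg h]
    refine Finset.sum_eq_zero fun r _ => Finset.sum_eq_zero fun s _ => if_neg fun h' => h ?_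
    have := r.isLt
    have := s.isLt
    omega

/-- The associator of left-normed products in terms of the operations `P`. -/
theorem assoc_eq_csum (hc : ∀ x y, Commute σ (i x) (i y)) (u v : List X) (z : X) :
    mul k B τ (mul k B τ (lprod i u) (lprod i v)) (i z) -
      mul k B τ (lprod i u) (mul k B τ (lprod i v) (i z)) =
      csum u fun u₁ u₂ => csum v fun v₁ v₂ =>
        mul k B τ (mul k B τ (lprod i u₁) (lprod i v₁)) (apP i σ u₂ v₂ z) := by
  rw [sub_eq_iff_eq_add.1 (apP_eq hc u v z).symm]
  -- The left side of the recursion is the missing term of the convolution, with both first parts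
  -- empty.
  have h1 : apP i σ u v z = csum u fun u₁ u₂ => csum v fun v₁ v₂ =>
      if 0 < u₁.length + v₁.length then 0 else
        mul k B τ (mul k B τ (lprod i u₁) (lprod i v₁)) (apP i σ u₂ v₂ z) := by
    rw [csum_eq_single, csum_eq_single]
    · simp [lprod, leftNormed, one_mul]
    · intro v₁ v₂ h h'
      exact if_pos (by omega)
    · intro u₁ u₂ h h'
      exact (csum_congr fun v₁ v₂ _ => if_pos (by omega)).trans (csum_zero v)
  conv_lhs => rw [h1]
  rw [← csum_add]
  refine csum_congr fun u₁ u₂ hu => ?_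
  rw [← csum_add]
  refine csum_congr fun v₁ v₂ hv => ?_
  by_cases h : 0 < u₁.length + v₁.length
  · rw [if_pos h, zero_add]
    by_cases h' : u₁.length < u.length ∧ v₁.length < v.length
    · rw [if_pos ⟨h'.1, h'.2, h⟩]
    · rw [if_neg fun h'' => h' ⟨h''.1, h''.2.1⟩]
      -- The terms absent from the recursion have `u₂` or `v₂` empty, and there P vanishes.
      by_cases hu₂ : u₂ = []
      · rw [hu₂, apP_nil_left, map_zero]
      · obtain rfl : v₂ = [] := by
          have := List.length_pos_iff.2 hu₂
          rw [← List.length_eq_zero_iff]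
          omega
        rw [apP_nil_right, map_zero]
  · rw [if_neg h, if_neg fun h' => h h'.2.2, add_zero]

end Letters

end Env

theorem applyWord_range {α : Type*} (L : List α) (x : α) :
    applyWord (List.range L.length) (x :: L) = L ++ [x] := by
  induction L using List.reverseRecOn with
  | nil => rfl
  | append_singleton L y ih =>
    rw [List.length_append, List.length_singleton, List.range_succ, applyWord_append,
      ← List.cons_append, applyWord_append_left, ih]
    · simpa [applyWord_cons, applyWord_nil] using swapAt_append_pair L [] x y
    · intro i hi
      simp at hi ⊢
      omega

theorem applyWord_range_reverse {α : Type*} (L : List α) (x : α) :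
    applyWord (List.range L.length).reverse (L ++ [x]) = x :: L := by
  induction L using List.reverseRecOn with
  | nil => rfl
  | append_singleton L y ih =>
    have := swapAt_append_pair L [] y x
    rw [List.length_append, List.length_singleton, List.range_succ, List.reverse_append,
      List.reverse_singleton, List.singleton_append, applyWord_cons, List.append_assoc,
      List.singleton_append, this, ← List.singleton_append, ← List.append_assoc,
      applyWord_append_left, ih]
    · rfl
    · intro i hi
      simp at hi ⊢
      omega

theorem csum_mem {α M : Type*} [AddCommMonoid M] (S : AddSubmonoid M) (l : List α)
    {φ : List α → List α → M}
    (h : ∀ u v, u.length + v.length = l.length → φ u v ∈ S) : csum l φ ∈ S := by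
  induction l generalizing φ with
  | nil => exact h [] [] rfl
  | cons a l ih =>
    exact S.add_mem (ih fun u v huv => h _ _ (by simp; omega))
      (ih fun u v huv => h _ _ (by simp; omega))

theorem lt_of_mem_permWord {n : ℕ} {π : Equiv.Perm (Fin n)} {i : ℕ} (hi : i ∈ permWord π) :
    i + 1 < n := (exists_word π).choose_spec.1 i hi

/-! ### The generated subalgebra and the operations S and Φ on it -/

namespace Env

variable {k V B : Type*} [Field k] [AddCommGroup V] [Module k V]
  {τ : V ⊗[k] V →ₗ[k] V ⊗[k] V}

section

variable [AddCommGroup B] [Module k B] {σ : B ⊗[k] B →ₗ[k] B ⊗[k] B} {f g h : Env B τ}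

theorem Commute.symm (hσ : σ ∘ₗ σ = LinearMap.id) (hfg : Commute σ f g) : Commute σ g f := by
  rw [Commute, ← hfg, map_map, hσ, map_id]
  rfl

theorem Commute.add_left (hf : Commute σ f h) (hg : Commute σ g h) : Commute σ (f + g) h := by
  simp only [Commute, _root_.map_add, LinearMap.add_apply] at *
  rw [hf, hg]

theorem Commute.smul_left (c : k) (hf : Commute σ f h) : Commute σ (c • f) h := by
  simp only [Commute, _root_.map_smul, LinearMap.smul_apply] at *
  rw [hf]

theorem Commute.map_tauOne (hfg : Commute σ f g) (h : Env B τ) :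
    map τ (tauOne σ) (prod τ (prod τ f g) h) = prod τ (prod τ g f) h := by
  rw [← hfg, prod_map_left]
  rfl

theorem Commute.map_tauTwo (f : Env B τ) (hgh : Commute σ g h) :
    map τ (tauTwo σ) (prod τ (prod τ f g) h) = prod τ (prod τ f h) g := by
  rw [tauTwo, map_comp, map_comp, LinearMap.comp_apply, LinearMap.comp_apply, map_assoc_prod,
    ← map_assoc_symm_prod, ← hgh, prod_map_right]
  rfl

end

variable [NonAssocRing B] [Module k B] [IsScalarTower k B B] [SMulCommClass k B B]
  {σ : B ⊗[k] B →ₗ[k] B ⊗[k] B} {f g h : Env B τ}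

/-- The axiom `mul_left` lets `h` pass `g` and then `f`. -/
theorem Commute.mul_left (hA : IsBraidedAlgebra σ) (hf : Commute σ f h) (hg : Commute σ g h) :
    Commute σ (mul k B τ f g) h := by
  rw [Commute, bilin_apply, prod_map_left, map_map]
  have h1 := congrArg (fun F => map τ F (prod τ (prod τ f g) h)) hA.mul_left
  refine h1.trans ?_
  simp only [map_comp, LinearMap.comp_apply]
  rw [hg.map_tauTwo, hf.map_tauOne, map_assoc_prod, prod_map_right]
  rfl

theorem one_commute (hA : IsBraidedAlgebra σ) (hσ : σ ∘ₗ σ = LinearMap.id) (f : Env B τ) :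
    Commute σ (one B τ) f := by
  rw [Commute, one_prod, prod_one, map_map]
  congr 2
  ext x
  simp [hA.tau_one_left hσ]

/-- The elements generated by the images of the generators. -/
inductive IsGen (j : V →ₗ[k] B) : Env B τ → Prop
  | gen (a : ℕ) : IsGen j (gen τ j a)
  | one : IsGen j (one B τ)
  | add {f g : Env B τ} : IsGen j f → IsGen j g → IsGen j (f + g)
  | smul (c : k) {f : Env B τ} : IsGen j f → IsGen j (c • f)
  | mul {f g : Env B τ} : IsGen j f → IsGen j g → IsGen j (mul k B τ f g)

variable {j : V →ₗ[k] B}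

/-- Commutation is stable under the operations in the first argument. Symmetry, from σ² = id,
reduces the second argument to the same induction. -/
theorem IsGen.commute (hA : IsBraidedAlgebra σ) (hσ : σ ∘ₗ σ = LinearMap.id)
    (hj : TensorProduct.map j j ∘ₗ τ = σ ∘ₗ TensorProduct.map j j)
    (hf : IsGen j f) (hg : IsGen j g) : Commute σ f g := by
  induction hf with
  | gen a =>
    refine Commute.symm hσ ?_
    induction hg with
    | gen b => exact gen_commute hj b a
    | one => exact one_commute hA hσ _
    | add _ _ h h' => exact h.add_left h'
    | smul c _ h => exact h.smul_left c
    | mul _ _ h h' => exact Commute.mul_left hA h h'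
  | one => exact one_commute hA hσ _
  | add _ _ h h' => exact h.add_left h'
  | smul c _ h => exact h.smul_left c
  | mul _ _ h h' => exact Commute.mul_left hA h h'

variable (τ j) in
/-- The submodule of the elements generated by the images of the generators. -/
def gens : Submodule k (Env B τ) where
  carrier := {f | IsGen j f}
  zero_mem' := by
    have := IsGen.smul (0 : k) (IsGen.one (τ := τ) (j := j))
    rwa [zero_smul] at this
  add_mem' := IsGen.add
  smul_mem' c _ := IsGen.smul c

theorem mul_mem_gens (hf : f ∈ gens τ j) (hg : g ∈ gens τ j) : mul k B τ f g ∈ gens τ j :=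
  IsGen.mul hf hg

theorem gen_mem_gens (a : ℕ) : gen τ j a ∈ gens τ j := IsGen.gen a

theorem gens_commute (hA : IsBraidedAlgebra σ) (hσ : σ ∘ₗ σ = LinearMap.id)
    (hj : TensorProduct.map j j ∘ₗ τ = σ ∘ₗ TensorProduct.map j j) (x y : gens τ j) :
    Commute σ (x : Env B τ) y := IsGen.commute hA hσ hj x.2 y.2

section Membership

variable {X : Type*} {i : X → Env B τ} (hi : ∀ x, i x ∈ gens τ j)

include hi

theorem lprod_mem_gens (u : List X) : lprod i u ∈ gens τ j := by
  induction u using List.reverseRecOn with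
  | nil => exact IsGen.one
  | append_singleton u x ih => rw [lprod_concat]; exact mul_mem_gens ih (hi x)

/-- By the recursion, values of P are built from products of letters. -/
theorem apP_mem_gens (hc : ∀ x y, Commute σ (i x) (i y)) (u v : List X) (z : X) :
    apP i σ u v z ∈ gens τ j := by
  induction hn : u.length + v.length using Nat.strong_induction_on generalizing u v with
  | _ n ih =>
    rw [apP_eq hc]
    refine sub_mem (sub_mem ?_ ?_) ?_
    · exact mul_mem_gens (mul_mem_gens (lprod_mem_gens hi u) (lprod_mem_gens hi v)) (hi z)
    · exact mul_mem_gens (lprod_mem_gens hi u) (mul_mem_gens (lprod_mem_gens hi v) (hi z))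
    · refine csum_mem (gens τ j).toAddSubmonoid u fun u₁ u₂ hu =>
        csum_mem (gens τ j).toAddSubmonoid v fun v₁ v₂ hv => ?_
      split_ifs with h
      · exact mul_mem_gens (mul_mem_gens (lprod_mem_gens hi u₁) (lprod_mem_gens hi v₁))
          (ih (u₂.length + v₂.length) (by omega) u₂ v₂ rfl)
      · exact (gens τ j).zero_mem

end Membership

section Letters

variable {X : Type*} {i : X → Env B τ}

/-- The value of the operations `S` on words. -/
def apS (i : X → Env B τ) (σ : B ⊗[k] B →ₗ[k] B ⊗[k] B) (u : List X) (y z : X) : Env B τ := ap (opS σ u.length) ((u ++ [y, z]).map i)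

theorem ap_opS {m : ℕ} {u : List X} (hu : u.length = m) (y z : X) :
    ap (opS σ m) ((u ++ [y, z]).map i) = apS i σ u y z := by
  subst hu
  rfl

theorem apS_nil (hc : ∀ x y, Commute σ (i x) (i y)) (y z : X) :
    apS i σ [] y z = -(mul k B τ (i y) (i z) - mul k B τ (i z) (i y)) := by
  rw [apS]
  simp only [List.length_nil, List.nil_append, List.map_cons, List.map_nil, opS]
  rw [ap_neg, ap, tens_two, map_map, LinearMap.comp_assoc, LinearEquiv.symm_comp,
    LinearMap.comp_id, bilin_apply, bilin_apply, ← hc y z, map_map, sub_eq_add_neg,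
    ← neg_one_smul k (LinearMap.mul' k B ∘ₗ σ), map_add, map_smul]
  simp [sub_eq_add_neg]

theorem apS_of_ne_nil (hc : ∀ x y, Commute σ (i x) (i y)) {u : List X} (hu : u ≠ []) (y z : X) :
    apS i σ u y z = -(apP i σ u [y] z - apP i σ u [z] y) := by
  obtain ⟨m, hm⟩ : ∃ m, u.length = m + 1 :=
    Nat.exists_eq_succ_of_ne_zero fun h => hu (List.length_eq_zero_iff.1 h)
  rw [← ap_opS hm, opS, ap_add, ap_neg, ap_comp_tauAt]
  · have hs := swapAt_append_pair u [] y z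
    rw [hm] at hs
    rw [← map_swapAt, hs, ← ap_P hm rfl, ← ap_P hm rfl]
    simp only [List.map_append, List.map_cons, List.map_nil, List.append_assoc, List.cons_append,
      List.nil_append, List.length_cons, List.length_nil]
    abel
  · simp [hm]
  · intro f hf g hg
    obtain ⟨x, -, rfl⟩ := List.mem_map.1 hf
    obtain ⟨y, -, rfl⟩ := List.mem_map.1 hg
    exact hc x y

/-- One formula for all lengths: the terms with P vanish on the empty word, and the commutator
appears only there. -/
theorem apS_eq (hc : ∀ x y, Commute σ (i x) (i y)) (u : List X) (y z : X) :
    apS i σ u y z = -(apP i σ u [y] z - apP i σ u [z] y) -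
      if u.length = 0 then mul k B τ (i y) (i z) - mul k B τ (i z) (i y) else 0 := by
  by_cases hu : u = []
  · subst hu
    rw [apS_nil hc, apP_nil_left, apP_nil_left]
    simp
  · rw [apS_of_ne_nil hc hu, if_neg (by simpa using hu), sub_zero]

/-- Antisymmetrize the associator formula in `y` and `z`. The difference between `u (y z)` and `u (z
y)` is supplied by the commutator term of S on the empty word. -/
theorem csum_mul_apS (hc : ∀ x y, Commute σ (i x) (i y)) (u : List X) (y z : X) :
    lprod i (u ++ [y, z]) - lprod i (u ++ [z, y]) +
      csum u (fun u₁ u₂ => mul k B τ (lprod i u₁) (apS i σ u₂ y z)) = 0 := by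
  have hsplit (y z : X) : lprod i (u ++ [y, z]) =
      mul k B τ (mul k B τ (lprod i u) (i y)) (i z) := by
    rw [← lprod_concat, ← lprod_concat, List.append_assoc]; rfl
  have hone (y : X) : lprod i [y] = i y := by
    have := lprod_concat (i := i) [] y
    rwa [lprod_nil, one_mul] at this
  have hassoc (y z : X) : mul k B τ (mul k B τ (lprod i u) (i y)) (i z) -
      mul k B τ (lprod i u) (mul k B τ (i y) (i z)) =
      csum u fun u₁ u₂ => mul k B τ (lprod i u₁) (apP i σ u₂ [y] z) := by
    have := assoc_eq_csum hc u [y] z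
    rw [hone] at this
    rw [this]
    congr 1
    funext u₁ u₂
    simp only [csum]
    rw [apP_nil_right, map_zero, zero_add, lprod_nil, mul_one]
  have hlast : csum u (fun u₁ u₂ => mul k B τ (lprod i u₁)
      (if u₂.length = 0 then mul k B τ (i y) (i z) - mul k B τ (i z) (i y) else 0)) =
      mul k B τ (lprod i u) (mul k B τ (i y) (i z) - mul k B τ (i z) (i y)) := by
    rw [csum_swap, csum_eq_single]
    · rfl
    · intro v w h h'
      rw [if_neg (by omega), map_zero]
  have h1 : csum u (fun u₁ u₂ => mul k B τ (lprod i u₁) (apS i σ u₂ y z)) =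
      -((csum u fun u₁ u₂ => mul k B τ (lprod i u₁) (apP i σ u₂ [y] z)) -
        csum u fun u₁ u₂ => mul k B τ (lprod i u₁) (apP i σ u₂ [z] y)) -
      mul k B τ (lprod i u) (mul k B τ (i y) (i z) - mul k B τ (i z) (i y)) := by
    rw [← hlast, ← csum_sub, ← csum_neg, ← csum_sub]
    congr 1
    funext u₁ u₂
    rw [apS_eq hc, map_sub, map_neg, map_sub]
  rw [h1, ← hassoc, ← hassoc, hsplit, hsplit, map_sub]
  abel

theorem ap_opPhi (hc : ∀ x y, Commute σ (i x) (i y)) {m n : ℕ} {u v : List X} (hu : u.length = m)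
    (hv : v.length = n + 1) :
    ap (opPhi σ m (n + 1)) ((u ++ v).map i) =
      ((m.factorial : k)⁻¹ * ((n + 1).factorial : k)⁻¹) •
        ∑ π : Equiv.Perm (Fin m), ∑ ρ : Equiv.Perm (Fin (n + 1)),
          ap (P σ m n) ((applyWord (permWord π) u ++ applyWord (permWord ρ) v).map i) := by
  rw [opPhi, ap_smul, ap_sum]
  congr 1
  refine Finset.sum_congr rfl fun π _ => ?_
  rw [ap_sum]
  refine Finset.sum_congr rfl fun ρ _ => ?_
  refine (ap_comp_act (n := m + n + 1) (P σ m n) _ ?_ ?_).trans ?_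
  · simp [hu, hv, Nat.add_assoc]
  · intro f hf g hg
    obtain ⟨x, -, rfl⟩ := List.mem_map.1 hf
    obtain ⟨y, -, rfl⟩ := List.mem_map.1 hg
    exact hc x y
  rw [← applyWord_map, applyWord_append, applyWord_append_left (w := permWord π)]
  · have h2 := applyWord_shift (permWord ρ) (applyWord (permWord π) u) v
    rw [length_applyWord, hu] at h2
    rw [h2]
  · intro a ha
    rw [hu]
    exact lt_of_mem_permWord ha

/-- Φ permutes the last argument of P together with its second block, so the cut into `u`, `v`, `z`
is recovered afterwards. -/
theorem exists_ap_P_eq {m n : ℕ} {L : List X} (h : L.length = m + n + 1) :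
    ∃ u v z, L = u ++ v ++ [z] ∧ u.length = m ∧ v.length = n ∧
      ap (P σ m n) (L.map i) = apP i σ u v z := by
  induction L using List.reverseRecOn with
  | nil => simp at h
  | append_singleton L z =>
    have hL : L.length = m + n := by simpa using h
    refine ⟨L.take m, L.drop m, z, by simp, by simp [hL], by simp [hL], ?_⟩
    rw [← ap_P (m := m) (n := n) (by simp [hL]) (by simp [hL])]
    congr 1
    rw [← List.map_append, List.take_append_drop, List.map_append]
    rfl

end Letters

section Closure

variable (hc : ∀ x y : gens τ j, Commute σ (x : Env B τ) y)

include hc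

/-- Closure allows all generated elements to serve as letters. Values of S are then letters again,
as the nested identities require. -/
theorem apS_mem_gens (u : List (gens τ j)) (y z : gens τ j) :
    apS Subtype.val σ u y z ∈ gens τ j := by
  rw [apS_eq hc]
  refine sub_mem (neg_mem (sub_mem (apP_mem_gens Subtype.property hc _ _ _) (apP_mem_gens Subtype.property hc _ _ _))) ?_
  split_ifs
  · exact sub_mem (mul_mem_gens y.2 z.2) (mul_mem_gens z.2 y.2)
  · exact zero_mem _

theorem ap_opPhi_mem_gens {m n : ℕ} {u v : List (gens τ j)} (hu : u.length = m)
    (hv : v.length = n + 1) : ap (opPhi σ m (n + 1)) ((u ++ v).map Subtype.val) ∈ gens τ j := by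
  rw [ap_opPhi hc hu hv]
  refine Submodule.smul_mem _ _ (Submodule.sum_mem _ fun π _ => Submodule.sum_mem _ fun ρ _ => ?_)
  obtain ⟨u', v', z, -, -, -, h⟩ := exists_ap_P_eq (σ := σ) (i := (Subtype.val : gens τ j → _))
    (m := m) (n := n) (L := applyWord (permWord π) u ++ applyWord (permWord ρ) v)
    (by simp [length_applyWord, hu, hv, Nat.add_assoc])
  rw [h]
  exact apP_mem_gens Subtype.property hc _ _ _

/-- The operations `S` on the generated elements. -/
def genS (u : List (gens τ j)) (y z : gens τ j) : gens τ j :=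
  ⟨apS Subtype.val σ u y z, apS_mem_gens hc u y z⟩

theorem isCommutatorFamily_genS :
    IsCommutatorFamily (mul k B τ) (one B τ) (Subtype.val : gens τ j → Env B τ) (genS hc) :=
  fun u y z => csum_mul_apS hc u y z

end Closure

end Env

/-! ### Braidedness and compositions of operations, evaluated on letters -/

namespace Env

section Words

variable {k V B X : Type*} [Field k] [AddCommGroup V] [Module k V]
  {τ : V ⊗[k] V →ₗ[k] V ⊗[k] V} [AddCommGroup B] [Module k B]
  {σ : B ⊗[k] B →ₗ[k] B ⊗[k] B} {i : X → Env B τ} (hc : ∀ x y, Commute σ (i x) (i y))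

include hc

theorem ap_comp_act_map {W : Type*} [AddCommGroup W] [Module k W] {n : ℕ}
    (M : (⨂[k]^n) B →ₗ[k] W) (l : List ℕ) {L : List X} (hL : L.length = n) :
    ap (M ∘ₗ act σ n l) (L.map i) = ap M ((applyWord l L).map i) := by
  rw [ap_comp_act M l (by simpa using hL), applyWord_map]
  intro f hf g hg
  obtain ⟨x, -, rfl⟩ := List.mem_map.1 hf
  obtain ⟨y, -, rfl⟩ := List.mem_map.1 hg
  exact hc x y

/-- The compositions with an operation `N` that are summed over shuffles. -/
theorem sum_shuffles_ap_idTensorId {r q n n' p : ℕ} (j : Fin (r + 1)) (M : (⨂[k]^n') B →ₗ[k] B)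
    (N : (⨂[k]^(r - j + p)) B →ₗ[k] B) (h : n = j + (r - j + p) + q) (h' : j + 1 + q = n')
    {u w₁ w₂ : List X} (hu : u.length = r) (hw₁ : w₁.length = p) (hw₂ : w₂.length = q) :
    ∑ π ∈ shuffles r j,
      ap (M ∘ₗ idTensorId j q (BraidedSabinin.one.symm.toLinearMap ∘ₗ N) h h' ∘ₗ
        act σ n (shuffleWord j π)) ((u ++ w₁ ++ w₂).map i) =
      csum u fun u₁ u₂ => if u₁.length = j.val then
        ap M (u₁.map i ++ [ap N ((u₂ ++ w₁).map i)] ++ w₂.map i) else 0 := by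
  have hj := j.isLt
  have h1 : ∀ π ∈ shuffles r j,
      ap (M ∘ₗ idTensorId j q (BraidedSabinin.one.symm.toLinearMap ∘ₗ N) h h' ∘ₗ
        act σ n (shuffleWord j π)) ((u ++ w₁ ++ w₂).map i) =
      ap (M ∘ₗ idTensorId j q (BraidedSabinin.one.symm.toLinearMap ∘ₗ N) h h')
        ((applyWord (shuffleWord j π) u ++ w₁ ++ w₂).map i) := by
    intro π _
    rw [← LinearMap.comp_assoc, ap_comp_act_map hc _ _ (by simp [hu, hw₁, hw₂]; omega),
      List.append_assoc, applyWord_append_left, List.append_assoc]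
    intro a ha
    rw [hu]
    exact lt_of_mem_shuffleWord ha
  rw [Finset.sum_congr rfl h1, sum_shuffles u hu (by omega) fun u' =>
    ap (M ∘ₗ idTensorId j q (BraidedSabinin.one.symm.toLinearMap ∘ₗ N) h h')
        ((u' ++ w₁ ++ w₂).map i)]
  refine csum_congr fun u₁ u₂ hu' => ?_
  by_cases hj : u₁.length = j.val
  · rw [if_pos hj, if_pos hj, ← ap_idTensorId M N h h' (by simpa using hj)
      (by simp [hw₁]; omega)]
    simp
  · rw [if_neg hj, if_neg hj]

/-- An operation whose values commute with the letters is braided. -/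
theorem ap_braided {m : ℕ} (M : (⨂[k]^m) B →ₗ[k] B) {u : List X} (hu : u.length = m) (x : X)
    (hM : Commute σ (ap M (u.map i)) (i x)) :
    ap (σ ∘ₗ tensorMap M BraidedSabinin.one.toLinearMap) ((u ++ [x]).map i) =
      ap (tensorMap BraidedSabinin.one.toLinearMap M ∘ₗ
        (TensorPower.cast k B (Nat.add_comm m 1)).toLinearMap ∘ₗ
        act σ (m + 1) (List.range m).reverse) ((u ++ [x]).map i) := by
  subst hu
  rw [ap_comp, List.map_append, ap_tensorMap _ _ _ _ (by simp), ← List.map_append,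
    ← LinearMap.comp_assoc, ap_comp_act_map hc _ _ (by simp), applyWord_range_reverse, ap_cast,
    ← List.singleton_append (l := u), List.map_append, ap_tensorMap _ _ _ _ (by simp)]
  have h1 : ap (BraidedSabinin.one (k := k) (V := B)).toLinearMap ([x].map i) = i x := ap_one _
  rw [h1]
  exact hM

theorem ap_braided' {m : ℕ} (M : (⨂[k]^m) B →ₗ[k] B) {u : List X} (hu : u.length = m) (x : X)
    (hM : Commute σ (i x) (ap M (u.map i))) :
    ap (σ ∘ₗ tensorMap BraidedSabinin.one.toLinearMap M ∘ₗ
        (TensorPower.cast k B (Nat.add_comm m 1)).toLinearMap) ((x :: u).map i) =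
      ap (tensorMap M BraidedSabinin.one.toLinearMap ∘ₗ act σ (m + 1) (List.range m))
        ((x :: u).map i) := by
  subst hu
  rw [ap_comp, ap_cast, ap_comp_act_map hc _ _ (by simp), applyWord_range,
    ← List.singleton_append, List.map_append, List.map_append, ap_tensorMap _ _ _ _ (by simp),
    ap_tensorMap _ _ _ _ (by simp)]
  have h1 : ap (BraidedSabinin.one (k := k) (V := B)).toLinearMap ([x].map i) = i x := ap_one _
  rw [h1]
  exact hM

end Words

theorem exists_eq_append_pair {α : Type*} {n : ℕ} {L : List α} (h : L.length = n + 2) :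
    ∃ u y z, L = u ++ [y, z] ∧ u.length = n := by
  have h2 : (L.drop n).length = 2 := by simp [h]
  obtain ⟨y, z, hyz⟩ := List.length_eq_two.1 h2
  exact ⟨L.take n, y, z, by rw [← hyz, List.take_append_drop], by simp [h]⟩

/-! ### The Sabinin identities on generated elements -/

section Sabinin

variable {k V B : Type*} [Field k] [AddCommGroup V] [Module k V]
  {τ : V ⊗[k] V →ₗ[k] V ⊗[k] V} [NonAssocRing B] [Module k B] [IsScalarTower k B B]
  [SMulCommClass k B B] {σ : B ⊗[k] B →ₗ[k] B ⊗[k] B} {j : V →ₗ[k] B}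
  (hc : ∀ x y : gens τ j, Commute σ (x : Env B τ) y)

include hc

theorem ap_antisymmetry {m : ℕ} {u : List (gens τ j)} (hu : u.length = m) (y z : gens τ j) :
    ap (opS σ m + opS σ m ∘ₗ tauAt σ (m + 2) m) ((u ++ [y, z]).map Subtype.val) = 0 := by
  have hs := swapAt_append_pair u [] y z
  rw [hu] at hs
  rw [ap_add, ← act_singleton, ap_comp_act_map hc _ _ (by simp [hu]), applyWord_cons, applyWord_nil,
    hs, ap_opS hu, ap_opS hu, apS_eq hc, apS_eq hc]
  split_ifs <;> abel

/-- The sum over `l` and shuffles is the sum over splittings of `u`, grouped by length, so the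
classical derivation identity applies. -/
theorem ap_derivation {m r : ℕ} (hr : r ≤ m) {u w : List (gens τ j)} (hu : u.length = r)
    (hw : w.length = m - r) (a b y z : gens τ j) :
    ap (opS σ (m + 2) - opS σ (m + 2) ∘ₗ tauAt σ (m + 2 + 2) r +
      ∑ l : Fin (r + 1), ∑ π ∈ shuffles r l,
        opS σ (m - r + l + 1) ∘ₗ
          idTensorId l (m - r + 2) (BraidedSabinin.one.symm.toLinearMap ∘ₗ opS σ (r - l))
            (show m + 2 + 2 = l + (r - l + 2) + (m - r + 2) by omega) (by omega) ∘ₗ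
          act σ (m + 2 + 2) (shuffleWord l π))
      ((u ++ [a, b] ++ (w ++ [y, z])).map Subtype.val) = 0 := by
  rw [ap_add, ap_sub, ap_sum]
  have hL (a b : gens τ j) : u ++ [a, b] ++ (w ++ [y, z]) = (u ++ a :: b :: w) ++ [y, z] := by simp
  have hs : swapAt r (u ++ [a, b] ++ (w ++ [y, z])) = u ++ [b, a] ++ (w ++ [y, z]) := by
    rw [← hu]
    simpa using swapAt_append_pair u (w ++ [y, z]) a b
  rw [← act_singleton, ap_comp_act_map hc _ _ (by simp [hu, hw]; omega), applyWord_cons,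
    applyWord_nil, hs, hL, hL, ap_opS (by simp [hu, hw]; omega), ap_opS (by simp [hu, hw]; omega)]
  have hd := (isCommutatorFamily_genS hc).derivation one_mul u w a b y z
  refine Eq.trans ?_ hd
  congr 1
  rw [csum_eq_sum_length, hu, Finset.sum_range]
  refine Finset.sum_congr rfl fun l _ => ?_
  rw [ap_sum, ← hL, sum_shuffles_ap_idTensorId hc (w₁ := [a, b]) (w₂ := w ++ [y, z]) l _ _ _ _ hu
    rfl (by simp [hw])]
  refine csum_congr fun u₁ u₂ hu' => ?_
  by_cases hl : u₁.length = l.val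
  · rw [if_pos hl, if_pos hl]
    have h1 := ap_opS (σ := σ) (i := (Subtype.val : gens τ j → Env B τ)) (m := m - r + l + 1)
      (u := u₁ ++ genS hc u₂ a b :: w) (by simp [hl, hw]; omega) y z
    refine Eq.trans ?_ h1
    congr 1
    have h2 := ap_opS (σ := σ) (i := (Subtype.val : gens τ j → Env B τ)) (m := r - l)
      (u := u₂) (by omega) a b
    rw [h2]
    simp [genS]
  · rw [if_neg hl, if_neg hl]

theorem ap_cyclic {m : ℕ} {u : List (gens τ j)} (hu : u.length = m) (x y z : gens τ j) :
    ap ((opS σ (m + 1) +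
      ∑ l : Fin (m + 1), ∑ π ∈ shuffles m l,
        opS σ l ∘ₗ
          idTensorId l 1 (BraidedSabinin.one.symm.toLinearMap ∘ₗ opS σ (m - l))
            (show m + 1 + 2 = l + (m - l + 2) + 1 by omega) (by omega) ∘ₗ
          act σ (m + 1 + 2) (shuffleWord l π)) ∘ₗ
      (LinearMap.id + act σ (m + 1 + 2) [m, m + 1] + act σ (m + 1 + 2) [m + 1, m]))
      ((u ++ [x, y, z]).map Subtype.val) = 0 := by
  set E : (⨂[k]^(m + 1 + 2)) B →ₗ[k] B := opS σ (m + 1) +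
      ∑ l : Fin (m + 1), ∑ π ∈ shuffles m l,
        opS σ l ∘ₗ
          idTensorId l 1 (BraidedSabinin.one.symm.toLinearMap ∘ₗ opS σ (m - l))
            (show m + 1 + 2 = l + (m - l + 2) + 1 by omega) (by omega) ∘ₗ
          act σ (m + 1 + 2) (shuffleWord l π) with hE
  have h1 (x y z : gens τ j) : ap E ((u ++ [x, y, z]).map Subtype.val) =
      (genS hc (u ++ [x]) y z : Env B τ) +
        csum u fun u₁ u₂ => (genS hc u₁ (genS hc u₂ x y) z : Env B τ) := by
    rw [hE, ap_add, ap_sum]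
    congr 1
    · have := ap_opS (σ := σ) (i := (Subtype.val : gens τ j → Env B τ)) (m := m + 1)
        (u := u ++ [x]) (by simp [hu]) y z
      refine Eq.trans ?_ this
      simp
    · rw [csum_eq_sum_length, hu, Finset.sum_range]
      refine Finset.sum_congr rfl fun l _ => ?_
      have hL : u ++ [x, y, z] = u ++ [x, y] ++ [z] := by simp
      rw [ap_sum, hL]
      refine (sum_shuffles_ap_idTensorId hc (p := 2) (q := 1) (w₁ := [x, y]) (w₂ := [z])
        l (opS σ l) (opS σ (m - l)) _ _ hu rfl rfl).trans ?_
      refine csum_congr fun u₁ u₂ hu' => ?_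
      by_cases hl : u₁.length = l.val
      · rw [if_pos hl, if_pos hl]
        have h1 := ap_opS (σ := σ) (i := (Subtype.val : gens τ j → Env B τ)) (m := l)
          (u := u₁) hl (genS hc u₂ x y) z
        refine Eq.trans ?_ h1
        congr 1
        have h2 := ap_opS (σ := σ) (i := (Subtype.val : gens τ j → Env B τ)) (m := m - l)
          (u := u₂) (by omega) x y
        rw [h2]
        simp [genS]
      · rw [if_neg hl, if_neg hl]
  have hlen : (u ++ [x, y, z]).length = m + 1 + 2 := by simp [hu]
  have hs0 (x y z : gens τ j) : swapAt m (u ++ [x, y, z]) = u ++ [y, x, z] := by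
    rw [← hu]; exact swapAt_append_pair u [z] x y
  have hs1 (x y z : gens τ j) : swapAt (m + 1) (u ++ [x, y, z]) = u ++ [x, z, y] := by
    have := swapAt_append_pair (u ++ [x]) [] y z
    simpa [hu] using this
  rw [LinearMap.comp_add, LinearMap.comp_add, LinearMap.comp_id, ap_add, ap_add,
    ap_comp_act_map hc _ _ hlen, ap_comp_act_map hc _ _ hlen]
  simp only [applyWord_cons, applyWord_nil, hs0, hs1, h1]
  -- A value of `E` pairs terms belonging to different cyclic summands; the sums over the three
  -- rotations agree.
  have := (isCommutatorFamily_genS hc).cyclic one_mul u x y z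
  simp only [cyclicTerm] at this
  rw [← this]
  abel

/-- The condition `r + 1 ≠ m` keeps the exchange within one block, where it is absorbed by the sum
over permutations. -/
theorem ap_symmetry {m n r : ℕ} (hr : r + 1 < m + (n + 1)) (hrm : r + 1 ≠ m)
    {u v : List (gens τ j)} (hu : u.length = m) (hv : v.length = n + 1) :
    ap (opPhi σ m (n + 1) - opPhi σ m (n + 1) ∘ₗ tauAt σ (m + (n + 1)) r)
      ((u ++ v).map Subtype.val) = 0 := by
  rw [ap_sub, ← act_singleton, ap_comp_act_map hc _ _ (by simp [hu, hv]), applyWord_cons,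
    applyWord_nil, sub_eq_zero, ap_opPhi hc hu hv]
  rcases Nat.lt_or_ge r m with h | h
  · have h1 : swapAt r (u ++ v) = swapAt r u ++ v := swapAt_append_left u v (by omega)
    rw [h1, ap_opPhi hc (by simp [hu]) hv]
    congr 1
    exact (sum_permWord_swapAt u hu r fun u' => ∑ ρ : Equiv.Perm (Fin (n + 1)),
      ap (P σ m n) ((u' ++ applyWord (permWord ρ) v).map Subtype.val)).symm
  · obtain ⟨s, rfl⟩ := Nat.exists_eq_add_of_le h
    have h1 : swapAt (m + s) (u ++ v) = u ++ swapAt s v := by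
      rw [← hu]; exact swapAt_append_right u v s
    rw [h1, ap_opPhi hc hu (by simp [hv])]
    congr 1
    refine Finset.sum_congr rfl fun π _ => ?_
    exact (sum_permWord_swapAt v hv s fun v' =>
      ap (P σ m n) ((applyWord (permWord π) u ++ v').map Subtype.val)).symm

end Sabinin

end Env

/-! ### The Sabinin structure on the whole algebra -/

section Faithful

variable {k B : Type*} [Field k] [NonAssocRing B] [Module k B] [IsScalarTower k B B]
  [SMulCommClass k B B] {σ : B ⊗[k] B →ₗ[k] B ⊗[k] B}

/-- Faithfulness for V = B and j the identity: generators with labels `0, …, n - 1` are among the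
admissible lists. -/
theorem eq_of_ap_eq {W : Type*} [AddCommGroup W] [Module k W] (hA : IsBraidedAlgebra σ)
    (hσ : σ ∘ₗ σ = LinearMap.id) {n : ℕ} {M M' : (⨂[k]^n) B →ₗ[k] W}
    (h : ∀ L : List (Env.gens σ (LinearMap.id : B →ₗ[k] B)), L.length = n →
      Env.ap M (L.map Subtype.val) = Env.ap M' (L.map Subtype.val)) : M = M' := by
  have := h ((List.range n).map fun a => ⟨Env.gen σ LinearMap.id a, Env.gen_mem_gens a⟩) (by simp)
  rw [List.map_map] at this
  have h2 := Env.comp_eq_of_ap_gen_eq hA.braiding hσ LinearMap.id this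
  rwa [PiTensorProduct.map_id, LinearMap.comp_id, LinearMap.comp_id] at h2

/-- The operations `S` and `Φ` on an algebra with an involutive braiding. -/
theorem IsBraidedAlgebra.isSabininTauAlgebra (hA : IsBraidedAlgebra σ)
    (hσ : σ ∘ₗ σ = LinearMap.id) : IsSabininTauAlgebra σ (opS σ) (opPhi σ) := by
  have hc : ∀ x y : Env.gens σ (LinearMap.id : B →ₗ[k] B), Env.Commute σ (x : Env B σ) y :=
    Env.gens_commute hA hσ (by rw [TensorProduct.map_id]; rfl)
  -- An operation with values in the generated subspace is braided, since these values commute with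
  -- every letter up to σ.
  have hbr {m : ℕ} (M : (⨂[k]^m) B →ₗ[k] B)
      (hM : ∀ u : List (Env.gens σ (LinearMap.id : B →ₗ[k] B)), u.length = m →
        Env.ap M (u.map Subtype.val) ∈ Env.gens σ (LinearMap.id : B →ₗ[k] B)) :
      IsBraidedOperation σ M := by
    constructor
    · refine eq_of_ap_eq hA hσ fun L hL => ?_
      induction L using List.reverseRecOn with
      | nil => simp at hL
      | append_singleton u x =>
        have hu : u.length = m := by simpa using hL
        exact Env.ap_braided hc M hu x (hc ⟨_, hM u hu⟩ x)
    · refine eq_of_ap_eq hA hσ fun L hL => ?_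
      cases L with
      | nil => simp at hL
      | cons x u =>
        have hu : u.length = m := by simpa using hL
        exact Env.ap_braided' hc M hu x (hc x ⟨_, hM u hu⟩)
  refine ⟨hA.braiding, hσ, fun m => hbr _ fun L hL => ?_, fun m n _ hn => hbr _ fun L hL => ?_,
    fun m => ?_, fun m r hr => ?_, fun m => ?_, fun m n _ hn r hr hrm => ?_⟩
  · obtain ⟨u, y, z, rfl, hu⟩ := Env.exists_eq_append_pair hL
    rw [Env.ap_opS hu]
    exact Env.apS_mem_gens hc u y z
  · obtain ⟨n, rfl⟩ := Nat.exists_eq_add_of_le' (show 1 ≤ n by omega)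
    rw [← List.take_append_drop m L]
    exact Env.ap_opPhi_mem_gens hc (by simp [hL]) (by simp [hL])
  · refine eq_of_ap_eq hA hσ fun L hL => ?_
    obtain ⟨u, y, z, rfl, hu⟩ := Env.exists_eq_append_pair hL
    rw [Env.ap_antisymmetry hc hu, Env.ap_zero]
  · refine eq_of_ap_eq hA hσ fun L hL => ?_
    obtain ⟨L, y, z, rfl, hL'⟩ := Env.exists_eq_append_pair hL
    obtain ⟨u, a, b, w, rfl, rfl⟩ := exists_pair (L := L) (i := r) (by omega)
    rw [show u ++ a :: b :: w ++ [y, z] = u ++ [a, b] ++ (w ++ [y, z]) by simp,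
      Env.ap_derivation hc hr rfl (by simp at hL'; omega), Env.ap_zero]
  · refine eq_of_ap_eq hA hσ fun L hL => ?_
    obtain ⟨L, y, z, rfl, hL'⟩ := Env.exists_eq_append_pair hL
    induction L using List.reverseRecOn with
    | nil => simp at hL'
    | append_singleton u x =>
      have hu : u.length = m := by simpa using hL'
      rw [show u ++ [x] ++ [y, z] = u ++ [x, y, z] by simp, Env.ap_cyclic hc hu, Env.ap_zero]
  · obtain ⟨n, rfl⟩ := Nat.exists_eq_add_of_le' (show 1 ≤ n by omega)
    refine eq_of_ap_eq hA hσ fun L hL => ?_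
    rw [← List.take_append_drop m L, Env.ap_symmetry hc hr hrm (by simp [hL]) (by simp [hL]),
      Env.ap_zero]

end Faithful

/-! ### Splittings of two lists into three blocks -/

section Reindexing

variable {α M : Type*} [AddCommMonoid M]

/-- Coassociativity and cocommutativity in both lists at once, used for the left tensor factor of a
coproduct. -/
theorem csum_csum_assoc_swap (u v : List α)
    (F : List α → List α → List α → List α → List α → List α → M) :
    (csum u fun u₁ u₂ => csum v fun v₁ v₂ => csum u₁ fun p₁ p₂ => csum v₁ fun q₁ q₂ =>
      F p₁ p₂ u₂ q₁ q₂ v₂) =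
    csum u fun u₁ u₂ => csum v fun v₁ v₂ => csum u₁ fun p₁ p₂ => csum v₁ fun q₁ q₂ =>
      F p₁ u₂ p₂ q₁ v₂ q₂ := by
  refine (csum_congr fun u₁ u₂ _ => csum_comm _ _ _).trans ?_
  refine (csum_assoc_swap u fun p₁ p₂ u₂ => csum v fun v₁ v₂ => csum v₁ fun q₁ q₂ =>
    F p₁ p₂ u₂ q₁ q₂ v₂).trans ?_
  refine csum_congr fun u₁ u₂ _ => ?_
  refine (csum_congr fun p₁ p₂ _ => csum_assoc_swap v fun q₁ q₂ v₂ =>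
    F p₁ u₂ p₂ q₁ q₂ v₂).trans ?_
  exact csum_comm _ _ _

theorem csum_csum_assoc (u v : List α)
    (F : List α → List α → List α → List α → List α → List α → M) :
    (csum u fun u₁ u₂ => csum v fun v₁ v₂ => csum u₁ fun p₁ p₂ => csum v₁ fun q₁ q₂ =>
      F p₁ p₂ u₂ q₁ q₂ v₂) =
    csum u fun u₁ u₂ => csum v fun v₁ v₂ => csum u₂ fun p₁ p₂ => csum v₂ fun q₁ q₂ =>
      F u₁ p₁ p₂ v₁ q₁ q₂ := by
  refine (csum_congr fun u₁ u₂ _ => csum_comm _ _ _).trans ?_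
  refine (csum_assoc u fun p₁ p₂ u₂ => csum v fun v₁ v₂ => csum v₁ fun q₁ q₂ =>
    F p₁ p₂ u₂ q₁ q₂ v₂).trans ?_
  refine csum_congr fun u₁ u₂ _ => ?_
  refine (csum_congr fun p₁ p₂ _ => csum_assoc v fun q₁ q₂ v₂ =>
    F u₁ p₁ p₂ q₁ q₂ v₂).trans ?_
  exact csum_comm _ _ _

end Reindexing

/-! ### Primitive elements and coproducts in the envelope -/

section Primitive

variable (k B : Type*) [Field k] [NonAssocRing B] [Module k B] [IsScalarTower k B B]
  [SMulCommClass k B B] [Coalgebra k B]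

/-- The map `x ↦ Δ x - x ⊗ 1 - 1 ⊗ x`. -/
def primDefect : B →ₗ[k] B ⊗[k] B :=
  Coalgebra.comul - (TensorProduct.mk k B B).flip 1 - TensorProduct.mk k B B 1

variable {k B}

omit [IsScalarTower k B B] [SMulCommClass k B B] in
theorem mem_primitives_iff {x : B} : x ∈ primitives k B ↔ primDefect k B x = 0 := by
  change (Coalgebra.comul x : B ⊗[k] B) = x ⊗ₜ[k] 1 + 1 ⊗ₜ[k] x ↔ _
  simp only [primDefect, LinearMap.sub_apply, LinearMap.flip_apply, TensorProduct.mk_apply]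
  rw [sub_sub, sub_eq_zero]

end Primitive

namespace Env

variable {k V B : Type*} [Field k] [AddCommGroup V] [Module k V]
  {τ : V ⊗[k] V →ₗ[k] V ⊗[k] V} [NonAssocRing B] [Module k B] [IsScalarTower k B B]
  [SMulCommClass k B B] {σ : B ⊗[k] B →ₗ[k] B ⊗[k] B} {f g h : Env B τ}

variable (τ σ) in
/-- The multiplication of the envelope of the braided tensor square. -/
abbrev star : Env (B ⊗[k] B) τ →+ Env (B ⊗[k] B) τ →+ Env (B ⊗[k] B) τ := bilin τ (braidedMul σ)

/-- The braiding inside the product of the tensor square only exchanges two commuting elements, so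
multiplication is componentwise. -/
theorem star_prod {f₁ f₂ g₁ g₂ : Env B τ} (hc : Commute σ f₂ g₁) :
    star τ σ (prod τ f₁ f₂) (prod τ g₁ g₂) =
      prod τ (mul k B τ f₁ g₁) (mul k B τ f₂ g₂) := by
  have h1 : map τ ((TensorProduct.assoc k B B B).toLinearMap ∘ₗ σ.rTensor B ∘ₗ
      (TensorProduct.assoc k B B B).symm.toLinearMap) (prod τ f₂ (prod τ g₁ g₂)) =
      prod τ g₁ (prod τ f₂ g₂) := by
    rw [map_comp, map_comp, LinearMap.comp_apply, LinearMap.comp_apply, map_assoc_symm_prod]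
    have := hc.map_tauOne g₂
    rw [tauOne] at this
    rw [this, map_assoc_prod]
  rw [bilin_apply, braidedMul, map_comp, map_comp, map_comp, LinearMap.comp_apply,
    LinearMap.comp_apply, LinearMap.comp_apply, map_assoc_prod, LinearMap.lTensor,
    ← prod_map_right, h1, map_assoc_symm_prod, map_prod]
  rfl

theorem star_one_one (hA : IsBraidedAlgebra σ) (hσ : σ ∘ₗ σ = LinearMap.id)
    (y : Env (B ⊗[k] B) τ) : star τ σ (prod τ (one B τ) (one B τ)) y = y := by
  rw [one_prod, one, map_map, bilin_apply, prod_map_left, map_map]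
  conv_rhs => rw [← map_lid_prod_unit y]
  congr 2
  refine TensorProduct.ext' fun c s => ?_
  induction s using TensorProduct.induction_on with
  | zero => simp
  | add s t hs ht => rw [TensorProduct.tmul_add, _root_.map_add, _root_.map_add, hs, ht]
  | tmul a b => simp [braidedMul, hA.tau_one_left hσ, TensorProduct.smul_tmul']

variable [Coalgebra k B]

variable (k B τ) in
/-- The coproduct on envelopes. -/
abbrev coprod : Env B τ →ₗ[k] Env (B ⊗[k] B) τ := map τ (Coalgebra.comul : B →ₗ[k] B ⊗[k] B)

variable (B τ) in
/-- The primitive elements of the envelope. -/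
def prims : Submodule k (Env B τ) := LinearMap.ker (map τ (primDefect k B))

theorem map_sub {W W' : Type*} [AddCommGroup W] [Module k W] [AddCommGroup W'] [Module k W']
    (φ ψ : W →ₗ[k] W') : map τ (φ - ψ) = map τ φ - map τ ψ := by
  rw [sub_eq_add_neg, ← neg_one_smul k ψ, map_add, map_smul, neg_one_smul, sub_eq_add_neg]

omit [IsScalarTower k B B] [SMulCommClass k B B] in
theorem mem_prims_iff : f ∈ prims B τ ↔
    coprod k B τ f = prod τ f (one B τ) + prod τ (one B τ) f := by
  rw [prims, LinearMap.mem_ker, prod_one, one_prod, primDefect, map_sub, map_sub,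
    LinearMap.sub_apply, LinearMap.sub_apply, sub_sub, sub_eq_zero]

section Coproduct

variable (h1 : (Coalgebra.comul (1 : B) : B ⊗[k] B) = 1 ⊗ₜ[k] 1)
  (hm : ∀ x y : B, (Coalgebra.comul (x * y) : B ⊗[k] B) =
    braidedMul σ ((Coalgebra.comul x : B ⊗[k] B) ⊗ₜ[k] (Coalgebra.comul y : B ⊗[k] B)))

include h1 in
omit [IsScalarTower k B B] [SMulCommClass k B B] in
theorem coprod_one : coprod k B τ (one B τ) = prod τ (one B τ) (one B τ) := by
  rw [one_prod, one, map_map, map_map]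
  congr 2
  ext
  simp [h1]

include hm in
theorem coprod_mul (f g : Env B τ) :
    coprod k B τ (mul k B τ f g) = star τ σ (coprod k B τ f) (coprod k B τ g) := by
  rw [bilin_apply, bilin_apply, map_map, ← map_prod, map_map]
  congr 2
  refine TensorProduct.ext' fun x y => ?_
  simp [hm]

end Coproduct

section Letters

variable {j : V →ₗ[k] B} {X : Type*} {i : X → Env B τ}
  (hA : IsBraidedAlgebra σ) (hσ : σ ∘ₗ σ = LinearMap.id)
  (hj : TensorProduct.map j j ∘ₗ τ = σ ∘ₗ TensorProduct.map j j)
  (h1 : (Coalgebra.comul (1 : B) : B ⊗[k] B) = 1 ⊗ₜ[k] 1)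
  (hm : ∀ x y : B, (Coalgebra.comul (x * y) : B ⊗[k] B) =
    braidedMul σ ((Coalgebra.comul x : B ⊗[k] B) ⊗ₜ[k] (Coalgebra.comul y : B ⊗[k] B)))
  (hi : ∀ x, i x ∈ gens τ j) (hp : ∀ x, i x ∈ prims B τ)

include hA hσ hj in
omit [Coalgebra k B] in
theorem star_prod_of_mem {f₁ f₂ g₁ g₂ : Env B τ} (hf : f₂ ∈ gens τ j) (hg : g₁ ∈ gens τ j) :
    star τ σ (prod τ f₁ f₂) (prod τ g₁ g₂) = prod τ (mul k B τ f₁ g₁) (mul k B τ f₂ g₂) :=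
  star_prod (IsGen.commute hA hσ hj hf hg)

include hA hσ hj in
omit [Coalgebra k B] in
theorem star_prod_primitive {f₁ f₂ g : Env B τ} (hf : f₂ ∈ gens τ j) (hg : g ∈ gens τ j) :
    star τ σ (prod τ f₁ f₂) (prod τ g (one B τ) + prod τ (one B τ) g) =
      prod τ (mul k B τ f₁ g) f₂ + prod τ f₁ (mul k B τ f₂ g) := by
  rw [_root_.map_add, star_prod_of_mem hA hσ hj hf hg,
    star_prod_of_mem hA hσ hj hf (IsGen.one : IsGen j _), mul_one, mul_one]

include hA hσ hj h1 hm hi hp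

/-- Each primitive letter goes to the left or to the right tensor factor, as in a shuffle bialgebra.
-/
theorem coprod_lprod (u : List X) : coprod k B τ (lprod i u) =
    csum u fun u₁ u₂ => prod τ (lprod i u₁) (lprod i u₂) := by
  induction u using List.reverseRecOn with
  | nil => exact coprod_one h1
  | append_singleton u x ih =>
    rw [lprod_concat, coprod_mul hm, ih, mem_prims_iff.1 (hp x), csum_append]
    refine (map_csum ((star τ σ).flip (prod τ (i x) (one B τ) + prod τ (one B τ) (i x))) u
      _).trans ?_
    congr 1
    funext u₁ u₂
    rw [AddMonoidHom.flip_apply, star_prod_primitive hA hσ hj (lprod_mem_gens hi u₂) (hi x)]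
    simp only [csum, lprod_concat, List.append_nil]

theorem coprod_lprod_mul_lprod (u v : List X) :
    coprod k B τ (mul k B τ (lprod i u) (lprod i v)) =
    csum u fun u₁ u₂ => csum v fun v₁ v₂ =>
      prod τ (mul k B τ (lprod i u₁) (lprod i v₁)) (mul k B τ (lprod i u₂) (lprod i v₂)) := by
  rw [coprod_mul hm, coprod_lprod hA hσ hj h1 hm hi hp, coprod_lprod hA hσ hj h1 hm hi hp]
  refine (map_csum ((star τ σ).flip _) u _).trans ?_
  congr 1
  funext u₁ u₂
  rw [AddMonoidHom.flip_apply, map_csum]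
  congr 1
  funext v₁ v₂
  exact star_prod_of_mem hA hσ hj (lprod_mem_gens hi u₂) (lprod_mem_gens hi v₁)

/-- The coproduct of an associator of left-normed products. -/
theorem coprod_associator (u v : List X) (z : X) :
    coprod k B τ (mul k B τ (mul k B τ (lprod i u) (lprod i v)) (i z) -
      mul k B τ (lprod i u) (mul k B τ (lprod i v) (i z))) =
    csum u fun u₁ u₂ => csum v fun v₁ v₂ =>
      prod τ (mul k B τ (mul k B τ (lprod i u₁) (lprod i v₁)) (i z) -
          mul k B τ (lprod i u₁) (mul k B τ (lprod i v₁) (i z)))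
        (mul k B τ (lprod i u₂) (lprod i v₂)) +
      prod τ (mul k B τ (lprod i u₁) (lprod i v₁))
        (mul k B τ (mul k B τ (lprod i u₂) (lprod i v₂)) (i z) -
          mul k B τ (lprod i u₂) (mul k B τ (lprod i v₂) (i z))) := by
  have hL : coprod k B τ (mul k B τ (mul k B τ (lprod i u) (lprod i v)) (i z)) =
      csum u fun u₁ u₂ => csum v fun v₁ v₂ =>
        prod τ (mul k B τ (mul k B τ (lprod i u₁) (lprod i v₁)) (i z))
          (mul k B τ (lprod i u₂) (lprod i v₂)) +
        prod τ (mul k B τ (lprod i u₁) (lprod i v₁))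
          (mul k B τ (mul k B τ (lprod i u₂) (lprod i v₂)) (i z)) := by
    rw [coprod_mul hm, coprod_lprod_mul_lprod hA hσ hj h1 hm hi hp, mem_prims_iff.1 (hp z)]
    refine (map_csum ((star τ σ).flip _) u _).trans ?_
    congr 1
    funext u₁ u₂
    refine (map_csum ((star τ σ).flip _) v _).trans ?_
    congr 1
    funext v₁ v₂
    exact star_prod_primitive hA hσ hj
      (mul_mem_gens (lprod_mem_gens hi u₂) (lprod_mem_gens hi v₂)) (hi z)
  have hR : coprod k B τ (mul k B τ (lprod i u) (mul k B τ (lprod i v) (i z))) =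
      csum u fun u₁ u₂ => csum v fun v₁ v₂ =>
        prod τ (mul k B τ (lprod i u₁) (mul k B τ (lprod i v₁) (i z)))
          (mul k B τ (lprod i u₂) (lprod i v₂)) +
        prod τ (mul k B τ (lprod i u₁) (lprod i v₁))
          (mul k B τ (lprod i u₂) (mul k B τ (lprod i v₂) (i z))) := by
    rw [coprod_mul hm, coprod_mul hm, coprod_lprod hA hσ hj h1 hm hi hp u,
      coprod_lprod hA hσ hj h1 hm hi hp v, mem_prims_iff.1 (hp z)]
    have hv := map_csum ((star τ σ).flip (prod τ (i z) (one B τ) + prod τ (one B τ) (i z))) v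
      (fun v₁ v₂ => prod τ (lprod i v₁) (lprod i v₂))
    rw [AddMonoidHom.flip_apply] at hv
    rw [hv]
    refine (map_csum ((star τ σ).flip _) u _).trans ?_
    congr 1
    funext u₁ u₂
    rw [AddMonoidHom.flip_apply, map_csum]
    congr 1
    funext v₁ v₂
    rw [AddMonoidHom.flip_apply, star_prod_primitive hA hσ hj (lprod_mem_gens hi v₂) (hi z),
      _root_.map_add, star_prod_of_mem hA hσ hj (lprod_mem_gens hi u₂)
        (mul_mem_gens (lprod_mem_gens hi v₁) (hi z)),
      star_prod_of_mem hA hσ hj (lprod_mem_gens hi u₂) (lprod_mem_gens hi v₁)]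
  rw [_root_.map_sub, hL, hR, ← csum_sub]
  congr 1
  funext u₁ u₂
  rw [← csum_sub]
  congr 1
  funext v₁ v₂
  rw [_root_.map_sub, _root_.map_sub, LinearMap.sub_apply]
  abel

/-- Let `c u v` be the product of the two left-normed products. The coproduct of the associator
formula is the convolution of Δ(c) with Δ(P), and also that of Δ(c) with P ⊗ 1 + 1 ⊗ P. Cancelling
Δ(c), whose value on empty words is the unit, gives primitivity. -/
theorem apP_mem_prims (u v : List X) (z : X) : apP i σ u v z ∈ prims B τ := by
  have hc : ∀ x y, Commute σ (i x) (i y) := fun x y => IsGen.commute hA hσ hj (hi x) (hi y)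
  set c : List X → List X → Env B τ := fun u v => mul k B τ (lprod i u) (lprod i v) with hcdef
  have hcg (u v : List X) : c u v ∈ gens τ j :=
    mul_mem_gens (lprod_mem_gens hi u) (lprod_mem_gens hi v)
  have hassoc := assoc_eq_csum hc (σ := σ) (i := i)
  have hδc := coprod_lprod_mul_lprod hA hσ hj h1 hm hi hp
  have hδa := coprod_associator hA hσ hj h1 hm hi hp
  rw [mem_prims_iff, ← sub_eq_zero]
  refine eq_zero_of_csum_eq_zero (star τ σ) (fun u v => coprod k B τ (c u v)) (fun y => ?_)
    (fun u v => coprod k B τ (apP i σ u v z) -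
      (prod τ (apP i σ u v z) (one B τ) + prod τ (one B τ) (apP i σ u v z))) (fun u v => ?_) u v
  · have : c [] [] = one B τ := one_mul _
    rw [this, coprod_one h1, star_one_one hA hσ]
  have e1 : (csum u fun u₁ u₂ => csum v fun v₁ v₂ =>
      star τ σ (coprod k B τ (c u₁ v₁)) (coprod k B τ (apP i σ u₂ v₂ z))) =
      coprod k B τ (csum u fun u₁ u₂ => csum v fun v₁ v₂ =>
        mul k B τ (c u₁ v₁) (apP i σ u₂ v₂ z)) := by
    simp only [map_csum, coprod_mul hm]
  have e2 (u₁ u₂ v₁ v₂ : List X) : star τ σ (coprod k B τ (c u₁ v₁))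
      (prod τ (apP i σ u₂ v₂ z) (one B τ) + prod τ (one B τ) (apP i σ u₂ v₂ z)) =
      csum u₁ fun p₁ p₂ => csum v₁ fun q₁ q₂ =>
        prod τ (mul k B τ (c p₁ q₁) (apP i σ u₂ v₂ z)) (c p₂ q₂) +
        prod τ (c p₁ q₁) (mul k B τ (c p₂ q₂) (apP i σ u₂ v₂ z)) := by
    rw [hδc]
    refine (map_csum ((star τ σ).flip _) u₁ _).trans ?_
    congr 1
    funext p₁ p₂
    refine (map_csum ((star τ σ).flip _) v₁ _).trans ?_
    congr 1
    funext q₁ q₂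
    exact star_prod_primitive hA hσ hj (hcg p₂ q₂) (apP_mem_gens hi hc u₂ v₂ z)
  -- Both convolutions are compared with `coprod_associator`, after its associators are expanded by
  -- the associator formula.
  simp only [_root_.map_sub, csum_sub, e2]
  rw [e1, ← hassoc, hδa, sub_eq_zero]
  simp only [hassoc, csum_add]
  congr 1
  · have e3 (u₁ u₂ v₁ v₂ : List X) :
        prod τ (csum u₁ fun p₁ p₂ => csum v₁ fun q₁ q₂ =>
          mul k B τ (c p₁ q₁) (apP i σ p₂ q₂ z)) (c u₂ v₂) =
        csum u₁ fun p₁ p₂ => csum v₁ fun q₁ q₂ =>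
          prod τ (mul k B τ (c p₁ q₁) (apP i σ p₂ q₂ z)) (c u₂ v₂) := by
      refine (map_csum ((prod τ).flip (c u₂ v₂)) u₁ _).trans ?_
      congr 1
      funext p₁ p₂
      exact map_csum ((prod τ).flip (c u₂ v₂)) v₁ _
    refine (csum_congr fun u₁ u₂ _ => csum_congr fun v₁ v₂ _ => e3 u₁ u₂ v₁ v₂).trans ?_
    exact csum_csum_assoc_swap u v fun p₁ p₂ u₂ q₁ q₂ v₂ =>
      prod τ (mul k B τ (c p₁ q₁) (apP i σ p₂ q₂ z)) (c u₂ v₂)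
  · refine (csum_congr fun u₁ u₂ _ => csum_congr fun v₁ v₂ _ => ?_).trans
      (csum_csum_assoc u v fun p₁ p₂ u₂ q₁ q₂ v₂ =>
        prod τ (c p₁ q₁) (mul k B τ (c p₂ q₂) (apP i σ u₂ v₂ z))).symm
    rw [map_csum]
    congr 1
    funext p₁ p₂
    exact map_csum (prod τ (c u₁ v₁)) v₂ _

/-- Besides P there is only the commutator, whose mixed terms cancel because letters commute up to
the braiding. -/
theorem apS_mem_prims (u : List X) (y z : X) : apS i σ u y z ∈ prims B τ := by
  have hc : ∀ x y, Commute σ (i x) (i y) := fun x y => IsGen.commute hA hσ hj (hi x) (hi y)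
  have hP := apP_mem_prims hA hσ hj h1 hm hi hp
  rw [apS_eq hc]
  refine sub_mem (neg_mem (sub_mem (hP _ _ _) (hP _ _ _))) ?_
  split_ifs
  · have h2 (y z : X) : coprod k B τ (mul k B τ (i y) (i z)) =
        prod τ (mul k B τ (i y) (i z)) (one B τ) + prod τ (i y) (i z) +
          (prod τ (i z) (i y) + prod τ (one B τ) (mul k B τ (i y) (i z))) := by
      rw [coprod_mul hm, mem_prims_iff.1 (hp y), mem_prims_iff.1 (hp z),
        _root_.map_add (star τ σ), AddMonoidHom.add_apply,
        star_prod_primitive hA hσ hj (IsGen.one : IsGen j _) (hi z),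
        star_prod_primitive hA hσ hj (hi y) (hi z), one_mul]
    rw [mem_prims_iff, _root_.map_sub, h2, h2, _root_.map_sub, _root_.map_sub,
      LinearMap.sub_apply]
    abel
  · exact zero_mem _

theorem ap_opPhi_mem_prims {m n : ℕ} {u v : List X} (hu : u.length = m) (hv : v.length = n + 1) :
    ap (opPhi σ m (n + 1)) ((u ++ v).map i) ∈ prims B τ := by
  have hc : ∀ x y, Commute σ (i x) (i y) := fun x y => IsGen.commute hA hσ hj (hi x) (hi y)
  rw [ap_opPhi hc hu hv]
  refine Submodule.smul_mem _ _ (Submodule.sum_mem _ fun π _ => Submodule.sum_mem _ fun ρ _ => ?_)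
  obtain ⟨u', v', z, -, -, -, h⟩ := exists_ap_P_eq (σ := σ) (i := i)
    (m := m) (n := n) (L := applyWord (permWord π) u ++ applyWord (permWord ρ) v)
    (by simp [length_applyWord, hu, hv, Nat.add_assoc])
  rw [h]
  exact apP_mem_prims hA hσ hj h1 hm hi hp _ _ _

end Letters

end Env

/-! ### Naturality and restriction along an injective map -/

section Naturality

variable {k A B : Type*} [Field k] [AddCommGroup A] [Module k A] [AddCommGroup B] [Module k B]

/-- The tensor power of a linear map. -/
abbrev tpow (j : A →ₗ[k] B) (n : ℕ) : (⨂[k]^n) A →ₗ[k] (⨂[k]^n) B :=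
  PiTensorProduct.map fun _ => j

variable {j : A →ₗ[k] B}

theorem tpow_idTensorId {p q a b n n' : ℕ} {f : (⨂[k]^a) A →ₗ[k] (⨂[k]^b) A}
    {g : (⨂[k]^a) B →ₗ[k] (⨂[k]^b) B} (hfg : tpow j b ∘ₗ f = g ∘ₗ tpow j a)
    (h : n = p + a + q) (h' : p + b + q = n') :
    tpow j n' ∘ₗ idTensorId p q f h h' = idTensorId p q g h h' ∘ₗ tpow j n := by
  refine hom_ext_tmul h.symm fun x z => ?_
  refine tmul_induction (a := p) (b := a) rfl (p := fun x =>
    (tpow j n' ∘ₗ idTensorId p q f h h') (tmul h.symm x z) =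
      (idTensorId p q g h h' ∘ₗ tpow j n) (tmul h.symm x z)) ?_ ?_ x
  · intro x y
    apply toT_injective
    have h1 : toT (idTensorId p q f h h' (tmul h.symm (tmul rfl x y) z)) =
        toT x * toT (f y) * toT z := toT_idTensorId f h h' x y z (by simp only [toT_tmul])
    have h2 : toT (idTensorId p q g h h' (tpow j n (tmul h.symm (tmul rfl x y) z))) =
        toT (tpow j p x) * toT (g (tpow j a y)) * toT (tpow j q z) :=
      toT_idTensorId g h h' _ _ _ (by simp only [piMap_tmul, toT_tmul])
    rw [LinearMap.comp_apply, LinearMap.comp_apply, h2, toT_piMap, h1, map_mul, map_mul,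
      ← toT_piMap, ← toT_piMap, ← toT_piMap]
    congr 3
    exact LinearMap.congr_fun hfg y
  · intro s t hs ht
    simp only [map_add, LinearMap.add_apply, hs, ht]

variable {τ : A ⊗[k] A →ₗ[k] A ⊗[k] A} {σ : B ⊗[k] B →ₗ[k] B ⊗[k] B}

theorem tpow_tauAt (hj : TensorProduct.map j j ∘ₗ τ = σ ∘ₗ TensorProduct.map j j) (n i : ℕ) :
    tpow j n ∘ₗ tauAt τ n i = tauAt σ n i ∘ₗ tpow j n := by
  by_cases h : i + 2 ≤ n
  · rw [tauAt, tauAt, dif_pos h, dif_pos h]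
    refine tpow_idTensorId ?_ _ _
    refine LinearMap.ext fun x => ?_
    obtain ⟨s, rfl⟩ := two.surjective x
    simp only [LinearMap.comp_apply, LinearEquiv.coe_coe, LinearEquiv.symm_apply_apply, piMap_two]
    exact congrArg two (LinearMap.congr_fun hj s)
  · rw [tauAt_of_not τ h, tauAt_of_not σ h]
    rfl

theorem tpow_act (hj : TensorProduct.map j j ∘ₗ τ = σ ∘ₗ TensorProduct.map j j) (n : ℕ)
    (l : List ℕ) : tpow j n ∘ₗ act τ n l = act σ n l ∘ₗ tpow j n := by
  induction l with
  | nil => rfl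
  | cons i l ih =>
    rw [act, act, ← LinearMap.comp_assoc, ih, LinearMap.comp_assoc, tpow_tauAt hj,
      LinearMap.comp_assoc]

theorem tpow_cast {n n' : ℕ} (h : n = n') :
    tpow j n' ∘ₗ (TensorPower.cast k A h).toLinearMap =
      (TensorPower.cast k B h).toLinearMap ∘ₗ tpow j n := by
  subst h
  refine LinearMap.ext fun x => ?_
  simp

theorem comp_one_eq : j ∘ₗ one.toLinearMap = one.toLinearMap ∘ₗ tpow j 1 := by
  refine LinearMap.ext fun x => ?_
  obtain ⟨v, rfl⟩ := one.symm.surjective x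
  simp [piMap_one_symm]

theorem tpow_one_symm_comp {n : ℕ} {f : (⨂[k]^n) A →ₗ[k] A} {g : (⨂[k]^n) B →ₗ[k] B}
    (h : j ∘ₗ f = g ∘ₗ tpow j n) :
    tpow j 1 ∘ₗ one.symm.toLinearMap ∘ₗ f = (one.symm.toLinearMap ∘ₗ g) ∘ₗ tpow j n := by
  refine LinearMap.ext fun x => ?_
  simp only [LinearMap.comp_apply, LinearEquiv.coe_coe, piMap_one_symm]
  exact congrArg one.symm (LinearMap.congr_fun h x)

theorem map_comp_tensorMap_tpow {a b : ℕ} {f : (⨂[k]^a) A →ₗ[k] A} {g : (⨂[k]^b) A →ₗ[k] A}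
    {f' : (⨂[k]^a) B →ₗ[k] B} {g' : (⨂[k]^b) B →ₗ[k] B} (hf : j ∘ₗ f = f' ∘ₗ tpow j a)
    (hg : j ∘ₗ g = g' ∘ₗ tpow j b) :
    TensorProduct.map j j ∘ₗ tensorMap f g = tensorMap f' g' ∘ₗ tpow j (a + b) := by
  rw [map_comp_tensorMap, hf, hg]
  refine hom_ext_tmul rfl fun x y => ?_
  rw [tensorMap_tmul, LinearMap.comp_apply (tensorMap f' g'), piMap_tmul, tensorMap_tmul]
  rfl

theorem map_map_comp_tauOne (hj : TensorProduct.map j j ∘ₗ τ = σ ∘ₗ TensorProduct.map j j) :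
    TensorProduct.map (TensorProduct.map j j) j ∘ₗ tauOne τ =
      tauOne σ ∘ₗ TensorProduct.map (TensorProduct.map j j) j := by
  refine TensorProduct.ext' fun s c => ?_
  have := LinearMap.congr_fun hj s
  simp only [LinearMap.comp_apply] at this
  simp [tauOne, this]

theorem map_map_comp_tauTwo (hj : TensorProduct.map j j ∘ₗ τ = σ ∘ₗ TensorProduct.map j j) :
    TensorProduct.map (TensorProduct.map j j) j ∘ₗ tauTwo τ =
      tauTwo σ ∘ₗ TensorProduct.map (TensorProduct.map j j) j := by
  have h1 (a : A) (s : A ⊗[k] A) : TensorProduct.map (TensorProduct.map j j) j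
      ((TensorProduct.assoc k A A A).symm (a ⊗ₜ s)) =
      (TensorProduct.assoc k B B B).symm (j a ⊗ₜ TensorProduct.map j j s) := by
    induction s using TensorProduct.induction_on with
    | zero => simp
    | tmul b c => simp
    | add s t hs ht => simp only [TensorProduct.tmul_add, map_add, hs, ht]
  refine TensorProduct.ext_threefold fun a b c => ?_
  have := LinearMap.congr_fun hj (b ⊗ₜ c)
  simp only [LinearMap.comp_apply, TensorProduct.map_tmul] at this
  simp [tauTwo, h1, this]

/-- Over a field the tensor cube of an injective map is injective, so the relation can be checked in
B. -/
theorem IsBraiding.restrict (hb : IsBraiding σ) (hinj : Function.Injective j)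
    (hj : TensorProduct.map j j ∘ₗ τ = σ ∘ₗ TensorProduct.map j j) : IsBraiding τ := by
  have hinj3 : Function.Injective (TensorProduct.map (TensorProduct.map j j) j) :=
    TensorProduct.map_injective_of_flat_flat _ j
      (TensorProduct.map_injective_of_flat_flat j j hinj hinj) hinj
  refine LinearMap.ext fun x => hinj3 ?_
  have h1 := LinearMap.congr_fun (map_map_comp_tauOne hj)
  have h2 := LinearMap.congr_fun (map_map_comp_tauTwo hj)
  have h3 := LinearMap.congr_fun hb
  simp only [LinearMap.comp_apply] at h1 h2 h3 ⊢
  rw [h1, h2, h1, h2, h1, h2, h3]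

theorem involutive_restrict (hσ : σ ∘ₗ σ = LinearMap.id) (hinj : Function.Injective j)
    (hj : TensorProduct.map j j ∘ₗ τ = σ ∘ₗ TensorProduct.map j j) : τ ∘ₗ τ = LinearMap.id := by
  refine LinearMap.ext fun x => TensorProduct.map_injective_of_flat_flat j j hinj hinj ?_
  have h1 := LinearMap.congr_fun hj
  have h2 := LinearMap.congr_fun hσ
  simp only [LinearMap.comp_apply] at h1 h2 ⊢
  rw [h1, h1, h2]
  rfl

/-- Structures of a Sabinin `τ`-algebra restrict to subspaces that are closed under the braiding
and the operations. -/
theorem IsSabininTauAlgebra.restrict {S : ∀ m : ℕ, (⨂[k]^(m + 2)) B →ₗ[k] B}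
    {Φ : ∀ m n : ℕ, (⨂[k]^(m + n)) B →ₗ[k] B} (hB : IsSabininTauAlgebra σ S Φ)
    (hinj : Function.Injective j)
    (hj : TensorProduct.map j j ∘ₗ τ = σ ∘ₗ TensorProduct.map j j)
    {S' : ∀ m : ℕ, (⨂[k]^(m + 2)) A →ₗ[k] A} {Φ' : ∀ m n : ℕ, (⨂[k]^(m + n)) A →ₗ[k] A}
    (hS : ∀ m, j ∘ₗ S' m = S m ∘ₗ tpow j (m + 2))
    (hΦ : ∀ m n, j ∘ₗ Φ' m n = Φ m n ∘ₗ tpow j (m + n)) : IsSabininTauAlgebra τ S' Φ' := by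
  have hinj2 : Function.Injective (TensorProduct.map j j) :=
    TensorProduct.map_injective_of_flat_flat j j hinj hinj
  have hbr {m : ℕ} {M' : (⨂[k]^m) A →ₗ[k] A} {M : (⨂[k]^m) B →ₗ[k] B}
      (hM : j ∘ₗ M' = M ∘ₗ tpow j m) (h : IsBraidedOperation σ M) : IsBraidedOperation τ M' := by
    have e0 := LinearMap.congr_fun hj
    have e1 := LinearMap.congr_fun (map_comp_tensorMap_tpow hM comp_one_eq)
    have e2 := LinearMap.congr_fun (map_comp_tensorMap_tpow comp_one_eq hM)
    have e3 := LinearMap.congr_fun (tpow_cast (j := j) (Nat.add_comm m 1))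
    have e4 (l : List ℕ) := LinearMap.congr_fun (tpow_act hj (m + 1) l)
    have e5 := LinearMap.congr_fun h.1
    have e6 := LinearMap.congr_fun h.2
    simp only [LinearMap.comp_apply] at e0 e1 e2 e3 e4 e5 e6
    constructor
    · refine LinearMap.ext fun x => hinj2 ?_
      simp only [LinearMap.comp_apply]
      rw [e0, e1, e5, e2, e3, e4]
    · refine LinearMap.ext fun x => hinj2 ?_
      simp only [LinearMap.comp_apply]
      rw [e0, e2, e3, e6, e1, e4]
  -- Each remaining axiom says that an operation is zero. The helpers below build both versions of
  -- that operation together with their intertwining by `j`.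
  have hzero {n : ℕ} {M' : (⨂[k]^n) A →ₗ[k] A} {M : (⨂[k]^n) B →ₗ[k] B}
      (hM : j ∘ₗ M' = M ∘ₗ tpow j n) (h : M = 0) : M' = 0 := by
    refine LinearMap.ext fun x => hinj ?_
    have := LinearMap.congr_fun hM x
    rw [h] at this
    simpa using this
  have hcomp {n n' : ℕ} {M' : (⨂[k]^n') A →ₗ[k] A} {M : (⨂[k]^n') B →ₗ[k] B}
      {F : (⨂[k]^n) A →ₗ[k] (⨂[k]^n') A} {G : (⨂[k]^n) B →ₗ[k] (⨂[k]^n') B}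
      (hM : j ∘ₗ M' = M ∘ₗ tpow j n') (hF : tpow j n' ∘ₗ F = G ∘ₗ tpow j n) :
      j ∘ₗ (M' ∘ₗ F) = (M ∘ₗ G) ∘ₗ tpow j n :=
    LinearMap.ext fun x => (LinearMap.congr_fun hM (F x)).trans
      (congrArg M (LinearMap.congr_fun hF x))
  have hact {n : ℕ} {M' : (⨂[k]^n) A →ₗ[k] A} {M : (⨂[k]^n) B →ₗ[k] B}
      (hM : j ∘ₗ M' = M ∘ₗ tpow j n) (l : List ℕ) :
      j ∘ₗ (M' ∘ₗ act τ n l) = (M ∘ₗ act σ n l) ∘ₗ tpow j n :=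
    hcomp hM (tpow_act hj n l)
  have hid {n n' a p q : ℕ} {M' : (⨂[k]^n') A →ₗ[k] A} {M : (⨂[k]^n') B →ₗ[k] B}
      (hM : j ∘ₗ M' = M ∘ₗ tpow j n') {N' : (⨂[k]^a) A →ₗ[k] A} {N : (⨂[k]^a) B →ₗ[k] B}
      (hN : j ∘ₗ N' = N ∘ₗ tpow j a) (h : n = p + a + q) (h' : p + 1 + q = n') (l : List ℕ) :
      j ∘ₗ (M' ∘ₗ idTensorId p q (one.symm.toLinearMap ∘ₗ N') h h' ∘ₗ act τ n l) =
        (M ∘ₗ idTensorId p q (one.symm.toLinearMap ∘ₗ N) h h' ∘ₗ act σ n l) ∘ₗ tpow j n :=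
    hact (hcomp hM (tpow_idTensorId (tpow_one_symm_comp hN) h h')) l
  have hadd {n : ℕ} {M' N' : (⨂[k]^n) A →ₗ[k] A} {M N : (⨂[k]^n) B →ₗ[k] B}
      (hM : j ∘ₗ M' = M ∘ₗ tpow j n) (hN : j ∘ₗ N' = N ∘ₗ tpow j n) :
      j ∘ₗ (M' + N') = (M + N) ∘ₗ tpow j n := by
    rw [LinearMap.comp_add, hM, hN, LinearMap.add_comp]
  have hsub {n : ℕ} {M' N' : (⨂[k]^n) A →ₗ[k] A} {M N : (⨂[k]^n) B →ₗ[k] B}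
      (hM : j ∘ₗ M' = M ∘ₗ tpow j n) (hN : j ∘ₗ N' = N ∘ₗ tpow j n) :
      j ∘ₗ (M' - N') = (M - N) ∘ₗ tpow j n := by
    rw [LinearMap.comp_sub, hM, hN, LinearMap.sub_comp]
  have hsum {n : ℕ} {ι : Type} (s : Finset ι) {M' : ι → ((⨂[k]^n) A →ₗ[k] A)}
      {M : ι → ((⨂[k]^n) B →ₗ[k] B)} (hM : ∀ i, j ∘ₗ M' i = M i ∘ₗ tpow j n) :
      j ∘ₗ (∑ i ∈ s, M' i) = (∑ i ∈ s, M i) ∘ₗ tpow j n := by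
    refine LinearMap.ext fun x => ?_
    simp only [LinearMap.comp_apply, LinearMap.sum_apply, map_sum]
    exact Finset.sum_congr rfl fun i _ => LinearMap.congr_fun (hM i) x
  refine ⟨hB.braiding.restrict hinj hj, involutive_restrict hB.involutive hinj hj,
    fun m => hbr (hS m) (hB.braided_S m),
    fun m n hm hn => hbr (hΦ m n) (hB.braided_Φ m n hm hn), fun m => ?_, fun m r hr => ?_,
    fun m => ?_, fun m n hm hn r hr hrm => ?_⟩
  · exact hzero (hadd (hS m) (hact (hS m) [m])) (hB.antisymmetry m)
  · exact hzero (hadd (hsub (hS _) (hact (hS _) [r])) (hsum _ fun l => hsum _ fun π =>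
      hid (hS _) (hS _) _ _ _)) (hB.derivation m r hr)
  · refine hzero ?_ (hB.cyclic m)
    have hE := hadd (hS (m + 1)) (hsum Finset.univ fun l : Fin (m + 1) =>
      hsum (shuffles m l) fun π => hid (hS l) (hS (m - l))
        (show m + 1 + 2 = l + (m - l + 2) + 1 by omega) (by omega) (shuffleWord l π))
    refine hcomp hE ?_
    rw [LinearMap.comp_add, LinearMap.comp_add, LinearMap.add_comp, LinearMap.add_comp,
      tpow_act hj, tpow_act hj]
    rfl
  · exact hzero (hsub (hΦ m n) (hact (hΦ m n) [r])) (hB.symmetry m n hm hn r hr hrm)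

end Naturality

/-! ### The braiding on primitive elements -/

section Restriction

variable {k B : Type*} [Field k] [NonAssocRing B] [Module k B] [IsScalarTower k B B]
  [SMulCommClass k B B] {σ : B ⊗[k] B →ₗ[k] B ⊗[k] B}

theorem tauTwo_tmul_one (hA : IsBraidedAlgebra σ) (hσ : σ ∘ₗ σ = LinearMap.id) (s : B ⊗[k] B) :
    tauTwo σ (s ⊗ₜ 1) = ((TensorProduct.mk k B B).flip 1).rTensor B s := by
  induction s using TensorProduct.induction_on with
  | zero => simp
  | tmul b c => simp [tauTwo, hA.tau_one_right hσ]
  | add s t hs ht => simp only [TensorProduct.add_tmul, map_add, hs, ht]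

omit [IsScalarTower k B B] [SMulCommClass k B B] in
theorem assoc_symm_one_tmul (s : B ⊗[k] B) :
    (TensorProduct.assoc k B B B).symm (1 ⊗ₜ s) = (TensorProduct.mk k B B 1).rTensor B s := by
  induction s using TensorProduct.induction_on with
  | zero => simp
  | tmul b c => simp
  | add s t hs ht => simp only [TensorProduct.tmul_add, map_add, hs, ht]

theorem tauOne_rTensor_one (hA : IsBraidedAlgebra σ) (hσ : σ ∘ₗ σ = LinearMap.id)
    (s : B ⊗[k] B) : tauOne σ ((TensorProduct.mk k B B 1).rTensor B s) =
      (TensorProduct.assoc k B B B).symm ((TensorProduct.mk k B B 1).lTensor B s) := by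
  induction s using TensorProduct.induction_on with
  | zero => simp
  | tmul b c => simp [tauOne, hA.tau_one_left hσ]
  | add s t hs ht => simp only [map_add, hs, ht]

omit [IsScalarTower k B B] [SMulCommClass k B B] in
theorem assoc_symm_lTensor_one (s : B ⊗[k] B) :
    (TensorProduct.assoc k B B B).symm (((TensorProduct.mk k B B).flip 1).lTensor B s) =
      s ⊗ₜ[k] 1 := by
  induction s using TensorProduct.induction_on with
  | zero => simp
  | tmul b c => simp
  | add s t hs ht => simp only [TensorProduct.add_tmul, map_add, hs, ht]

variable [Coalgebra k B]

/-- For primitive `y` the axiom `comul_left` expresses the coproduct of the first factor of `σ (x ⊗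
y)` by inserting 1 after and before that factor. -/
theorem rTensor_primDefect_tau (hA : IsBraidedAlgebra σ) (hC : IsBraidedCoalgebra σ)
    (hσ : σ ∘ₗ σ = LinearMap.id) (x : B) {y : B} (hy : y ∈ primitives k B) :
    (primDefect k B).rTensor B (σ (x ⊗ₜ y)) = 0 := by
  have hy' : (Coalgebra.comul y : B ⊗[k] B) = y ⊗ₜ[k] 1 + 1 ⊗ₜ[k] y := hy
  have h := LinearMap.congr_fun hC.comul_left (x ⊗ₜ y)
  simp only [LinearMap.comp_apply, LinearMap.lTensor_tmul, hy', LinearEquiv.coe_coe,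
    TensorProduct.tmul_add, map_add, TensorProduct.assoc_symm_tmul] at h
  rw [primDefect, LinearMap.rTensor_sub, LinearMap.rTensor_sub, LinearMap.sub_apply,
    LinearMap.sub_apply, h, tauOne, LinearMap.rTensor_tmul, LinearMap.rTensor_tmul,
    tauTwo_tmul_one hA hσ, hA.tau_one_right hσ]
  simp only [tauTwo, LinearMap.comp_apply, LinearEquiv.coe_coe, TensorProduct.assoc_tmul,
    LinearMap.lTensor_tmul, assoc_symm_one_tmul]
  abel

theorem lTensor_primDefect_tau (hA : IsBraidedAlgebra σ) (hC : IsBraidedCoalgebra σ)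
    (hσ : σ ∘ₗ σ = LinearMap.id) {x : B} (y : B) (hx : x ∈ primitives k B) :
    (primDefect k B).lTensor B (σ (x ⊗ₜ y)) = 0 := by
  have hx' : (Coalgebra.comul x : B ⊗[k] B) = x ⊗ₜ[k] 1 + 1 ⊗ₜ[k] x := hx
  have h := LinearMap.congr_fun hC.comul_right (x ⊗ₜ y)
  simp only [LinearMap.comp_apply, LinearMap.rTensor_tmul, hx', LinearEquiv.coe_coe,
    TensorProduct.add_tmul, map_add] at h
  have h1 : tauOne σ (tauTwo σ ((x ⊗ₜ[k] 1) ⊗ₜ[k] y)) = σ (x ⊗ₜ y) ⊗ₜ 1 := by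
    simp [tauOne, tauTwo, hA.tau_one_left hσ]
  have h2 : tauTwo σ ((1 ⊗ₜ[k] x) ⊗ₜ[k] y) =
      (TensorProduct.mk k B B 1).rTensor B (σ (x ⊗ₜ y)) := by
    rw [← assoc_symm_one_tmul]
    simp [tauTwo]
  rw [h1, h2, tauOne_rTensor_one hA hσ] at h
  apply (TensorProduct.assoc k B B B).symm.injective
  rw [primDefect, LinearMap.lTensor_sub, LinearMap.lTensor_sub, LinearMap.sub_apply,
    LinearMap.sub_apply, map_sub, map_sub, h, assoc_symm_lTensor_one, map_zero]
  abel

/-- The braiding restricts to the primitive elements. -/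
theorem exists_restrict_tau (hA : IsBraidedAlgebra σ) (hC : IsBraidedCoalgebra σ)
    (hσ : σ ∘ₗ σ = LinearMap.id) :
    ∃ τ : primitives k B ⊗[k] primitives k B →ₗ[k] primitives k B ⊗[k] primitives k B,
      TensorProduct.map (primitives k B).subtype (primitives k B).subtype ∘ₗ τ =
        σ ∘ₗ TensorProduct.map (primitives k B).subtype (primitives k B).subtype := by
  set j := (primitives k B).subtype with hjdef
  have hinj : Function.Injective j := Subtype.val_injective
  have hex : Function.Exact j (primDefect k B) := fun x => by
    rw [← mem_primitives_iff]
    simp [hjdef]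
  have hr : (primDefect k B).rTensor B ∘ₗ σ ∘ₗ TensorProduct.map j j = 0 :=
    TensorProduct.ext' fun x y => rTensor_primDefect_tau hA hC hσ x.1 y.2
  have hl : (primDefect k B).lTensor B ∘ₗ σ ∘ₗ TensorProduct.map j j = 0 :=
    TensorProduct.ext' fun x y => lTensor_primDefect_tau hA hC hσ y.1 x.2
  -- A retraction of the inclusion gives a linear formula for the restriction; it remains to see
  -- that the image of σ lies in the tensor square of the primitives.
  obtain ⟨e, he⟩ := LinearMap.exists_leftInverse_of_injective j (LinearMap.ker_eq_bot.2 hinj)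
  refine ⟨TensorProduct.map e e ∘ₗ σ ∘ₗ TensorProduct.map j j, LinearMap.ext fun x => ?_⟩
  obtain ⟨t, ht⟩ := (Module.Flat.rTensor_exact B hex _).1 (LinearMap.congr_fun hr x)
  -- The first factor has been lifted to the primitives. Flatness transfers the condition on the
  -- second factor to the lift, so that it can be lifted as well.
  have h1 : (primDefect k B).lTensor (primitives k B) t = 0 := by
    apply Module.Flat.rTensor_preserves_injective_linearMap (M := B ⊗[k] B) j hinj
    have h2 := LinearMap.congr_fun hl x
    simp only [LinearMap.comp_apply, LinearMap.zero_apply] at h2 ht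
    rw [← ht] at h2
    rw [map_zero, ← h2, ← LinearMap.comp_apply, ← LinearMap.comp_apply,
      LinearMap.rTensor_comp_lTensor, LinearMap.lTensor_comp_rTensor]
  obtain ⟨s, rfl⟩ := (Module.Flat.lTensor_exact (primitives k B) hex _).1 h1
  simp only [LinearMap.comp_apply] at ht ⊢
  rw [← ht, ← LinearMap.comp_apply (j.rTensor B), LinearMap.rTensor_comp_lTensor,
    ← LinearMap.comp_apply, ← LinearMap.comp_apply, ← TensorProduct.map_comp,
    ← TensorProduct.map_comp, LinearMap.comp_assoc, he, LinearMap.comp_id]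

end Restriction

/-! ### Closure of the primitive elements under S and Φ -/

section Closed

variable {k B : Type*} [Field k] [NonAssocRing B] [Module k B] [IsScalarTower k B B]
  [SMulCommClass k B B] [Coalgebra k B] {σ : B ⊗[k] B →ₗ[k] B ⊗[k] B}
  {τ : primitives k B ⊗[k] primitives k B →ₗ[k] primitives k B ⊗[k] primitives k B}

omit [IsScalarTower k B B] [SMulCommClass k B B] in
theorem gen_mem_prims (a : ℕ) : Env.gen τ (primitives k B).subtype a ∈ Env.prims B τ := by
  rw [Env.prims, LinearMap.mem_ker, Env.gen, Env.map_mk]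
  have : primDefect k B ∘ₗ (primitives k B).subtype ∘ₗ one.toLinearMap = 0 :=
    LinearMap.ext fun x => mem_primitives_iff.1 (one x).2
  rw [this, map_zero]

-- Faithfulness is applied with the primitives as the braided space: the composite of `M` with the
-- primitivity defect vanishes on the generators, hence on all tensors of primitive elements.
omit [IsScalarTower k B B] [SMulCommClass k B B] in
theorem apply_mem_primitives (hb : IsBraiding τ) (hτ : τ ∘ₗ τ = LinearMap.id) {n : ℕ}
    {M : (⨂[k]^n) B →ₗ[k] B}
    (h : Env.ap M ((List.range n).map (Env.gen τ (primitives k B).subtype)) ∈ Env.prims B τ)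
    (x : (⨂[k]^n) (primitives k B)) :
    M (tpow (primitives k B).subtype n x) ∈ primitives k B := by
  have h' : Env.ap (primDefect k B ∘ₗ M)
      ((List.range n).map (Env.gen τ (primitives k B).subtype)) =
      Env.ap (0 : (⨂[k]^n) B →ₗ[k] B ⊗[k] B)
        ((List.range n).map (Env.gen τ (primitives k B).subtype)) := by
    rw [Env.ap_comp, Env.ap_zero]
    exact LinearMap.mem_ker.1 h
  rw [mem_primitives_iff]
  exact LinearMap.congr_fun (Env.comp_eq_of_ap_gen_eq hb hτ _ h') x

variable (hA : IsBraidedAlgebra σ) (hσ : σ ∘ₗ σ = LinearMap.id)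
  (hj : TensorProduct.map (primitives k B).subtype (primitives k B).subtype ∘ₗ τ =
    σ ∘ₗ TensorProduct.map (primitives k B).subtype (primitives k B).subtype)
  (h1 : (Coalgebra.comul (1 : B) : B ⊗[k] B) = 1 ⊗ₜ[k] 1)
  (hm : ∀ x y : B, (Coalgebra.comul (x * y) : B ⊗[k] B) =
    braidedMul σ ((Coalgebra.comul x : B ⊗[k] B) ⊗ₜ[k] (Coalgebra.comul y : B ⊗[k] B)))

include hA hσ hj h1 hm

theorem opS_mem_primitives (m : ℕ) (x : (⨂[k]^(m + 2)) (primitives k B)) :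
    opS σ m (tpow (primitives k B).subtype (m + 2) x) ∈ primitives k B := by
  refine apply_mem_primitives (hA.braiding.restrict Subtype.val_injective hj)
    (involutive_restrict hσ Subtype.val_injective hj) ?_ x
  obtain ⟨u, y, z, h, hu⟩ := Env.exists_eq_append_pair (List.length_range (n := m + 2))
  rw [h, Env.ap_opS hu]
  exact Env.apS_mem_prims hA hσ hj h1 hm Env.gen_mem_gens gen_mem_prims u y z

theorem opPhi_mem_primitives (m n : ℕ) (x : (⨂[k]^(m + n)) (primitives k B)) :
    opPhi σ m n (tpow (primitives k B).subtype (m + n) x) ∈ primitives k B := by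
  cases n with
  | zero => exact zero_mem _
  | succ n =>
    refine apply_mem_primitives (hA.braiding.restrict Subtype.val_injective hj)
      (involutive_restrict hσ Subtype.val_injective hj) ?_ x
    rw [← List.take_append_drop m (List.range (m + (n + 1)))]
    exact Env.ap_opPhi_mem_prims hA hσ hj h1 hm Env.gen_mem_gens gen_mem_prims (by simp) (by simp)

end Closed

end

end BraidedSabinin

theorem corollary7p1 {k : Type*} [Field k] [CharZero k]
    {B : Type*} [NonAssocRing B] [Module k B] [IsScalarTower k B B] [SMulCommClass k B B]
    [Coalgebra k B] (τ : B ⊗[k] B →ₗ[k] B ⊗[k] B) (ldiv rdiv : B →ₗ[k] B →ₗ[k] B)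
    (hB : BraidedSabinin.IsBraidedHopfAlgebra τ ldiv rdiv) (hτ : τ ∘ₗ τ = LinearMap.id) :
    ∃ (τ' : BraidedSabinin.primitives k B ⊗[k] BraidedSabinin.primitives k B →ₗ[k]
          BraidedSabinin.primitives k B ⊗[k] BraidedSabinin.primitives k B)
      (S : ∀ m : ℕ, (⨂[k]^(m + 2)) (BraidedSabinin.primitives k B) →ₗ[k]
          BraidedSabinin.primitives k B)
      (Φ : ∀ m n : ℕ, (⨂[k]^(m + n)) (BraidedSabinin.primitives k B) →ₗ[k]
          BraidedSabinin.primitives k B),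
      TensorProduct.map (BraidedSabinin.primitives k B).subtype
          (BraidedSabinin.primitives k B).subtype ∘ₗ τ' =
        τ ∘ₗ TensorProduct.map (BraidedSabinin.primitives k B).subtype
          (BraidedSabinin.primitives k B).subtype ∧
      (∀ m : ℕ, (BraidedSabinin.primitives k B).subtype ∘ₗ S m =
        BraidedSabinin.opS τ m ∘ₗ
          PiTensorProduct.map (fun _ => (BraidedSabinin.primitives k B).subtype)) ∧
      (∀ m n : ℕ, 1 ≤ m → 2 ≤ n → (BraidedSabinin.primitives k B).subtype ∘ₗ Φ m n =
        BraidedSabinin.opPhi τ m n ∘ₗ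
          PiTensorProduct.map (fun _ => (BraidedSabinin.primitives k B).subtype)) ∧
      BraidedSabinin.IsSabininTauAlgebra τ' S Φ := by
  obtain ⟨τ', hj⟩ := BraidedSabinin.exists_restrict_tau hB.algebra hB.coalgebra hτ
  have hS := BraidedSabinin.opS_mem_primitives hB.algebra hτ hj hB.comul_one hB.comul_mul
  have hΦ := BraidedSabinin.opPhi_mem_primitives hB.algebra hτ hj hB.comul_one hB.comul_mul
  -- The operations are corestrictions, so their compatibility with the inclusion holds by
  -- definition.
  refine ⟨τ', fun m => LinearMap.codRestrict _ (BraidedSabinin.opS τ m ∘ₗ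
      BraidedSabinin.tpow (BraidedSabinin.primitives k B).subtype (m + 2)) (hS m),
    fun m n => LinearMap.codRestrict _ (BraidedSabinin.opPhi τ m n ∘ₗ
      BraidedSabinin.tpow (BraidedSabinin.primitives k B).subtype (m + n)) (hΦ m n),
    hj, fun m => rfl, fun m n _ _ => rfl, ?_⟩
  exact (hB.algebra.isSabininTauAlgebra hτ).restrict Subtype.val_injective hj (fun m => rfl)
    fun m n => rfl
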